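/- **Setting.** There are $K+2$ nodes on a line: the end nodes $A$ and $B$ at distance $L>0$, and $K$ repeater nodes strictly between them, at positions that may be chosen. Local quantum operations are arbitrary, error-free and instantaneous. Classical communication is error-free and travels at speed $c>0$. Quantum systems ("photons") also travel at speed $c$ between distinct nodes, but each of them is lost, independently, with a probability that lies strictly between $0$ and $1$ and depends only on the length of the link; whether it has been lost becomes known at the receiving node at the planned arrival time. At time $0$ all nodes start at once and share no entanglement, so that the time for preparing entanglement is counted. A protocol consists of finitely many operations and finitely many finite-dimensional systems; each operation may depend on all the classical information that can have reached its node. A protocol *implements* a bipartite unitary $U$ on $\mathcal H_A\otimes\mathcal H_B$ *unambiguously in total time* $t$ if it is finished by time $t$ and there is a $p$ with $0<p\le 1$, independent of the input, such that with probability $p$ exactly $U$ is applied to the input state, and with probability $1-p$ the original input state is recovered at $A$ and $B$, where by time $t$ both end nodes know, from the classical information available to them, which of the two cases has happened. **Theorem.** Let $T(K)$ be the minimum (infimum) of all times $t$ that are sufficient for the unambiguous implementation of an arbitrarily given bipartite unitary, of any finite dimensions $d_A,d_B\ge 1$, between $A$ and $B$ with the help of $K$ repeater nodes. Then 1. $\frac{2L}{c}\le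 T(0)\le\frac{3L}{c}$, 2. $T(1)=\frac{3L}{2c}$, 3. $\frac{5L}{4c}\le T(2)\le\frac{7L}{5c}$, 4. $T(3)=\frac{7L}{6c}$. Moreover, every bipartite unitary can be implemented unambiguously in a total time equal to the stated upper bound: in time $\frac{3L}{c}$ without repeater nodes, and, with the repeater nodes at the following distances from $A$, in time $\frac{3L}{2c}$ with one at $\frac L2$, in time $\frac{7L}{5c}$ with two at $\frac L5,\frac{3L}5$, and in time $\frac{7L}{6c}$ with three at $\frac L6,\frac L2,\frac{5L}6$. -/

import Mathlib

open scoped Matrix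

noncomputable section

namespace RepeaterNet

/-- The quantum registers of a protocol: the input/output system of each end node, `m` local
memories, and `n` photonic systems, each of which is transmitted (at most) once. -/
inductive Reg (m n : ℕ) : Type
  | inA : Reg m n
  | inB : Reg m n
  | mem (i : Fin m) : Reg m n
  | photon (j : Fin n) : Reg m n
  deriving DecidableEq, Fintype

/-- The dimension of each register. -/
def regDim (dA dB : ℕ) {m n : ℕ} (memDim : Fin m → ℕ) (photonDim : Fin n → ℕ) : Reg m n → ℕ
  | .inA => dA
  | .inB => dB
  | .mem i => memDim i
  | .photon j => photonDim j

/-- Positions of the `K + 2` nodes on the line: `A` is node `0`, at position `0`; `B` is the last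
node, at position `L`; the `K` repeater nodes lie strictly between, in increasing order. -/
structure IsPlacement (K : ℕ) (L : ℝ) (pos : Fin (K + 2) → ℝ) : Prop where
  strictMono : StrictMono pos
  pos_A : pos 0 = 0
  pos_B : pos (Fin.last (K + 1)) = L

/-- A signal that leaves position `x` at time `s` can be at position `y` at time `t`. -/
def Reaches (c x s y t : ℝ) : Prop := |x - y| ≤ c * (t - s)

/-- A matrix, indexed by the joint basis configurations of a family of registers, is of the form
`M' ⊗ 1` with `M'` acting on the registers of `S` and `1` the identity on all the others. -/
def ActsOnlyOn {R : Type} {d : R → ℕ} (S : Set R)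
    (M : Matrix (∀ r, Fin (d r)) (∀ r, Fin (d r)) ℂ) : Prop :=
  (∀ x y, (∃ r, r ∉ S ∧ x r ≠ y r) → M x y = 0) ∧
  (∀ x y x' y', (∀ r, r ∉ S → x r = y r) → (∀ r, r ∉ S → x' r = y' r) →
    (∀ r, r ∈ S → x r = x' r ∧ y r = y' r) → M x y = M x' y')

/-- The space-time layout of a protocol for nodes `Fin (K + 2)` and input systems of dimensions
`dA`, `dB`: finitely many memories and photons, each prepared in a fixed basis state (so that
nothing is entangled at the start), and finitely many local operations, each performed at a node
at a time and having one of `k` classical outcomes. Photon `j` is emitted by node `src j`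
towards node `dst j` at time `dep j`. -/
structure Layout (K dA dB : ℕ) where
  /-- number of memories -/
  m : ℕ
  /-- number of photons -/
  n : ℕ
  /-- number of local operations -/
  N : ℕ
  /-- number of possible outcomes of a local operation -/
  k : ℕ
  memDim : Fin m → ℕ
  memInit : ∀ i, Fin (memDim i)
  memNode : Fin m → Fin (K + 2)
  photonDim : Fin n → ℕ
  photonInit : ∀ j, Fin (photonDim j)
  src : Fin n → Fin (K + 2)
  dst : Fin n → Fin (K + 2)
  dep : Fin n → ℝ
  node : Fin N → Fin (K + 2)
  time : Fin N → ℝ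

namespace Layout

variable {K dA dB : ℕ} (P : Layout K dA dB)

/-- Joint basis configurations of all registers. -/
abbrev Cfg : Type := ∀ r : Reg P.m P.n, Fin (regDim dA dB P.memDim P.photonDim r)

/-- A complete classical record of a run: which photons are lost (`ω.1 j = true` iff photon `j` is
lost), and the outcome `ω.2 e` of each local operation `e`. -/
abbrev Record : Type := (Fin P.n → Bool) × (Fin P.N → Fin P.k)

/-- The planned arrival time of photon `j`. -/
def arr (c : ℝ) (pos : Fin (K + 2) → ℝ) (j : Fin P.n) : ℝ :=
  P.dep j + |pos (P.src j) - pos (P.dst j)| / c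

/-- The records `ω` and `ω'` coincide in all the classical information that can be known at node
`v` at time `t`: the arrival or loss of each photon, which becomes known at its destination at its
planned arrival time, and the outcome of each of the first `q` local operations, as far as a
signal from there reaches node `v` by time `t`. -/
def SameView (c : ℝ) (pos : Fin (K + 2) → ℝ) (q : ℕ) (v : Fin (K + 2)) (t : ℝ)
    (ω ω' : P.Record) : Prop :=
  (∀ j, Reaches c (pos (P.dst j)) (P.arr c pos j) (pos v) t → ω.1 j = ω'.1 j) ∧
  (∀ e : Fin P.N, (e : ℕ) < q → Reaches c (pos (P.node e)) (P.time e) (pos v) t → ω.2 e = ω'.2 e)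

/-- The registers that are at node `v` at time `t`, when `lost` is the set of lost photons. A photon
is at its source until it departs and, unless it is lost, at its destination once it has arrived;
at all other times it is out of reach of every node. -/
def regsAt (c : ℝ) (pos : Fin (K + 2) → ℝ) (v : Fin (K + 2)) (t : ℝ) (lost : Fin P.n → Bool) :
    Set (Reg P.m P.n) :=
  {r | match r with
    | .inA => v = 0
    | .inB => v = Fin.last (K + 1)
    | .mem i => v = P.memNode i
    | .photon j => (v = P.src j ∧ t ≤ P.dep j) ∨
        (v = P.dst j ∧ P.arr c pos j ≤ t ∧ lost j = false)}

open Classical in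
/-- The initial vector: the input `ψ` on the end nodes, all other registers in their fixed initial
basis states. -/
def initial (ψ : Fin dA × Fin dB → ℂ) : P.Cfg → ℂ := fun x =>
  if (∀ i, x (.mem i) = P.memInit i) ∧ (∀ j, x (.photon j) = P.photonInit j)
  then ψ (x .inA, x .inB) else 0

/-- The probability of the loss pattern `lost`, the photons being lost independently, with
probability `loss ℓ` over a link of length `ℓ`. -/
def lossWeight (pos : Fin (K + 2) → ℝ) (loss : ℝ → ℝ) (lost : Fin P.n → Bool) : ℝ :=
  ∏ j, if lost j = true then loss |pos (P.src j) - pos (P.dst j)|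
    else 1 - loss |pos (P.src j) - pos (P.dst j)|

end Layout

/-- A protocol that starts at time `0` and is finished at time `t`, with nodes at positions `pos`,
signals of speed `c`, and input systems of dimensions `dA` and `dB`. Local operations take no time
and are arbitrary quantum instruments on the registers that are present; classical communication is
error-free and costs nothing except for the travel time; photons may be lost. -/
structure Protocol (K dA dB : ℕ) (c : ℝ) (pos : Fin (K + 2) → ℝ) (t : ℝ)
    extends Layout K dA dB where
  src_ne_dst : ∀ j, src j ≠ dst j
  dep_nonneg : ∀ j, 0 ≤ dep j
  time_nonneg : ∀ e, 0 ≤ time e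
  time_le : ∀ e, time e ≤ t
  time_mono : Monotone time
  /-- `kraus e ω` is the Kraus operator of local operation `e` for outcome `ω.2 e`, when the
  instrument is chosen according to what record `ω` shows at that node and time. -/
  kraus : Fin N → toLayout.Record → Matrix toLayout.Cfg toLayout.Cfg ℂ
  /-- the choice of the instrument uses only the available classical information -/
  kraus_congr : ∀ (e : Fin N) ω ω', toLayout.SameView c pos e.val (node e) (time e) ω ω' → ω.2 e = ω'.2 e →
    kraus e ω = kraus e ω'
  /-- operations are local -/
  kraus_local : ∀ e ω, ActsOnlyOn (toLayout.regsAt c pos (node e) (time e) ω.1) (kraus e ω)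
  /-- the Kraus operators of all outcomes together preserve probability -/
  kraus_complete : ∀ (e : Fin N) (ω : toLayout.Record),
    ∑ o : Fin k, (kraus e (ω.1, Function.update ω.2 e o))ᴴ *
      kraus e (ω.1, Function.update ω.2 e o) = 1

namespace Protocol

variable {K dA dB : ℕ} {c : ℝ} {pos : Fin (K + 2) → ℝ} {t : ℝ} (P : Protocol K dA dB c pos t)

/-- The (unnormalized) joint state of all registers, lost photons included, at the end of the run
with record `ω` on the input `ψ`: the Kraus operators are applied in chronological order. -/
def final (ω : P.Record) (ψ : Fin dA × Fin dB → ℂ) : P.Cfg → ℂ :=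
  (List.ofFn fun e => P.kraus e ω).reverse.prod *ᵥ P.initial ψ

/-- The probability of the record `ω` on the normalized input `ψ`. -/
def prob (loss : ℝ → ℝ) (ω : P.Record) (ψ : Fin dA × Fin dB → ℂ) : ℝ :=
  P.lossWeight pos loss ω.1 * ∑ x, ‖P.final ω ψ x‖ ^ 2

/-- In the run with record `ω`, exactly `V` is applied to the input: every input `ψ` is turned into
`V ψ` on the original input systems, in a product with a state of all other registers (lost photons
included) that does not depend on `ψ`. -/
def Applies (ω : P.Record) (V : Matrix (Fin dA × Fin dB) (Fin dA × Fin dB) ℂ) : Prop :=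
  ∃ η : (∀ i, Fin (P.memDim i)) → (∀ j, Fin (P.photonDim j)) → ℂ,
    ∀ (ψ : Fin dA × Fin dB → ℂ) (x : P.Cfg), P.final ω ψ x =
      (V *ᵥ ψ) (x .inA, x .inB) * η (fun i => x (.mem i)) (fun j => x (.photon j))

open Classical in
/-- Unambiguous implementation of `U`: by the end of the protocol each end node knows, from the
classical information that has reached it, whether the run succeeded (`flagA`, `flagB`), and the two
always agree; in case of success exactly `U` has been applied; in case of failure the input has been
restored; the probability `p` of success is positive and does not depend on the input. -/
def Implements (loss : ℝ → ℝ) (U : Matrix (Fin dA × Fin dB) (Fin dA × Fin dB) ℂ) : Prop :=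
  ∃ flagA flagB : P.Record → Prop,
    (∀ ω ω', P.SameView c pos P.N 0 t ω ω' → (flagA ω ↔ flagA ω')) ∧
    (∀ ω ω', P.SameView c pos P.N (Fin.last (K + 1)) t ω ω' → (flagB ω ↔ flagB ω')) ∧
    (∀ ω, ¬ (flagA ω ↔ flagB ω) → ∀ ψ, P.final ω ψ = 0) ∧
    (∀ ω, flagA ω → flagB ω → P.Applies ω U) ∧
    (∀ ω, ¬ flagA ω → ¬ flagB ω → P.Applies ω 1) ∧
    ∃ p : ℝ, 0 < p ∧ ∀ ψ : Fin dA × Fin dB → ℂ, ∑ q, ‖ψ q‖ ^ 2 = 1 →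
      ∑ ω : P.Record, (if flagA ω ∧ flagB ω then P.prob loss ω ψ else 0) = p

end Protocol

/-- With nodes at the positions `pos`, the bipartite unitary `U` can be implemented unambiguously
in total time `t`. -/
def ImplementableAt (K : ℕ) (c : ℝ) (loss : ℝ → ℝ) (pos : Fin (K + 2) → ℝ) (t : ℝ) {dA dB : ℕ}
    (U : Matrix (Fin dA × Fin dB) (Fin dA × Fin dB) ℂ) : Prop :=
  ∃ P : Protocol K dA dB c pos t, P.Implements loss U

/-- The times that are sufficient for the unambiguous implementation of an arbitrarily given
bipartite unitary (of any finite dimensions) between end nodes at distance `L` with the help of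
`K` repeater nodes, suitably placed. -/
def sufficientTimes (K : ℕ) (L c : ℝ) (loss : ℝ → ℝ) : Set ℝ :=
  {t | ∀ dA dB : ℕ, 0 < dA → 0 < dB → ∀ U ∈ Matrix.unitaryGroup (Fin dA × Fin dB) ℂ,
    ∃ pos : Fin (K + 2) → ℝ, IsPlacement K L pos ∧ ImplementableAt K c loss pos t U}

/-- The minimum of the sufficient times (their infimum, should it not be attained). -/
def minTime (K : ℕ) (L c : ℝ) (loss : ℝ → ℝ) : ℝ := sInf (sufficientTimes K L c loss)

/-- Time `t` suffices for every bipartite unitary with one and the same placement `pos`. -/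
def SuffAt (K : ℕ) (L c : ℝ) (loss : ℝ → ℝ) (pos : Fin (K + 2) → ℝ) (t : ℝ) : Prop :=
  IsPlacement K L pos ∧
  ∀ dA dB : ℕ, 0 < dA → 0 < dB → ∀ U ∈ Matrix.unitaryGroup (Fin dA × Fin dB) ℂ,
    ImplementableAt K c loss pos t U

end RepeaterNet

end

/-! Lower bounds. Cut the line between two neighbouring nodes at distance `g`, let `S` be the side
of `A`, and let `x` be the position of the last node of `S`. Before time `g / c` nothing from beyond
the cut can have reached `S`, not even the news that a photon was lost. Suppose that no signal
leaving `S` at time `g / c` or later reaches `B` by time `t`. Then `B` depends on `S` only through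
what `S` does in isolation. The nodes of `S` do exactly the same in the runs in which all photons
across the cut are lost. In such a run, too, the input or its image under the unitary ends up in the
two end systems, in a product with all other registers, lost photons included. So the crossing
photons carry no information about the input of `A`, and the output at `B` cannot depend on that
input. The swap gate contradicts this, whence `g + (L - x) ≤ c * t`; the mirror image gives the
bounds seen from `A`. Linear combinations of these inequalities over all cuts eliminate the
positions. The argument is carried by `Protocol.mulVec_total_eq_zero` (no leakage),
`Protocol.swap_bound` and `exists_placement_of_mem_sufficientTimes`.

Upper bounds. Both inputs are teleported to a central node over at most two hops each, the unitary
is applied there, and the results are teleported back. For each hop two entangled pairs, one for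
each direction, are prepared at time `0` at the node nearer to the centre, and one half of each is
sent outwards. The outer node measures only if both photons of the hop have arrived, so a state
never enters a hop by which it could not return. If a hop is unusable, the state waits in front of
it, the gate is omitted, and whatever was moved is brought back. Success depends on the loss pattern
alone, hence its probability is independent of the input. Both ends learn it in time, since the news
travels with the corrections. This is `teleport`, `Step.carries_final` and
`Plan.protocol_implements`; a `Plan` isolates the causal inequalities that the schedule needs, and
the four placements satisfy them. -/

noncomputable section

namespace RepeaterNet

set_option linter.unusedSectionVars false

/-! ### Locality of operators on a family of registers -/

section ActsOnlyOn

variable {R : Type} {d : R → ℕ}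

theorem ActsOnlyOn.mono {S T : Set R} {M : Matrix (∀ r, Fin (d r)) (∀ r, Fin (d r)) ℂ}
    (h : ActsOnlyOn S M) (hST : S ⊆ T) : ActsOnlyOn T M := by
  classical
  refine ⟨fun x y ⟨r, hr, hxy⟩ => h.1 x y ⟨r, fun hs => hr (hST hs), hxy⟩, ?_⟩
  intro x y x' y' h1 h2 h3
  by_cases hx : ∃ r, r ∉ S ∧ x r ≠ y r
  · obtain ⟨r, hr, hne⟩ := hx
    have hrT : r ∈ T := by by_contra hc; exact hne (h1 r hc)
    rw [h.1 x y ⟨r, hr, hne⟩, h.1 x' y' ⟨r, hr, by rwa [← (h3 r hrT).1, ← (h3 r hrT).2]⟩]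
  · push Not at hx
    refine h.2 x y x' y' hx (fun r hr => ?_) (fun r hr => h3 r (hST hr))
    by_cases hrT : r ∈ T
    · rw [← (h3 r hrT).1, ← (h3 r hrT).2, hx r hr]
    · exact h2 r hrT

variable [Fintype R] [DecidableEq R]

theorem ActsOnlyOn.one (S : Set R) :
    ActsOnlyOn S (1 : Matrix (∀ r, Fin (d r)) (∀ r, Fin (d r)) ℂ) := by
  refine ⟨fun x y ⟨r, _, h⟩ => Matrix.one_apply_ne (fun e => h (by rw [e])), ?_⟩
  intro x y x' y' h1 h2 h3
  have : x = y ↔ x' = y' := by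
    constructor
    · rintro rfl
      funext r
      by_cases hr : r ∈ S
      · rw [← (h3 r hr).1, ← (h3 r hr).2]
      · exact h2 r hr
    · rintro rfl
      funext r
      by_cases hr : r ∈ S
      · rw [(h3 r hr).1, (h3 r hr).2]
      · exact h1 r hr
  simp [Matrix.one_apply, this]

theorem ActsOnlyOn.smul {S : Set R} {M : Matrix (∀ r, Fin (d r)) (∀ r, Fin (d r)) ℂ}
    (h : ActsOnlyOn S M) (a : ℂ) : ActsOnlyOn S (a • M) := by
  refine ⟨fun x y hxy => by simp [h.1 x y hxy], fun x y x' y' h1 h2 h3 => ?_⟩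
  simp [h.2 x y x' y' h1 h2 h3]

open Classical in
-- Only configurations that agree with `x` outside `S` enter the sum at `x`. Replacing their part
-- outside `S` by that of `x'` is a bijection onto the configurations that enter at `x'`, and matrix
-- elements are unchanged by it.
theorem ActsOnlyOn.mulVec_apply_congr {S : Set R} {M : Matrix (∀ r, Fin (d r)) (∀ r, Fin (d r)) ℂ}
    (h : ActsOnlyOn S M) {x x' : ∀ r, Fin (d r)} (hS : ∀ r ∈ S, x r = x' r)
    {v v' : (∀ r, Fin (d r)) → ℂ}
    (hv : ∀ w w', (∀ r, r ∉ S → w r = x r) → (∀ r, r ∉ S → w' r = x' r) →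
      (∀ r ∈ S, w r = w' r) → v w = v' w') :
    (M *ᵥ v) x = (M *ᵥ v') x' := by
  simp only [Matrix.mulVec, dotProduct]
  rw [← Finset.sum_filter_of_ne (p := fun w => ∀ r, r ∉ S → w r = x r),
    ← Finset.sum_filter_of_ne (s := Finset.univ) (f := fun w => M x' w * v' w)
      (p := fun w => ∀ r, r ∉ S → w r = x' r)]
  · refine Finset.sum_bij' (fun w _ => S.piecewise w x') (fun w _ => S.piecewise w x) ?_ ?_ ?_ ?_ ?_
    · intro w _
      simp only [Finset.mem_filter, Finset.mem_univ, true_and]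
      intro r hr; simp [hr]
    · intro w _
      simp only [Finset.mem_filter, Finset.mem_univ, true_and]
      intro r hr; simp [hr]
    · intro w hw
      simp only [Finset.mem_filter, Finset.mem_univ, true_and] at hw
      funext r
      by_cases hr : r ∈ S <;> simp [hr, hw]
    · intro w hw
      simp only [Finset.mem_filter, Finset.mem_univ, true_and] at hw
      funext r
      by_cases hr : r ∈ S <;> simp [hr, hw]
    · intro w hw
      simp only [Finset.mem_filter, Finset.mem_univ, true_and] at hw
      rw [h.2 x w x' (S.piecewise w x') (fun r hr => (hw r hr).symm) (fun r hr => by simp [hr])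
        (fun r hr => ⟨hS r hr, by simp [hr]⟩),
        hv w (S.piecewise w x') hw (fun r hr => by simp [hr]) (fun r hr => by simp [hr])]
  · intro w _ hne r hr
    by_contra hc
    exact hne (by rw [h.1 x' w ⟨r, hr, Ne.symm hc⟩, zero_mul])
  · intro w _ hne r hr
    by_contra hc
    exact hne (by rw [h.1 x w ⟨r, hr, Ne.symm hc⟩, zero_mul])

theorem ActsOnlyOn.mul {S : Set R} {M N : Matrix (∀ r, Fin (d r)) (∀ r, Fin (d r)) ℂ}
    (hM : ActsOnlyOn S M) (hN : ActsOnlyOn S N) : ActsOnlyOn S (M * N) := by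
  have key : ∀ x y, (M * N) x y = (M *ᵥ fun w => N w y) x := fun x y => rfl
  refine ⟨?_, ?_⟩
  · rintro x y ⟨r, hr, hne⟩
    rw [Matrix.mul_apply]
    refine Finset.sum_eq_zero fun w _ => ?_
    by_cases hw : x r = w r
    · rw [hN.1 w y ⟨r, hr, hw ▸ hne⟩, mul_zero]
    · rw [hM.1 x w ⟨r, hr, hw⟩, zero_mul]
  · intro x y x' y' h1 h2 h3
    rw [key, key]
    refine hM.mulVec_apply_congr (fun r hr => (h3 r hr).1) ?_
    intro w w' hw hw' hww
    exact hN.2 w y w' y' (fun r hr => by rw [hw r hr, h1 r hr])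
      (fun r hr => by rw [hw' r hr, h2 r hr]) (fun r hr => ⟨hww r hr, (h3 r hr).2⟩)

open Classical in
-- An intermediate configuration must agree with `x` off `S` and with `y` off `T`, hence on `S`.
-- This leaves a single term, from which commutation can be read off.
theorem ActsOnlyOn.mul_apply_of_disjoint {S T : Set R} (hST : Disjoint S T)
    {M N : Matrix (∀ r, Fin (d r)) (∀ r, Fin (d r)) ℂ}
    (hM : ActsOnlyOn S M) (hN : ActsOnlyOn T N) (x y : ∀ r, Fin (d r)) :
    (M * N) x y = M x (S.piecewise y x) * N (S.piecewise y x) y := by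
  rw [Matrix.mul_apply, Finset.sum_eq_single (S.piecewise y x)]
  · intro w _ hw
    have : ∃ r, w r ≠ S.piecewise y x r := by
      by_contra hc; push Not at hc; exact hw (funext hc)
    obtain ⟨r, hr⟩ := this
    by_cases hrS : r ∈ S
    · simp only [hrS, Set.piecewise_eq_of_mem] at hr
      rw [hN.1 w y ⟨r, Set.disjoint_left.1 hST hrS, hr⟩, mul_zero]
    · simp only [hrS, not_false_eq_true, Set.piecewise_eq_of_notMem] at hr
      rw [hM.1 x w ⟨r, hrS, Ne.symm hr⟩, zero_mul]
  · simp

theorem ActsOnlyOn.commute {S T : Set R} (hST : Disjoint S T)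
    {M N : Matrix (∀ r, Fin (d r)) (∀ r, Fin (d r)) ℂ}
    (hM : ActsOnlyOn S M) (hN : ActsOnlyOn T N) : Commute M N := by
  classical
  ext x y
  rw [hM.mul_apply_of_disjoint hST hN, hN.mul_apply_of_disjoint hST.symm hM]
  have hd : ∀ r, r ∈ S → r ∉ T := fun r hr => Set.disjoint_left.1 hST hr
  by_cases hxy : ∃ r, r ∉ S ∧ r ∉ T ∧ x r ≠ y r
  · obtain ⟨r, hS, hT, hne⟩ := hxy
    rw [hN.1 _ y ⟨r, hT, by simpa [hS] using hne⟩, hM.1 _ y ⟨r, hS, by simpa [hT] using hne⟩,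
      mul_zero, mul_zero]
  · push Not at hxy
    rw [mul_comm (N x _)]
    congr 1
    · refine hM.2 _ _ _ _ (fun r hr => by simp [hr]) (fun r hr => ?_) (fun r hr => ?_)
      · by_cases hT : r ∈ T <;> simp [hT, hxy r hr]
      · simp [hr, hd r hr]
    · refine hN.2 _ _ _ _ (fun r hr => ?_) (fun r hr => by simp [hr]) (fun r hr => ?_)
      · by_cases hS : r ∈ S <;> simp [hS]
        exact hxy r hS hr
      · have : r ∉ S := fun h => hd r h hr
        simp [hr, this]

end ActsOnlyOn

/-! ### Chronological products of operators and instruments -/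

section opProd

/-- The product of a finite sequence of operators, the first one acting first. -/
def opProd {A : Type*} [Monoid A] {N : ℕ} (F : Fin N → A) : A := (List.ofFn F).reverse.prod

theorem opProd_succ {A : Type*} [Monoid A] {N : ℕ} (F : Fin (N + 1) → A) :
    opProd F = F (Fin.last N) * opProd (fun e => F e.castSucc) := by
  rw [opProd, opProd, List.ofFn_succ', List.concat_eq_append]
  simp

@[simp] theorem opProd_zero {A : Type*} [Monoid A] (F : Fin 0 → A) : opProd F = 1 := by
  simp [opProd]

theorem opProd_induction {A : Type*} [Monoid A] {p : A → Prop} (h1 : p 1)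
    (hmul : ∀ a b, p a → p b → p (a * b)) {N : ℕ} (F : Fin N → A) (hF : ∀ e, p (F e)) :
    p (opProd F) := by
  induction N with
  | zero => simpa using h1
  | succ N ih =>
    rw [opProd_succ]
    exact hmul _ _ (hF _) (ih _ fun e => hF _)

open Classical in
/-- If the operators selected by `D` commute with all earlier ones that are not selected, they can
be made to act first. -/
theorem opProd_eq_mul {A : Type*} [Monoid A] {N : ℕ} (F : Fin N → A) (D : Fin N → Prop)
    (h : ∀ e e', D e → ¬ D e' → e' < e → Commute (F e) (F e')) :
    opProd F = opProd (fun e => if D e then 1 else F e) *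
      opProd (fun e => if D e then F e else 1) := by
  induction N with
  | zero => simp
  | succ N ih =>
    rw [opProd_succ, ih _ (fun e => D e.castSucc)
      (fun e e' he he' hlt => h _ _ he he' (Fin.castSucc_lt_castSucc_iff.2 hlt)),
      opProd_succ (fun e => if D e then 1 else F e), opProd_succ (fun e => if D e then F e else 1)]
    by_cases hD : D (Fin.last N)
    · simp only [hD, if_true, one_mul]
      have hc : Commute (F (Fin.last N))
          (opProd fun e : Fin N => if D e.castSucc then 1 else F e.castSucc) := by
        refine opProd_induction (p := fun a => Commute (F (Fin.last N)) a) (Commute.one_right _)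
          (fun a b ha hb => ha.mul_right hb) _ fun e => ?_
        split_ifs with he
        · exact Commute.one_right _
        · exact h _ _ hD he (Fin.castSucc_lt_last e)
      rw [← mul_assoc, hc.eq, mul_assoc]
    · simp only [hD, if_false, one_mul, mul_assoc]

variable {X : Type*} [Fintype X] [DecidableEq X]

theorem sum_norm_sq_eq (v : X → ℂ) : ((∑ x, ‖v x‖ ^ 2 : ℝ) : ℂ) = star v ⬝ᵥ v := by
  simp [dotProduct, Complex.conj_mul']

theorem sum_norm_sq_mulVec {ι : Type*} [Fintype ι] (M : ι → Matrix X X ℂ)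
    (hM : ∑ a, (M a)ᴴ * M a = 1) (v : X → ℂ) :
    ∑ a, ∑ x, ‖(M a *ᵥ v) x‖ ^ 2 = ∑ x, ‖v x‖ ^ 2 := by
  have : ((∑ a, ∑ x, ‖(M a *ᵥ v) x‖ ^ 2 : ℝ) : ℂ) = ((∑ x, ‖v x‖ ^ 2 : ℝ) : ℂ) := by
    rw [Complex.ofReal_sum]
    simp only [sum_norm_sq_eq]
    calc ∑ a, star (M a *ᵥ v) ⬝ᵥ (M a *ᵥ v) = ∑ a, star v ⬝ᵥ (((M a)ᴴ * M a) *ᵥ v) := by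
          refine Finset.sum_congr rfl fun a _ => ?_
          rw [Matrix.star_mulVec, ← Matrix.dotProduct_mulVec, Matrix.mulVec_mulVec]
      _ = star v ⬝ᵥ v := by
          rw [← dotProduct_sum, ← Matrix.sum_mulVec, hM, Matrix.one_mulVec]
  exact_mod_cast this

theorem eq_zero_of_sum_norm_sq {v : X → ℂ} (h : ∑ x, ‖v x‖ ^ 2 = 0) : v = 0 := by
  rw [Finset.sum_eq_zero_iff_of_nonneg (fun _ _ => by positivity)] at h
  funext x
  simpa using h x (Finset.mem_univ x)

open Classical in
/-- If a sequence of instruments, run on `v` with the outcomes outside `D` frozen and only the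
instruments in `D` applied, leads to the zero vector for all outcomes, then `v` is zero. -/
theorem eq_zero_of_opProd_mulVec {N k : ℕ} (F : Fin N → (Fin N → Fin k) → Matrix X X ℂ)
    (D : Fin N → Prop) (o₀ : Fin N → Fin k)
    (hF : ∀ e o o', (∀ e' ≤ e, o e' = o' e') → F e o = F e o')
    (hc : ∀ e o, ∑ a, (F e (Function.update o e a))ᴴ * F e (Function.update o e a) = 1)
    (v : X → ℂ)
    (hv : ∀ o, (∀ e, ¬ D e → o e = o₀ e) →
      opProd (fun e => if D e then F e o else 1) *ᵥ v = 0) : v = 0 := by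
  induction N with
  | zero => simpa using hv o₀ (fun e => e.elim0)
  | succ N ih =>
    refine ih (fun e o => F e.castSucc (Fin.snoc o (o₀ (Fin.last N)))) (fun e => D e.castSucc)
      (fun e => o₀ e.castSucc) ?_ ?_ ?_
    · intro e o o' h
      refine hF _ _ _ fun e' he' => ?_
      induction e' using Fin.lastCases with
      | last => exact absurd he' (by simp)
      | cast e' => simpa using h e' (Fin.castSucc_le_castSucc_iff.1 he')
    · intro e o
      have := hc e.castSucc (Fin.snoc (α := fun _ => Fin k) o (o₀ (Fin.last N)))
      simpa only [Fin.snoc_update] using this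
    · intro o ho
      set u := opProd (fun e => if D (Fin.castSucc e) then
        F e.castSucc (Fin.snoc o (o₀ (Fin.last N))) else 1) *ᵥ v with hu
      have hprod : ∀ a, (D (Fin.last N) ∨ a = o₀ (Fin.last N)) →
          (if D (Fin.last N) then F (Fin.last N) (Fin.snoc o a) else 1) *ᵥ u = 0 := by
        intro a ha
        have := hv (Fin.snoc (α := fun _ => Fin k) o a) (by
          intro e he
          induction e using Fin.lastCases with
          | last => simpa using ha.resolve_left he
          | cast e => simpa using ho e he)
        rw [opProd_succ, ← Matrix.mulVec_mulVec] at this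
        -- By causality the earlier instruments do not depend on the last outcome, so it may be
        -- replaced by the frozen one.
        have e1 : (fun e : Fin N => if D e.castSucc then F e.castSucc
            (Fin.snoc (α := fun _ => Fin k) o a) else 1) =
            fun e : Fin N => if D e.castSucc then F e.castSucc
            (Fin.snoc (α := fun _ => Fin k) o (o₀ (Fin.last N))) else 1 := by
          funext e
          rw [hF e.castSucc _ (Fin.snoc (α := fun _ => Fin k) o (o₀ (Fin.last N)))]
          intro e' he'
          induction e' using Fin.lastCases with
          | last => exact absurd he' (by simp)
          | cast e' => simp
        rw [e1] at this
        exact this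
      -- A selected last instrument maps `u` to zero for every outcome, and completeness turns this
      -- into `u = 0`. An unselected one acts as the identity.
      by_cases hD : D (Fin.last N)
      · have h2 := sum_norm_sq_mulVec _ (hc (Fin.last N)
          (Fin.snoc (α := fun _ => Fin k) o (o₀ (Fin.last N)))) u
        simp only [Fin.update_snoc_last] at h2
        refine eq_zero_of_sum_norm_sq (h2.symm.trans ?_)
        refine Finset.sum_eq_zero fun a _ => ?_
        have := hprod a (Or.inl hD)
        rw [if_pos hD] at this
        simp [this]
      · have := hprod _ (Or.inr rfl)
        rwa [if_neg hD, Matrix.one_mulVec] at this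

/-- A sequence of instruments preserves the total probability. -/
theorem sum_opProd_norm_sq {N k : ℕ} (a₀ : Fin k) (F : Fin N → (Fin N → Fin k) → Matrix X X ℂ)
    (hF : ∀ e o o', (∀ e' ≤ e, o e' = o' e') → F e o = F e o')
    (hc : ∀ e o, ∑ a, (F e (Function.update o e a))ᴴ * F e (Function.update o e a) = 1)
    (v : X → ℂ) :
    ∑ o, ∑ x, ‖(opProd (fun e => F e o) *ᵥ v) x‖ ^ 2 = ∑ x, ‖v x‖ ^ 2 := by
  induction N with
  | zero => simp
  | succ N ih =>
    rw [← (Fin.snocEquiv (fun _ => Fin k)).sum_comp, Fintype.sum_prod_type, Finset.sum_comm]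
    rw [← ih (fun e o => F e.castSucc (Fin.snoc o a₀))]
    · refine Finset.sum_congr rfl fun o _ => ?_
      have h2 := sum_norm_sq_mulVec _ (hc (Fin.last N)
        (Fin.snoc (α := fun _ => Fin k) o a₀))
        (opProd (fun e : Fin N => F e.castSucc (Fin.snoc (α := fun _ => Fin k) o a₀)) *ᵥ v)
      simp only [Fin.update_snoc_last] at h2
      rw [← h2]
      refine Finset.sum_congr rfl fun a _ => ?_
      simp only [Fin.snocEquiv, Equiv.coe_fn_mk]
      rw [opProd_succ, ← Matrix.mulVec_mulVec]
      have e1 : (fun e : Fin N => F e.castSucc (Fin.snoc (α := fun _ => Fin k) o a)) =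
          fun e : Fin N => F e.castSucc (Fin.snoc (α := fun _ => Fin k) o a₀) := by
        funext e
        rw [hF e.castSucc _ (Fin.snoc (α := fun _ => Fin k) o a₀)]
        intro e' he'
        induction e' using Fin.lastCases with
        | last => exact absurd he' (by simp)
        | cast e' => simp
      rw [e1]
    · intro e o o' h
      refine hF _ _ _ fun e' he' => ?_
      induction e' using Fin.lastCases with
      | last => exact absurd he' (by simp)
      | cast e' => simpa using h e' (Fin.castSucc_le_castSucc_iff.1 he')
    · intro e o
      have := hc e.castSucc (Fin.snoc (α := fun _ => Fin k) o a₀)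
      simpa only [Fin.snoc_update] using this

end opProd

/-! ### Causal order, and slices of operators -/

theorem Reaches.trans {c x s y t z u : ℝ} (h : Reaches c x s y t) (h' : Reaches c y t z u) :
    Reaches c x s z u := by
  unfold Reaches at *
  have := abs_sub_le x y z
  linarith

theorem Reaches.of_le {c x s t : ℝ} (hc : 0 < c) (h : s ≤ t) : Reaches c x s x t := by
  unfold Reaches
  rw [sub_self, abs_zero]
  exact mul_nonneg hc.le (by linarith)

section Slice

variable {R : Type} [Fintype R] [DecidableEq R] {d : R → ℕ}

open Classical in
/-- The matrix elements of `Y` between the configurations `z` and `y₀` of the registers of `W`, as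
an operator on the remaining registers. -/
def slice (W : Set R) (Y : Matrix (∀ r, Fin (d r)) (∀ r, Fin (d r)) ℂ) (z y₀ : ∀ r, Fin (d r)) :
    Matrix (∀ r, Fin (d r)) (∀ r, Fin (d r)) ℂ :=
  Matrix.of fun x y => if ∀ r ∈ W, x r = y r then Y (W.piecewise z x) (W.piecewise y₀ y) else 0

theorem ActsOnlyOn.slice {G W C : Set R} {Y : Matrix (∀ r, Fin (d r)) (∀ r, Fin (d r)) ℂ}
    (hY : ActsOnlyOn G Y) (hG : G ⊆ W ∪ C) (hWC : Disjoint W C) (z y₀ : ∀ r, Fin (d r)) :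
    ActsOnlyOn C (slice W Y z y₀) := by
  classical
  have hY' := hY.mono hG
  have hd : ∀ r, r ∈ W → r ∉ C := fun r hr => Set.disjoint_left.1 hWC hr
  refine ⟨?_, ?_⟩
  · rintro x y ⟨r, hr, hne⟩
    simp only [RepeaterNet.slice, Matrix.of_apply]
    split_ifs with h
    · by_cases hW : r ∈ W
      · exact absurd (h r hW) hne
      · exact hY'.1 _ _ ⟨r, by simp [hW, hr], by simpa [hW] using hne⟩
    · rfl
  · intro x y x' y' h1 h2 h3
    simp only [RepeaterNet.slice, Matrix.of_apply]
    rw [if_pos (fun r hr => h1 r (hd r hr)), if_pos (fun r hr => h2 r (hd r hr))]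
    refine hY'.2 _ _ _ _ ?_ ?_ ?_
    · intro r hr
      simp only [Set.mem_union, not_or] at hr
      simp [hr.1, h1 r hr.2]
    · intro r hr
      simp only [Set.mem_union, not_or] at hr
      simp [hr.1, h2 r hr.2]
    · intro r hr
      by_cases hW : r ∈ W
      · simp [hW]
      · have hC : r ∈ C := hr.resolve_left hW
        simp [hW, h3 r hC]

open Classical in
-- On a vector whose content of `W` is fixed to `y₀`, slicing loses nothing: as `z` varies, the
-- slices give all components of `Y *ᵥ v`.
theorem slice_mulVec {W : Set R} {Y : Matrix (∀ r, Fin (d r)) (∀ r, Fin (d r)) ℂ}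
    {z y₀ : ∀ r, Fin (d r)} {v : (∀ r, Fin (d r)) → ℂ}
    (hv : ∀ x, v x ≠ 0 → ∀ r ∈ W, x r = y₀ r) (x : ∀ r, Fin (d r)) :
    (slice W Y z y₀ *ᵥ v) x =
      if ∀ r ∈ W, x r = y₀ r then (Y *ᵥ v) (W.piecewise z x) else 0 := by
  simp only [Matrix.mulVec, dotProduct, slice, Matrix.of_apply]
  split_ifs with h
  · refine Finset.sum_congr rfl fun w _ => ?_
    by_cases hw : v w = 0
    · simp [hw]
    · have hw' := hv w hw
      rw [if_pos (fun r hr => by rw [h r hr, hw' r hr])]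
      congr 2
      funext r
      by_cases hr : r ∈ W <;> simp [hr, hw']
  · refine Finset.sum_eq_zero fun w _ => ?_
    by_cases hw : v w = 0
    · simp [hw]
    · rw [if_neg (fun hh => h fun r hr => by rw [hh r hr, hv w hw r hr]), zero_mul]

theorem ActsOnlyOn.mulVec_support {S W : Set R} (hSW : Disjoint S W)
    {M : Matrix (∀ r, Fin (d r)) (∀ r, Fin (d r)) ℂ} (hM : ActsOnlyOn S M)
    {y₀ : ∀ r, Fin (d r)} {v : (∀ r, Fin (d r)) → ℂ}
    (hv : ∀ x, v x ≠ 0 → ∀ r ∈ W, x r = y₀ r) :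
    ∀ x, (M *ᵥ v) x ≠ 0 → ∀ r ∈ W, x r = y₀ r := by
  intro x hx r hr
  by_contra hne
  refine hx (Finset.sum_eq_zero fun w _ => ?_)
  by_cases hw : v w = 0
  · simp [hw]
  · change M x w * v w = 0
    rw [hM.1 x w ⟨r, Set.disjoint_right.1 hSW hr, ?_⟩, zero_mul]
    rw [hv w hw r hr]
    exact hne

end Slice

/-! ### Causality in protocols and the no-leakage argument -/

namespace Protocol

variable {K dA dB : ℕ} {c : ℝ} {pos : Fin (K + 2) → ℝ} {t : ℝ} (P : Protocol K dA dB c pos t)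

/-- The operator applied to the registers in the run with record `ω`. -/
def total (ω : P.Record) : Matrix P.Cfg P.Cfg ℂ := opProd fun e => P.kraus e ω

theorem final_eq (ω : P.Record) (ψ : Fin dA × Fin dB → ℂ) :
    P.final ω ψ = P.total ω *ᵥ P.initial ψ := rfl

theorem kraus_causal (l : Fin P.n → Bool) (e : Fin P.N) (o o' : Fin P.N → Fin P.k)
    (h : ∀ e' ≤ e, o e' = o' e') : P.kraus e (l, o) = P.kraus e (l, o') := by
  refine P.kraus_congr e _ _ ⟨fun _ _ => rfl, fun e' he' _ => h e' ?_⟩ (h e le_rfl)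
  exact le_of_lt he'

/-- Operation `e` can influence what is known at node `v` at the end of the protocol. -/
def Past (v : Fin (K + 2)) (e : Fin P.N) : Prop :=
  Reaches c (pos (P.node e)) (P.time e) (pos v) t

variable {P}

theorem Past.of_reaches {v : Fin (K + 2)} {e e' : Fin P.N} (he : P.Past v e)
    (h : Reaches c (pos (P.node e')) (P.time e') (pos (P.node e)) (P.time e)) : P.Past v e' :=
  Reaches.trans h he

theorem dep_lt_arr (hc : 0 < c) (hpos : Function.Injective pos) (j : Fin P.n) :
    P.dep j < P.arr c pos j := by
  unfold Layout.arr
  have : 0 < |pos (P.src j) - pos (P.dst j)| / c :=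
    div_pos (abs_pos.2 (sub_ne_zero.2 fun h => P.src_ne_dst j (hpos h))) hc
  linarith

theorem reaches_arr (hc : 0 < c) (j : Fin P.n) :
    Reaches c (pos (P.src j)) (P.dep j) (pos (P.dst j)) (P.arr c pos j) := by
  unfold Reaches Layout.arr
  rw [add_sub_cancel_left, mul_div_cancel₀ _ hc.ne']

/-- An operation in the past of `v` does not share registers with an earlier one that is not. -/
theorem disjoint_regsAt_of_past (hc : 0 < c) (hpos : Function.Injective pos) {v : Fin (K + 2)}
    {e e' : Fin P.N} (he : P.Past v e) (he' : ¬ P.Past v e') (hlt : e' < e) (l : Fin P.n → Bool) :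
    Disjoint (P.regsAt c pos (P.node e) (P.time e) l) (P.regsAt c pos (P.node e') (P.time e') l) := by
  have ht : P.time e' ≤ P.time e := P.time_mono hlt.le
  have hnode : P.node e ≠ P.node e' := fun h =>
    he' (he.of_reaches (by rw [h]; exact Reaches.of_le hc ht))
  rw [Set.disjoint_left]
  intro r h1 h2
  cases r with
  | inA => exact hnode (Eq.trans h1 (Eq.symm h2))
  | inB => exact hnode (Eq.trans h1 (Eq.symm h2))
  | mem i => exact hnode (Eq.trans h1 (Eq.symm h2))
  -- The only way to share a photon across different nodes is for `e'` to hold it before departure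
  -- and `e` after arrival. Then `e'` influences `e`, hence `v`.
  | photon j =>
    rcases h1 with ⟨h1, h1'⟩ | ⟨h1, h1', _⟩ <;> rcases h2 with ⟨h2, h2'⟩ | ⟨h2, h2', _⟩
    · exact hnode (h1.trans h2.symm)
    · have := dep_lt_arr (P := P) hc hpos j
      linarith
    · refine he' (he.of_reaches ?_)
      rw [h1, h2]
      exact ((Reaches.of_le hc h2').trans (reaches_arr hc j)).trans (Reaches.of_le hc h1')
    · exact hnode (h1.trans h2.symm)

/-- The registers that start at the nodes of `S`. -/
def homeRegs (P : Protocol K dA dB c pos t) (S : Set (Fin (K + 2))) : Set (Reg P.m P.n) :=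
  {r | match r with
    | .inA => 0 ∈ S
    | .inB => Fin.last (K + 1) ∈ S
    | .mem i => P.memNode i ∈ S
    | .photon j => P.src j ∈ S}

/-- The photons sent from `S` to other nodes early enough to influence what is known at `v` at the
end of the protocol. -/
def crossRegs (P : Protocol K dA dB c pos t) (S : Set (Fin (K + 2))) (v : Fin (K + 2)) :
    Set (Reg P.m P.n) :=
  {r | ∃ j, r = .photon j ∧ P.src j ∈ S ∧ P.dst j ∉ S ∧
    Reaches c (pos (P.src j)) (P.dep j) (pos v) t}

open Classical in
/-- The loss pattern `l`, with the photons between `S` and its complement lost in addition. -/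
def cutLoss (P : Protocol K dA dB c pos t) (S : Set (Fin (K + 2))) (l : Fin P.n → Bool) :
    Fin P.n → Bool := fun j => if (P.src j ∈ S ↔ P.dst j ∈ S) then l j else true

theorem crossRegs_subset (S : Set (Fin (K + 2))) (v : Fin (K + 2)) :
    P.crossRegs S v ⊆ P.homeRegs S := by
  rintro r ⟨j, rfl, h, _⟩
  exact h

theorem regsAt_subset_home {S : Set (Fin (K + 2))} {u : Fin (K + 2)} {τ : ℝ} {l : Fin P.n → Bool}
    (hu : u ∈ S)
    (h : ∀ j, u = P.dst j → P.arr c pos j ≤ τ → l j = false → P.src j ∈ S) :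
    P.regsAt c pos u τ l ⊆ P.homeRegs S := by
  intro r hr
  cases r with
  | inA => exact (show (0 : Fin (K + 2)) ∈ S from (show u = 0 from hr) ▸ hu)
  | inB => exact (show Fin.last (K + 1) ∈ S from (show u = Fin.last (K + 1) from hr) ▸ hu)
  | mem i => exact (show P.memNode i ∈ S from (show u = P.memNode i from hr) ▸ hu)
  | photon j =>
    rcases hr with ⟨h1, _⟩ | ⟨h1, h2, h3⟩
    · exact (show P.src j ∈ S from h1 ▸ hu)
    · exact h j h1 h2 h3

theorem homeRegs_compl (S : Set (Fin (K + 2))) : P.homeRegs Sᶜ = (P.homeRegs S)ᶜ := by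
  ext r
  cases r <;> rfl

theorem regsAt_cutLoss_subset {S : Set (Fin (K + 2))} {u : Fin (K + 2)} {τ : ℝ}
    {l : Fin P.n → Bool} (hu : u ∈ S) :
    P.regsAt c pos u τ (P.cutLoss S l) ⊆ P.homeRegs S := by
  refine regsAt_subset_home hu fun j hj _ hl => ?_
  by_contra hs
  simp [cutLoss, hs, ← hj, hu] at hl

theorem regsAt_cutLoss_subset' {S : Set (Fin (K + 2))} {u : Fin (K + 2)} {τ : ℝ}
    {l : Fin P.n → Bool} (hu : u ∉ S) :
    P.regsAt c pos u τ (P.cutLoss S l) ⊆ (P.homeRegs S)ᶜ := by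
  rw [← homeRegs_compl]
  refine regsAt_subset_home hu fun j hj _ hl => ?_
  intro hs
  simp [cutLoss, hs, ← hj, hu] at hl

/-- **No leakage.** If the nodes of `S` are at distance at least `g` from all others, and no signal
that leaves `S` at time `g / c` or later reaches node `v ∉ S` by time `t`, then what happens at
`v` does not depend on an input to `S` that is always recoverable, up to registers other than
photons, when all photons between `S` and its complement are lost. -/
theorem mulVec_total_eq_zero (P : Protocol K dA dB c pos t) (hc : 0 < c)
    (hpos : Function.Injective pos) (S : Set (Fin (K + 2))) (v : Fin (K + 2)) (g : ℝ)
    (hsep : ∀ u ∈ S, ∀ w, w ∉ S → g ≤ |pos u - pos w|)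
    (hlate : ∀ u ∈ S, c * t < g + |pos u - pos v|)
    (v₀ v₁ : P.Cfg → ℂ) (y₀ : P.Cfg)
    (hv₀ : ∀ x, v₀ x ≠ 0 → ∀ r ∈ (P.homeRegs S)ᶜ, x r = y₀ r)
    (hv₁ : ∀ x, v₁ x ≠ 0 → ∀ r ∈ (P.homeRegs S)ᶜ, x r = y₀ r)
    (X : Matrix P.Cfg P.Cfg ℂ) (r' : Reg P.m P.n) (hX : ActsOnlyOn {r'} X)
    (hr' : ∀ u τ l, r' ∈ P.regsAt c pos u τ l → u = v) (hr'S : r' ∉ P.homeRegs S)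
    (ω : P.Record)
    (h₁ : ∀ ω' : P.Record, ω'.1 = ω.1 → P.SameView c pos P.N v t ω ω' →
      X *ᵥ (P.total ω' *ᵥ v₁) = 0)
    (h₀ : ∀ ω' : P.Record, ∀ M : Matrix P.Cfg P.Cfg ℂ, ActsOnlyOn (Set.range Reg.photon) M →
      M *ᵥ (P.total ω' *ᵥ v₁) = 0 → M *ᵥ (P.total ω' *ᵥ v₀) = 0) :
    X *ᵥ (P.total ω *ᵥ v₀) = 0 := by
  classical
  obtain ⟨l, o⟩ := ω
  dsimp only at h₁
  have hsep' : ∀ w, w ∉ S → ∀ u ∈ S, g ≤ |pos w - pos u| := fun w hw u hu => by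
    rw [abs_sub_comm]; exact hsep u hu w hw
  -- An operation at `S` that still influences `v` takes place before time `g / c`, when nothing
  -- from outside can have arrived at `S`.
  have early : ∀ e, P.Past v e → P.node e ∈ S → c * P.time e < g := by
    intro e he heS
    have h1 := hlate _ heS
    unfold Past Reaches at he
    linarith
  have nocross : ∀ j, (P.src j ∈ S ↔ P.dst j ∉ S) → g ≤ c * P.arr c pos j := by
    intro j hj
    have h1 : g ≤ |pos (P.src j) - pos (P.dst j)| := by
      by_cases hs : P.src j ∈ S
      · exact hsep _ hs _ (hj.1 hs)
      · exact hsep' _ hs _ (by by_contra h; exact hs (hj.2 h))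
    have h2 := P.dep_nonneg j
    unfold Layout.arr
    rw [mul_add, mul_div_cancel₀ _ hc.ne']
    have := mul_nonneg hc.le h2
    linarith
  -- the operations in the past of `v` depend on outcomes in the past of `v` only
  have kraus_past : ∀ e o', P.Past v e → (∀ e', P.Past v e' → o' e' = o e') →
      P.kraus e (l, o') = P.kraus e (l, o) := by
    intro e o' he ho'
    exact P.kraus_congr e _ _ ⟨fun _ _ => rfl, fun e' _ h => ho' e' (he.of_reaches h)⟩ (ho' e he)
  set A : Matrix P.Cfg P.Cfg ℂ := opProd fun e => if P.Past v e then P.kraus e (l, o) else 1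
    with hA
  have hXcomm : ∀ e ω', ¬ P.Past v e → Commute X (P.kraus e ω') := by
    intro e ω' he
    refine ActsOnlyOn.commute ?_ hX (P.kraus_local e ω')
    rw [Set.disjoint_singleton_left]
    intro hmem
    refine he ?_
    unfold Past
    rw [hr' _ _ _ hmem]
    exact Reaches.of_le hc (P.time_le e)
  have hXB : ∀ ω', Commute X (opProd fun e => if P.Past v e then 1 else P.kraus e ω') := by
    intro ω'
    refine opProd_induction (p := fun a => Commute X a) (Commute.one_right _)
      (fun a b ha hb => ha.mul_right hb) _ fun e => ?_
    split_ifs with he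
    · exact Commute.one_right _
    · exact hXcomm e ω' he
  have total_past : ∀ o', (∀ e', P.Past v e' → o' e' = o e') → P.total (l, o') =
      (opProd fun e => if P.Past v e then 1 else P.kraus e (l, o')) * A := by
    intro o' ho'
    rw [total, opProd_eq_mul _ (P.Past v)]
    · congr 2
      funext e
      split_ifs with he
      · exact kraus_past e o' he ho'
      · rfl
    · intro e e' he he' hlt
      exact ActsOnlyOn.commute (disjoint_regsAt_of_past hc hpos he he' hlt l)
        (P.kraus_local e (l, o')) (P.kraus_local e' (l, o'))
  -- The operations outside the past of `v` commute with `X`, and all their outcomes give runs with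
  -- the same view at `v`. As `X` annihilates every such run and instruments preserve the norm, it
  -- already annihilates the state before them.
  have hA₁ : X *ᵥ (A *ᵥ v₁) = 0 := by
    refine eq_zero_of_opProd_mulVec (fun e o' => P.kraus e (l, o')) (fun e => ¬ P.Past v e) o
      (P.kraus_causal l) (fun e o' => P.kraus_complete e (l, o')) _ fun o' ho' => ?_
    have ho'' : ∀ e', P.Past v e' → o' e' = o e' := fun e' he' => ho' e' (not_not.2 he')
    have h2 := h₁ (l, o') rfl ⟨fun _ _ => rfl, fun e' _ h => (ho'' e' h).symm⟩
    rw [total_past o' ho'', ← Matrix.mulVec_mulVec, Matrix.mulVec_mulVec, (hXB _).eq,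
      ← Matrix.mulVec_mulVec] at h2
    refine Eq.trans ?_ h2
    congr 2
    funext e
    by_cases he : P.Past v e <;> simp [he]
  suffices hA₀ : X *ᵥ (A *ᵥ v₀) = 0 by
    rw [total_past o fun _ _ => rfl, ← Matrix.mulVec_mulVec, Matrix.mulVec_mulVec, (hXB _).eq,
      ← Matrix.mulVec_mulVec, hA₀, Matrix.mulVec_zero]
  -- split the past operations into those at `S` and those elsewhere
  set E : Matrix P.Cfg P.Cfg ℂ := opProd fun e =>
    if P.Past v e ∧ P.node e ∈ S then P.kraus e (l, o) else 1 with hE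
  set Q : Matrix P.Cfg P.Cfg ℂ := opProd fun e =>
    if P.Past v e ∧ P.node e ∉ S then P.kraus e (l, o) else 1 with hQ
  have home_early : ∀ e l', P.Past v e → P.node e ∈ S →
      P.regsAt c pos (P.node e) (P.time e) l' ⊆ P.homeRegs S := by
    intro e l' he heS
    refine regsAt_subset_home heS fun j hj harr _ => ?_
    by_contra hs
    have h1 := nocross j (by rw [← hj]; simp [hs, heS])
    have h2 := early e he heS
    have h3 := mul_le_mul_of_nonneg_left harr hc.le
    linarith
  -- A photon that an earlier operation outside `S` has received can no longer be at its source in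
  -- `S`, so the past operations at `S` may act first.
  have hAQE : A = Q * E := by
    rw [hA, opProd_eq_mul _ (fun e => P.node e ∈ S)]
    · congr 2 <;> funext e <;> by_cases h1 : P.Past v e <;> by_cases h2 : P.node e ∈ S <;>
        simp [h1, h2]
    · intro e e' heS heS' hlt
      split_ifs with he he'
      · refine ActsOnlyOn.commute ?_ (P.kraus_local e _) (P.kraus_local e' _)
        rw [Set.disjoint_left]
        intro r hr hr2
        have hhome := home_early e l he heS hr
        have hne : P.node e' ≠ P.node e := fun h => heS' (h ▸ heS)
        cases r with
        | inA => exact hne (Eq.trans hr2 (Eq.symm hr))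
        | inB => exact hne (Eq.trans hr2 (Eq.symm hr))
        | mem i => exact hne (Eq.trans hr2 (Eq.symm hr))
        | photon j =>
          have hsrc : P.src j ∈ S := hhome
          rcases hr2 with ⟨h2, _⟩ | ⟨h2, h2', _⟩
          · exact heS' (h2 ▸ hsrc)
          · rcases hr with ⟨h1, h1'⟩ | ⟨h1, _, _⟩
            · have := dep_lt_arr (P := P) hc hpos j
              have := P.time_mono hlt.le
              linarith
            · exact hne (h2.trans h1.symm)
      · exact Commute.one_right _
      · exact Commute.one_left _
      · exact Commute.one_left _
  have hEloc : ActsOnlyOn (P.homeRegs S) E := by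
    refine opProd_induction (ActsOnlyOn.one _) (fun _ _ => ActsOnlyOn.mul) _ fun e => ?_
    split_ifs with he
    · exact (P.kraus_local e _).mono (home_early e l he.1 he.2)
    · exact ActsOnlyOn.one _
  -- Past operations outside `S` can touch registers of `S` only in the form of photons that were
  -- sent across the cut early enough to matter at `v`.
  have hY : ActsOnlyOn ((P.homeRegs S)ᶜ ∪ P.crossRegs S v) (X * Q) := by
    refine (hX.mono (by simpa using Or.inl hr'S)).mul ?_
    refine opProd_induction (ActsOnlyOn.one _) (fun _ _ => ActsOnlyOn.mul) _ fun e => ?_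
    split_ifs with he
    · refine (P.kraus_local e _).mono fun r hr => ?_
      obtain ⟨hp, hS⟩ := he
      cases r with
      | inA => exact Or.inl fun h => hS ((show P.node e = 0 from hr) ▸ h)
      | inB => exact Or.inl fun h => hS ((show P.node e = Fin.last (K + 1) from hr) ▸ h)
      | mem i => exact Or.inl fun h => hS ((show P.node e = P.memNode i from hr) ▸ h)
      | photon j =>
        by_cases hsrc : P.src j ∈ S
        · rcases hr with ⟨h1, _⟩ | ⟨h1, h2, _⟩
          · exact absurd (h1 ▸ hsrc) hS
          · refine Or.inr ⟨j, rfl, hsrc, h1 ▸ hS, ?_⟩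
            unfold Past at hp
            rw [h1] at hp
            exact ((reaches_arr hc j).trans (Reaches.of_le hc h2)).trans hp
        · exact Or.inl hsrc
    · exact ActsOnlyOn.one _
  have hdisj : Disjoint (P.homeRegs S)ᶜ (P.crossRegs S v) :=
    Set.disjoint_left.2 fun r h1 h2 => h1 (crossRegs_subset S v h2)
  have hsupp : ∀ w : P.Cfg → ℂ, (∀ x, w x ≠ 0 → ∀ r ∈ (P.homeRegs S)ᶜ, x r = y₀ r) →
      ∀ x, (E *ᵥ w) x ≠ 0 → ∀ r ∈ (P.homeRegs S)ᶜ, x r = y₀ r := fun w hw =>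
    hEloc.mulVec_support disjoint_compl_right hw
  rw [hAQE, ← Matrix.mulVec_mulVec, Matrix.mulVec_mulVec] at hA₁ ⊢
  -- `E` leaves the registers outside `S` in `y₀`. Hence `X * Q` is known there from its slices, and
  -- these act on the crossing photons only.
  suffices hz : ∀ z, slice (P.homeRegs S)ᶜ (X * Q) z y₀ *ᵥ (E *ᵥ v₀) = 0 by
    funext x
    have := congrFun (hz x) ((P.homeRegs S)ᶜ.piecewise y₀ x)
    rw [slice_mulVec (hsupp v₀ hv₀), if_pos (fun r hr => by simp only [hr, Set.piecewise_eq_of_mem])]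
      at this
    refine Eq.trans ?_ this
    congr 1
    funext r
    by_cases hr : r ∈ (P.homeRegs S)ᶜ
    · simp only [hr, Set.piecewise_eq_of_mem]
    · simp only [hr, not_false_eq_true, Set.piecewise_eq_of_notMem]
  intro z
  set Y := slice (P.homeRegs S)ᶜ (X * Q) z y₀ with hYdef
  have hYloc : ActsOnlyOn (P.crossRegs S v) Y := hY.slice subset_rfl hdisj z y₀
  have hY₁ : Y *ᵥ (E *ᵥ v₁) = 0 := by
    funext x
    rw [slice_mulVec (hsupp v₁ hv₁), hA₁]
    simp
  -- compare with the runs in which all photons between `S` and its complement are lost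
  set l' := P.cutLoss S l with hl'
  -- Before time `g / c` the nodes of `S` have seen neither the fate of a crossing photon nor an
  -- outcome from outside, so they choose the same instruments as in the original run.
  have kraus_cut : ∀ e o', P.Past v e → P.node e ∈ S →
      (∀ e', P.Past v e' ∧ P.node e' ∈ S → o' e' = o e') →
      P.kraus e (l', o') = P.kraus e (l, o) := by
    intro e o' he heS ho'
    have hearly := early e he heS
    refine P.kraus_congr e _ _ ⟨fun j hj => ?_, fun e' _ h => ?_⟩ (ho' e ⟨he, heS⟩)
    · by_cases hcr : P.src j ∈ S ↔ P.dst j ∈ S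
      · simp [hl', cutLoss, hcr]
      · have h1 := nocross j (by tauto)
        have h2 : 0 ≤ c * (P.time e - P.arr c pos j) := (abs_nonneg _).trans hj
        linarith
    · refine ho' e' ⟨he.of_reaches h, ?_⟩
      by_contra heS'
      have h1 := hsep' _ heS' _ heS
      have h2 := mul_nonneg hc.le (P.time_nonneg e')
      unfold Reaches at h
      linarith
  -- When the crossing photons are lost, nobody receives them. Operations that handle them at the
  -- source before departure are in the past of `v`, so they belong to `E`.
  have hYB : ∀ o', Commute Y
      (opProd fun e => if P.Past v e ∧ P.node e ∈ S then 1 else P.kraus e (l', o')) := by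
    intro o'
    refine opProd_induction (p := fun a => Commute Y a) (Commute.one_right _)
      (fun a b ha hb => ha.mul_right hb) _ fun e => ?_
    split_ifs with he
    · exact Commute.one_right _
    · refine ActsOnlyOn.commute ?_ hYloc (P.kraus_local e _)
      rw [Set.disjoint_left]
      intro r hr hr2
      by_cases heS : P.node e ∈ S
      · obtain ⟨j, rfl, hsrc, hdst, hreach⟩ := hr
        rcases hr2 with ⟨h1, h2⟩ | ⟨h1, _, _⟩
        · refine he ⟨?_, heS⟩
          unfold Past
          rw [h1]
          exact (Reaches.of_le hc h2).trans hreach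
        · exact hdst (h1 ▸ heS)
      · exact regsAt_cutLoss_subset' heS hr2 (crossRegs_subset S v hr)
  have total_cut : ∀ o', (∀ e', P.Past v e' ∧ P.node e' ∈ S → o' e' = o e') →
      P.total (l', o') =
      (opProd fun e => if P.Past v e ∧ P.node e ∈ S then 1 else P.kraus e (l', o')) * E := by
    intro o' ho'
    rw [total, opProd_eq_mul _ (fun e => P.Past v e ∧ P.node e ∈ S)]
    · congr 2 <;> funext e <;> split_ifs with he <;> try rfl
      · exact kraus_cut e o' he.1 he.2 ho'
    · intro e e' he he' hlt
      refine ActsOnlyOn.commute ?_ (P.kraus_local e (l', o')) (P.kraus_local e' (l', o'))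
      by_cases heS' : P.node e' ∈ S
      · exact disjoint_regsAt_of_past hc hpos he.1 (fun h => he' ⟨h, heS'⟩) hlt l'
      · rw [Set.disjoint_left]
        intro r hr hr2
        exact regsAt_cutLoss_subset' heS' hr2 (regsAt_cutLoss_subset he.2 hr)
  -- In the cut runs `h₀` transfers the annihilation from `v₁` to `v₀` for all outcomes of the
  -- remaining operations. Conservation of the norm then removes these operations.
  refine eq_zero_of_opProd_mulVec (fun e o' => P.kraus e (l', o'))
    (fun e => ¬ (P.Past v e ∧ P.node e ∈ S)) o
    (P.kraus_causal l') (fun e o' => P.kraus_complete e (l', o')) _ fun o' ho' => ?_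
  have ho'' : ∀ e', P.Past v e' ∧ P.node e' ∈ S → o' e' = o e' := fun e' he' =>
    ho' e' (not_not.2 he')
  have hcomm : ∀ w, Y *ᵥ (P.total (l', o') *ᵥ w) =
      (opProd fun e => if P.Past v e ∧ P.node e ∈ S then 1 else P.kraus e (l', o')) *ᵥ
        (Y *ᵥ (E *ᵥ w)) := by
    intro w
    rw [total_cut o' ho'', ← Matrix.mulVec_mulVec, Matrix.mulVec_mulVec _ Y, (hYB _).eq,
      ← Matrix.mulVec_mulVec]
  have h2 := h₀ (l', o') Y (hYloc.mono fun r ⟨j, hj, _⟩ => ⟨j, hj.symm⟩)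
    (by rw [hcomm, hY₁, Matrix.mulVec_zero])
  rw [hcomm] at h2
  refine Eq.trans ?_ h2
  congr 2
  funext e
  by_cases he : P.Past v e ∧ P.node e ∈ S <;> simp only [he, and_self, not_true_eq_false, not_false_eq_true,
    if_true, if_false]

end Protocol

/-! ### The swap gate and the bounds from the cuts of the line -/

/-- The unitary that interchanges the two input systems. -/
def swapGate (d : ℕ) : Matrix (Fin d × Fin d) (Fin d × Fin d) ℂ :=
  Matrix.of fun p q => if p.swap = q then 1 else 0

theorem swapGate_mulVec {d : ℕ} (ψ : Fin d × Fin d → ℂ) (p : Fin d × Fin d) :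
    (swapGate d *ᵥ ψ) p = ψ p.swap := by
  simp [swapGate, Matrix.mulVec, dotProduct]

theorem swapGate_mem_unitaryGroup (d : ℕ) :
    swapGate d ∈ Matrix.unitaryGroup (Fin d × Fin d) ℂ := by
  have h : (swapGate d)ᴴ = swapGate d := by
    ext p q
    simp only [swapGate, Matrix.conjTranspose_apply, Matrix.of_apply]
    have : q.swap = p ↔ p.swap = q := ⟨fun h => by rw [← h, Prod.swap_swap],
      fun h => by rw [← h, Prod.swap_swap]⟩
    simp [this]
  rw [Matrix.mem_unitaryGroup_iff, Matrix.star_eq_conjTranspose, h]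
  ext p q
  change (swapGate d *ᵥ fun w => swapGate d w q) p = _
  rw [swapGate_mulVec]
  simp [swapGate, Matrix.one_apply]

theorem ActsOnlyOn.diagonal {R : Type} [Fintype R] [DecidableEq R] {d : R → ℕ} {S : Set R}
    {f : (∀ r, Fin (d r)) → ℂ} (hf : ∀ x y, (∀ r ∈ S, x r = y r) → f x = f y) :
    ActsOnlyOn S (Matrix.diagonal f) := by
  refine ⟨fun x y ⟨r, _, h⟩ => Matrix.diagonal_apply_ne _ (fun e => h (by rw [e])), ?_⟩
  intro x y x' y' h1 h2 h3
  have e : x = y ↔ x' = y' := by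
    constructor
    · rintro rfl
      funext r
      by_cases hr : r ∈ S
      · rw [← (h3 r hr).1, ← (h3 r hr).2]
      · exact h2 r hr
    · rintro rfl
      funext r
      by_cases hr : r ∈ S
      · rw [(h3 r hr).1, (h3 r hr).2]
      · exact h1 r hr
  rw [Matrix.diagonal_apply, Matrix.diagonal_apply]
  by_cases hxy : x = y
  · rw [if_pos hxy, if_pos (e.1 hxy)]
    exact hf _ _ fun r hr => (h3 r hr).1
  · rw [if_neg hxy, if_neg (fun h => hxy (e.2 h))]

namespace Protocol

section

variable {K dA dB : ℕ} {c : ℝ} {pos : Fin (K + 2) → ℝ} {t : ℝ} {P : Protocol K dA dB c pos t}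

/-- The contents of the input systems. -/
def ends (x : P.Cfg) : Fin dA × Fin dB := (x .inA, x .inB)

/-- Changing the contents of the input systems. -/
def setEnds (q : Fin dA × Fin dB) (x : P.Cfg) : P.Cfg
  | .inA => q.1
  | .inB => q.2
  | .mem i => x (.mem i)
  | .photon j => x (.photon j)

/-- A photonic operator that annihilates a state in which the input systems factor out annihilates
every state that differs from it in the input systems only. -/
theorem mulVec_eq_zero_of_ends {M : Matrix P.Cfg P.Cfg ℂ}
    (hM : ActsOnlyOn (Set.range Reg.photon) M) {q₀ q₁ : Fin dA × Fin dB}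
    {η : (∀ i, Fin (P.memDim i)) → (∀ j, Fin (P.photonDim j)) → ℂ} {v₀ v₁ : P.Cfg → ℂ}
    (h₀ : ∀ x, v₀ x = (Pi.single q₀ 1 : Fin dA × Fin dB → ℂ) (ends x) *
      η (fun i => x (.mem i)) (fun j => x (.photon j)))
    (h₁ : ∀ x, v₁ x = (Pi.single q₁ 1 : Fin dA × Fin dB → ℂ) (ends x) *
      η (fun i => x (.mem i)) (fun j => x (.photon j)))
    (h : M *ᵥ v₁ = 0) : M *ᵥ v₀ = 0 := by
  funext x
  -- The two states differ by the transposition of `q₀` and `q₁` in the input systems, which an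
  -- operator on the photons does not see.
  refine Eq.trans ?_ (congrFun h (setEnds (Equiv.swap q₀ q₁ (ends x)) x))
  refine hM.mulVec_apply_congr ?_ ?_
  · rintro _ ⟨j, rfl⟩
    rfl
  · intro w w' hw hw' hww
    have e1 : ends w = ends x := Prod.ext (hw .inA (by simp)) (hw .inB (by simp))
    have e2 : ends w' = Equiv.swap q₀ q₁ (ends x) :=
      Prod.ext (hw' .inA (by simp)) (hw' .inB (by simp))
    rw [h₀, h₁, e1, e2]
    congr 1
    · have hiff : Equiv.swap q₀ q₁ (ends x) = q₁ ↔ ends x = q₀ :=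
        ⟨fun h => by simpa using congrArg (Equiv.swap q₀ q₁) h,
          fun h => by rw [h, Equiv.swap_apply_left]⟩
      simp only [Pi.single_apply, hiff]
    · congr 1
      · funext i
        exact (hw (.mem i) (by simp)).trans (hw' (.mem i) (by simp)).symm
      · funext j
        exact hww _ ⟨j, rfl⟩

theorem initial_single_ne_zero {q : Fin dA × Fin dB} {x : P.Cfg}
    (h : P.initial (Pi.single q 1) x ≠ 0) :
    ends x = q ∧ (∀ i, x (.mem i) = P.memInit i) ∧ ∀ j, x (.photon j) = P.photonInit j := by
  unfold Layout.initial at h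
  split_ifs at h with hx
  · refine ⟨?_, hx⟩
    by_contra hne
    exact h (Pi.single_eq_of_ne hne _)
  · exact absurd rfl h

end

/-- If the swap gate is implemented, signals leaving the side `S` of a cut of the line at or after
the time needed to cross it must be able to reach the end node `v` on the other side. -/
theorem swap_bound {K : ℕ} {c : ℝ} {pos : Fin (K + 2) → ℝ} {t : ℝ} (P : Protocol K 2 2 c pos t)
    (hc : 0 < c) (hpos : Function.Injective pos) (S : Set (Fin (K + 2))) (v : Fin (K + 2))
    (g : ℝ) (hsep : ∀ u ∈ S, ∀ w, w ∉ S → g ≤ |pos u - pos w|)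
    (hlate : ∀ u ∈ S, c * t < g + |pos u - pos v|)
    (r' : Reg P.m P.n) (hr' : ∀ u τ l, r' ∈ P.regsAt c pos u τ l → u = v)
    (hr'S : r' ∉ P.homeRegs S) (q₀ q₁ : Fin 2 × Fin 2) (f : Fin 2 × Fin 2 → Fin 2)
    (hf₀ : f q₀.swap = 0) (hf₁ : f q₁.swap ≠ 0)
    (hfr : ∀ x y : P.Cfg, x r' = y r' → f (ends x) = f (ends y))
    (hA : 0 ∉ S → q₀.1 = q₁.1) (hB : Fin.last (K + 1) ∉ S → q₀.2 = q₁.2) (loss : ℝ → ℝ)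
    (hv : ∀ flagA flagB : P.Record → Prop,
      (∀ ω ω', P.SameView c pos P.N 0 t ω ω' → (flagA ω ↔ flagA ω')) →
      (∀ ω ω', P.SameView c pos P.N (Fin.last (K + 1)) t ω ω' → (flagB ω ↔ flagB ω')) →
      (∀ ω ω', P.SameView c pos P.N v t ω ω' → (flagA ω ↔ flagA ω')) ∨
      (∀ ω ω', P.SameView c pos P.N v t ω ω' → (flagB ω ↔ flagB ω')))
    (hP : P.Implements loss (swapGate 2)) : False := by
  classical
  obtain ⟨flagA, flagB, hfA, hfB, hne, hsucc, hfail, p, hp, hprob⟩ := hP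
  have hsingle : ∀ q : Fin 2 × Fin 2, swapGate 2 *ᵥ (Pi.single q 1) = Pi.single q.swap 1 := by
    intro q
    funext p
    rw [swapGate_mulVec, Pi.single_apply, Pi.single_apply]
    have : p.swap = q ↔ p = q.swap := ⟨fun h => by rw [← h, Prod.swap_swap],
      fun h => by rw [h, Prod.swap_swap]⟩
    simp [this]
  -- a successful run
  obtain ⟨ω, hωA, hωB, hω⟩ : ∃ ω, flagA ω ∧ flagB ω ∧ P.final ω (Pi.single q₀ 1) ≠ 0 := by
    by_contra hcon
    push Not at hcon
    have h1 := hprob (Pi.single q₀ 1) (by simp [Pi.single_apply, apply_ite])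
    rw [Finset.sum_eq_zero] at h1
    · exact hp.ne h1
    · intro ω _
      split_ifs with h
      · simp [prob, hcon ω h.1 h.2]
      · rfl
  -- The flag of the end node `v` is a function of its view, so every run that looks the same at `v`
  -- is flagged as a success there.
  have hview : ∀ ω', P.SameView c pos P.N v t ω ω' → flagA ω' ∨ flagB ω' := by
    intro ω' h
    rcases hv flagA flagB hfA hfB with h1 | h1
    · exact Or.inl ((h1 ω ω' h).1 hωA)
    · exact Or.inr ((h1 ω ω' h).1 hωB)
  -- `f` reads the output at `v`. `X` projects onto the value that the swap produces from `q₀` and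
  -- not from `q₁`, while these inputs differ only on the side `S`.
  set X : Matrix P.Cfg P.Cfg ℂ := Matrix.diagonal fun x => if f (ends x) = 0 then 1 else 0
  have key := P.mulVec_total_eq_zero hc hpos S v g hsep hlate (P.initial (Pi.single q₀ 1))
    (P.initial (Pi.single q₁ 1))
    (fun r => match r with
      | .inA => q₀.1
      | .inB => q₀.2
      | .mem i => P.memInit i
      | .photon j => P.photonInit j) ?_ ?_ X r' ?_ hr' hr'S ω ?_ ?_
  · refine hω (funext fun x => ?_)
    have h1 := congrFun key x
    rw [← final_eq] at h1
    simp only [X, Matrix.mulVec_diagonal] at h1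
    obtain ⟨η, hη⟩ := hsucc ω hωA hωB
    rw [hη, hsingle] at h1 ⊢
    by_cases hx : ends x = q₀.swap
    · rw [hx, if_pos hf₀, one_mul] at h1
      exact h1
    · change (Pi.single q₀.swap 1 : Fin 2 × Fin 2 → ℂ) (ends x) * _ = 0
      rw [Pi.single_eq_of_ne hx, zero_mul]
  · intro x hx r hr
    obtain ⟨h1, h2, h3⟩ := initial_single_ne_zero hx
    cases r with
    | inA => exact congrArg Prod.fst h1
    | inB => exact congrArg Prod.snd h1
    | mem i => exact h2 i
    | photon j => exact h3 j
  · intro x hx r hr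
    obtain ⟨h1, h2, h3⟩ := initial_single_ne_zero hx
    cases r with
    | inA => exact (congrArg Prod.fst h1).trans (hA hr).symm
    | inB => exact (congrArg Prod.snd h1).trans (hB hr).symm
    | mem i => exact h2 i
    | photon j => exact h3 j
  · exact ActsOnlyOn.diagonal fun x y hxy => by rw [hfr x y (hxy r' rfl)]
  · intro ω' _ hω'
    rw [← final_eq]
    funext x
    simp only [X, Matrix.mulVec_diagonal]
    by_cases hfl : flagA ω' ↔ flagB ω'
    · have h1 := hview ω' hω'
      obtain ⟨η, hη⟩ := hsucc ω' (by tauto) (by tauto)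
      rw [hη, hsingle]
      by_cases hx : ends x = q₁.swap
      · rw [hx, if_neg hf₁, zero_mul]
        rfl
      · change _ * ((Pi.single q₁.swap 1 : Fin 2 × Fin 2 → ℂ) (ends x) * _) = 0
        rw [Pi.single_eq_of_ne hx, zero_mul, mul_zero]
    · rw [hne ω' hfl]
      simp
  · intro ω' M hM
    rw [← final_eq, ← final_eq]
    intro h
    by_cases hfl : flagA ω' ↔ flagB ω'
    · by_cases hA' : flagA ω'
      · obtain ⟨η, hη⟩ := hsucc ω' hA' (hfl.1 hA')
        refine mulVec_eq_zero_of_ends hM (q₀ := q₀.swap) (q₁ := q₁.swap) (η := η) ?_ ?_ h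
        · intro x; rw [hη, hsingle]; rfl
        · intro x; rw [hη, hsingle]; rfl
      · obtain ⟨η, hη⟩ := hfail ω' hA' (fun hB' => hA' (hfl.2 hB'))
        refine mulVec_eq_zero_of_ends hM (q₀ := q₀) (q₁ := q₁) (η := η) ?_ ?_ h
        · intro x; rw [hη, Matrix.one_mulVec]; rfl
        · intro x; rw [hη, Matrix.one_mulVec]; rfl
    · rw [hne ω' hfl, Matrix.mulVec_zero]

/-- The bound for the part of the line up to a cut, seen from the end node `B`. -/
theorem swap_bound_B {K : ℕ} {c : ℝ} {pos : Fin (K + 2) → ℝ} {t : ℝ} {L : ℝ}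
    (P : Protocol K 2 2 c pos t) (hc : 0 < c) (hpos : IsPlacement K L pos) (loss : ℝ → ℝ)
    (hP : P.Implements loss (swapGate 2)) (i : Fin (K + 1)) :
    (pos i.succ - pos i.castSucc) + (L - pos i.castSucc) ≤ c * t := by
  by_contra hlt
  push Not at hlt
  have hm := hpos.strictMono
  refine P.swap_bound hc hm.injective {u | u ≤ i.castSucc} (Fin.last (K + 1))
    (pos i.succ - pos i.castSucc) ?_ ?_ .inB (fun _ _ _ h => h) ?_ (0, 0) (1, 0) Prod.snd
    rfl (by simp) (fun x y h => h) ?_ (fun _ => rfl) loss (fun _ _ _ h => Or.inr h) hP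
  · intro u hu w hw
    have h1 := hm.monotone (show u ≤ i.castSucc from hu)
    have h2 : i.succ ≤ w := by
      rw [Set.mem_ofPred_eq, not_le] at hw
      exact Fin.castSucc_lt_iff_succ_le.1 hw
    have h3 := hm.monotone h2
    rw [abs_sub_comm]
    exact le_trans (by linarith) (le_abs_self _)
  · intro u hu
    have h1 := hm.monotone (show u ≤ i.castSucc from hu)
    rw [hpos.pos_B, abs_sub_comm]
    have := le_abs_self (L - pos u)
    linarith
  · intro h
    exact absurd (show Fin.last (K + 1) ≤ i.castSucc from h) (not_le.2 (Fin.castSucc_lt_last i))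
  · intro h
    exact absurd (Fin.zero_le _) h

/-- The bound for the part of the line from a cut, seen from the end node `A`. -/
theorem swap_bound_A {K : ℕ} {c : ℝ} {pos : Fin (K + 2) → ℝ} {t : ℝ} {L : ℝ}
    (P : Protocol K 2 2 c pos t) (hc : 0 < c) (hpos : IsPlacement K L pos) (loss : ℝ → ℝ)
    (hP : P.Implements loss (swapGate 2)) (i : Fin (K + 1)) :
    (pos i.succ - pos i.castSucc) + pos i.succ ≤ c * t := by
  by_contra hlt
  push Not at hlt
  have hm := hpos.strictMono
  refine P.swap_bound hc hm.injective {u | i.succ ≤ u} 0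
    (pos i.succ - pos i.castSucc) ?_ ?_ .inA (fun _ _ _ h => h) ?_ (0, 0) (0, 1) Prod.fst
    rfl (by simp) (fun x y h => h) (fun _ => rfl) ?_ loss (fun _ _ h _ => Or.inl h) hP
  · intro u hu w hw
    have h1 := hm.monotone (show i.succ ≤ u from hu)
    have h2 : w ≤ i.castSucc := by
      rw [Set.mem_ofPred_eq, not_le] at hw
      exact Fin.le_castSucc_iff.2 hw
    have h3 := hm.monotone h2
    exact le_trans (by linarith) (le_abs_self _)
  · intro u hu
    have h1 := hm.monotone (show i.succ ≤ u from hu)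
    rw [hpos.pos_A]
    have := le_abs_self (pos u - 0)
    linarith
  · intro h
    exact absurd (show i.succ ≤ 0 from h) (not_le.2 (Fin.succ_pos i))
  · intro h
    exact absurd (Fin.le_last _) h

end Protocol

/-! ### Lower bounds on the time -/

/-- A time that suffices for all unitaries satisfies the bounds from all cuts of some placement. -/
theorem exists_placement_of_mem_sufficientTimes {K : ℕ} {L c t : ℝ} {loss : ℝ → ℝ} (hc : 0 < c)
    (ht : t ∈ sufficientTimes K L c loss) : ∃ pos : Fin (K + 2) → ℝ, IsPlacement K L pos ∧
      ∀ i : Fin (K + 1), (pos i.succ - pos i.castSucc) + (L - pos i.castSucc) ≤ c * t ∧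
        (pos i.succ - pos i.castSucc) + pos i.succ ≤ c * t := by
  obtain ⟨pos, hpos, P, hP⟩ := ht 2 2 (by norm_num) (by norm_num) (swapGate 2)
    (swapGate_mem_unitaryGroup 2)
  exact ⟨pos, hpos, fun i => ⟨P.swap_bound_B hc hpos loss hP i, P.swap_bound_A hc hpos loss hP i⟩⟩

theorem two_le_of_mem_sufficientTimes {L c t : ℝ} {loss : ℝ → ℝ} (hc : 0 < c)
    (ht : t ∈ sufficientTimes 0 L c loss) : 2 * L / c ≤ t := by
  obtain ⟨pos, hpos, h⟩ := exists_placement_of_mem_sufficientTimes hc ht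
  rw [div_le_iff₀ hc]
  have h0 := h 0
  have hA := hpos.pos_A
  have hB : pos 1 = L := hpos.pos_B
  simp only [Fin.isValue, Fin.succ_zero_eq_one, Fin.castSucc_zero] at h0
  linarith [h0.1]

theorem three_halves_le_of_mem_sufficientTimes {L c t : ℝ} {loss : ℝ → ℝ} (hc : 0 < c)
    (ht : t ∈ sufficientTimes 1 L c loss) : 3 * L / (2 * c) ≤ t := by
  obtain ⟨pos, hpos, h⟩ := exists_placement_of_mem_sufficientTimes hc ht
  rw [div_le_iff₀ (by positivity)]
  have h0 := h 0
  have h1 := h 1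
  have hA := hpos.pos_A
  have hB : pos 2 = L := hpos.pos_B
  change (pos 1 - pos 0) + (L - pos 0) ≤ _ ∧ _ at h0
  change _ ∧ (pos 2 - pos 1) + pos 2 ≤ _ at h1
  -- The sum of the two inequalities is `3 * L ≤ 2 * c * t`.
  linarith [h0.1, h1.2]

theorem five_quarters_le_of_mem_sufficientTimes {L c t : ℝ} {loss : ℝ → ℝ} (hc : 0 < c)
    (ht : t ∈ sufficientTimes 2 L c loss) : 5 * L / (4 * c) ≤ t := by
  obtain ⟨pos, hpos, h⟩ := exists_placement_of_mem_sufficientTimes hc ht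
  rw [div_le_iff₀ (by positivity)]
  have h0 := h 0
  have h1 := h 1
  have h2 := h 2
  have hA := hpos.pos_A
  have hB : pos 3 = L := hpos.pos_B
  change (pos 1 - pos 0) + (L - pos 0) ≤ _ ∧ _ at h0
  change (pos 2 - pos 1) + (L - pos 1) ≤ _ ∧ (pos 2 - pos 1) + pos 2 ≤ _ at h1
  change _ ∧ (pos 3 - pos 2) + pos 3 ≤ _ at h2
  -- With weights 3, 1, 1, 3 the positions cancel and `10 * L ≤ 8 * c * t` remains.
  linarith [h0.1, h1.1, h1.2, h2.2]

theorem seven_sixths_le_of_mem_sufficientTimes {L c t : ℝ} {loss : ℝ → ℝ} (hc : 0 < c)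
    (ht : t ∈ sufficientTimes 3 L c loss) : 7 * L / (6 * c) ≤ t := by
  obtain ⟨pos, hpos, h⟩ := exists_placement_of_mem_sufficientTimes hc ht
  rw [div_le_iff₀ (by positivity)]
  have h0 := h 0
  have h1 := h 1
  have h2 := h 2
  have h3 := h 3
  have hA := hpos.pos_A
  have hB : pos 4 = L := hpos.pos_B
  change (pos 1 - pos 0) + (L - pos 0) ≤ _ ∧ _ at h0
  change (pos 2 - pos 1) + (L - pos 1) ≤ _ ∧ _ at h1
  change _ ∧ (pos 3 - pos 2) + pos 3 ≤ _ at h2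
  change _ ∧ (pos 4 - pos 3) + pos 4 ≤ _ at h3
  -- With weights 2, 1, 1, 2 the positions cancel and `7 * L ≤ 6 * c * t` remains.
  linarith [h0.1, h1.1, h2.2, h3.2]

/-! ### Operators acting on a component -/

/-- A component of type `ι` of the points of `X`. -/
structure Lens (X ι : Type) where
  get : X → ι
  set : ι → X → X
  get_set : ∀ i x, get (set i x) = i
  set_get : ∀ x, set (get x) x = x
  set_set : ∀ i j x, set i (set j x) = set i x

section Lift

variable {X ι : Type} [Fintype X] [DecidableEq X] [Fintype ι] [DecidableEq ι]

/-- The operator on functions on `X` that acts on one component. -/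
def Lens.lift (l : Lens X ι) (A : Matrix ι ι ℂ) : Matrix X X ℂ :=
  Matrix.of fun x y => if l.set (l.get y) x = y then A (l.get x) (l.get y) else 0

theorem Lens.lift_mulVec (l : Lens X ι) (A : Matrix ι ι ℂ) (v : X → ℂ) (x : X) :
    (l.lift A *ᵥ v) x = ∑ i, A (l.get x) i * v (l.set i x) := by
  classical
  simp only [Matrix.mulVec, dotProduct, lift, Matrix.of_apply, ite_mul, zero_mul]
  rw [← Finset.sum_filter]
  refine Finset.sum_bij' (fun y _ => l.get y) (fun i _ => l.set i x) ?_ ?_ ?_ ?_ ?_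
  · intro y _; simp
  · intro i _; simp [l.get_set]
  · intro y hy; simpa using hy
  · intro i _; exact l.get_set i x
  · intro y hy
    have : l.set (l.get y) x = y := by simpa using hy
    rw [this]

theorem Lens.lift_mul (l : Lens X ι) (A B : Matrix ι ι ℂ) :
    l.lift A * l.lift B = l.lift (A * B) := by
  ext x z
  change (l.lift A *ᵥ fun y => l.lift B y z) x = _
  rw [l.lift_mulVec]
  simp only [lift, Matrix.of_apply, l.set_set, l.get_set, Matrix.mul_apply]
  split_ifs <;> simp

theorem Lens.lift_one (l : Lens X ι) : l.lift 1 = 1 := by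
  ext x y
  simp only [lift, Matrix.of_apply, Matrix.one_apply]
  by_cases hxy : x = y
  · subst hxy; simp [l.set_get]
  · rw [if_neg hxy]
    split_ifs with h1 h2
    · rw [← h2, l.set_get] at h1
      exact absurd h1 hxy
    · rfl
    · rfl

theorem Lens.lift_conjTranspose (l : Lens X ι) (A : Matrix ι ι ℂ) :
    (l.lift A)ᴴ = l.lift Aᴴ := by
  ext x y
  simp only [lift, Matrix.conjTranspose_apply, Matrix.of_apply]
  have : l.set (l.get x) y = x ↔ l.set (l.get y) x = y := by
    constructor
    · intro h; rw [← h, l.set_set, l.set_get]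
    · intro h; rw [← h, l.set_set, l.set_get]
  simp only [this]
  split_ifs <;> simp

theorem Lens.lift_sum {κ : Type} [Fintype κ] (l : Lens X ι) (A : κ → Matrix ι ι ℂ) :
    ∑ k, l.lift (A k) = l.lift (∑ k, A k) := by
  ext x y
  simp only [lift, Matrix.sum_apply, Matrix.of_apply]
  split_ifs <;> simp

theorem Lens.lift_conjTranspose_mul_self (l : Lens X ι) {A : Matrix ι ι ℂ} (hA : Aᴴ * A = 1) :
    (l.lift A)ᴴ * l.lift A = 1 := by
  rw [l.lift_conjTranspose, l.lift_mul, hA, l.lift_one]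

end Lift

/-! ### Operators on one or two registers, and exchange of contents -/

section Registers

variable {R : Type} [Fintype R] [DecidableEq R] {d : R → ℕ} {D : ℕ}

/-- The content of a register of dimension `D`. -/
def regLens (r : R) (hr : d r = D) : Lens (∀ r, Fin (d r)) (Fin D) where
  get x := Fin.cast hr (x r)
  set i x := Function.update x r (Fin.cast hr.symm i)
  get_set i x := by simp
  set_get x := by simp
  set_set i j x := by simp

/-- The joint content of two registers of dimension `D`. -/
def pairLens (r s : R) (hrs : r ≠ s) (hr : d r = D) (hs : d s = D) :
    Lens (∀ r, Fin (d r)) (Fin D × Fin D) where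
  get x := (Fin.cast hr (x r), Fin.cast hs (x s))
  set i x := Function.update (Function.update x r (Fin.cast hr.symm i.1)) s (Fin.cast hs.symm i.2)
  get_set i x := by simp [hrs]
  set_get x := by simp
  set_set i j x := by
    funext q
    by_cases h1 : q = s
    · subst h1; simp
    · by_cases h2 : q = r
      · subst h2; simp [h1]
      · simp [h1, h2]

theorem Lens.actsOnlyOn_lift {ι : Type} [Fintype ι] [DecidableEq ι]
    (l : Lens (∀ r, Fin (d r)) ι) {S : Set R} (h1 : ∀ i x r, r ∉ S → l.set i x r = x r)
    (h2 : ∀ x y, (∀ r ∈ S, x r = y r) → l.get x = l.get y)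
    (h3 : ∀ i x y, (∀ r ∈ S, x r = y r) → ∀ r ∈ S, l.set i x r = l.set i y r)
    (A : Matrix ι ι ℂ) : ActsOnlyOn S (l.lift A) := by
  refine ⟨?_, ?_⟩
  · rintro x y ⟨r, hr, hne⟩
    simp only [lift, Matrix.of_apply]
    rw [if_neg]
    intro h
    rw [← h, h1 _ _ _ hr] at hne
    exact hne rfl
  · intro x y x' y' e1 e2 e3
    have hy := h2 y y' fun r hr => (e3 r hr).2
    have hx := h2 x x' fun r hr => (e3 r hr).1
    simp only [lift, Matrix.of_apply]
    have : l.set (l.get y) x = y ↔ l.set (l.get y') x' = y' := by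
      rw [hy, funext_iff, funext_iff]
      refine forall_congr' fun r => ?_
      by_cases hr : r ∈ S
      · rw [h3 _ x x' (fun r hr => (e3 r hr).1) r hr, (e3 r hr).2]
      · rw [h1 _ _ _ hr, h1 _ _ _ hr]
        exact ⟨fun _ => e2 r hr, fun _ => e1 r hr⟩
    rw [hy] at this
    simp only [hx, hy, this]

theorem actsOnlyOn_regLens (r : R) (hr : d r = D) (A : Matrix (Fin D) (Fin D) ℂ) :
    ActsOnlyOn {r} ((regLens (d := d) r hr).lift A) := by
  refine Lens.actsOnlyOn_lift _ ?_ ?_ ?_ A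
  · intro i x q hq
    exact Function.update_of_ne (by simpa using hq) _ _
  · intro x y h
    simp [regLens, h r rfl]
  · rintro i x y h q rfl
    simp [regLens]

theorem actsOnlyOn_pairLens (r s : R) (hrs : r ≠ s) (hr : d r = D) (hs : d s = D)
    (A : Matrix (Fin D × Fin D) (Fin D × Fin D) ℂ) :
    ActsOnlyOn {r, s} ((pairLens (d := d) r s hrs hr hs).lift A) := by
  refine Lens.actsOnlyOn_lift _ ?_ ?_ ?_ A
  · intro i x q hq
    simp only [Set.mem_insert_iff, Set.mem_singleton_iff, not_or] at hq
    simp [pairLens, hq.1, hq.2]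
  · intro x y h
    simp [pairLens, h r (by simp), h s (by simp)]
  · intro i x y h q hq
    by_cases h1 : q = s
    · subst h1; simp [pairLens]
    · have : q = r := by simpa [h1] using hq
      subst this; simp [pairLens, h1]

/-- Interchange of the contents of two registers, as far as they fit. -/
def exch (a b : R) (x : ∀ r, Fin (d r)) : ∀ r, Fin (d r) :=
  if h : (x a : ℕ) < d b ∧ (x b : ℕ) < d a then
    Function.update (Function.update x a ⟨x b, h.2⟩) b ⟨x a, h.1⟩ else x

theorem exch_exch {a b : R} (hab : a ≠ b) (x : ∀ r, Fin (d r)) : exch a b (exch a b x) = x := by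
  by_cases h : (x a : ℕ) < d b ∧ (x b : ℕ) < d a
  · have e1 : exch a b x =
        Function.update (Function.update x a ⟨x b, h.2⟩) b ⟨x a, h.1⟩ := dif_pos h
    have ha : ((exch a b x) a : ℕ) = x b := by rw [e1]; simp [hab]
    have hb : ((exch a b x) b : ℕ) = x a := by rw [e1]; simp
    have h' : ((exch a b x) a : ℕ) < d b ∧ ((exch a b x) b : ℕ) < d a := by
      rw [ha, hb]; exact ⟨(x b).2, (x a).2⟩
    have e2 : exch a b (exch a b x) = Function.update (Function.update (exch a b x) a
      ⟨(exch a b x) b, h'.2⟩) b ⟨(exch a b x) a, h'.1⟩ := dif_pos h'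
    rw [e2]
    funext q
    by_cases h1 : q = b
    · subst h1
      apply Fin.ext
      simp [ha]
    · by_cases h2 : q = a
      · subst h2
        apply Fin.ext
        simp [hab, hb]
      · simp [h1, h2, e1]
  · have e1 : exch a b x = x := dif_neg h
    rw [e1, e1]

/-- The operator that interchanges the contents of two registers, as far as they fit. -/
def exchMat (a b : R) : Matrix (∀ r, Fin (d r)) (∀ r, Fin (d r)) ℂ :=
  Matrix.of fun x y => if exch a b x = y then 1 else 0

theorem exchMat_mulVec (a b : R) (v : (∀ r, Fin (d r)) → ℂ) (x : ∀ r, Fin (d r)) :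
    (exchMat a b *ᵥ v) x = v (exch a b x) := by
  simp [exchMat, Matrix.mulVec, dotProduct]

theorem exchMat_conjTranspose_mul_self {a b : R} (hab : a ≠ b) :
    (exchMat (d := d) a b)ᴴ * exchMat a b = 1 := by
  have h : (exchMat (d := d) a b)ᴴ = exchMat a b := by
    ext x y
    simp only [exchMat, Matrix.conjTranspose_apply, Matrix.of_apply]
    have : exch a b y = x ↔ exch a b x = y := ⟨fun h => by rw [← h, exch_exch hab],
      fun h => by rw [← h, exch_exch hab]⟩
    simp [this]
  rw [h]
  ext x y
  change (exchMat (d := d) a b *ᵥ fun w => exchMat a b w y) x = _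
  rw [exchMat_mulVec]
  simp [exchMat, Matrix.one_apply, exch_exch hab]

theorem exch_apply_of_ne {a b r : R} (ha : r ≠ a) (hb : r ≠ b) (x : ∀ r, Fin (d r)) :
    exch a b x r = x r := by
  unfold exch
  split_ifs
  · simp [ha, hb]
  · rfl

theorem actsOnlyOn_exchMat (a b : R) : ActsOnlyOn {a, b} (exchMat (d := d) a b) := by
  refine ⟨?_, ?_⟩
  · rintro x y ⟨r, hr, hne⟩
    simp only [Set.mem_insert_iff, Set.mem_singleton_iff, not_or] at hr
    simp only [exchMat, Matrix.of_apply]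
    rw [if_neg]
    intro h
    rw [← h, exch_apply_of_ne hr.1 hr.2] at hne
    exact hne rfl
  · intro x y x' y' h1 h2 h3
    have key : exch a b x = y ↔ exch a b x' = y' := by
      rw [funext_iff, funext_iff]
      refine forall_congr' fun r => ?_
      by_cases hr : r = a ∨ r = b
      · have h4 : exch a b x r = exch a b x' r := by
          unfold exch
          have ea := (h3 a (by simp)).1
          have eb := (h3 b (by simp)).1
          by_cases h : (x a : ℕ) < d b ∧ (x b : ℕ) < d a
          · have h' : (x' a : ℕ) < d b ∧ (x' b : ℕ) < d a := by rw [← ea, ← eb]; exact h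
            rw [dif_pos h, dif_pos h']
            by_cases hb : r = b
            · subst hb; simp [ea]
            · obtain rfl := hr.resolve_right hb
              simp [hb, eb]
          · have h' : ¬ ((x' a : ℕ) < d b ∧ (x' b : ℕ) < d a) := by rw [← ea, ← eb]; exact h
            rw [dif_neg h, dif_neg h']
            exact (h3 r hr).1
        rw [h4, (h3 r hr).2]
      · have hr' := hr
        rw [not_or] at hr'
        rw [exch_apply_of_ne hr'.1 hr'.2, exch_apply_of_ne hr'.1 hr'.2]
        exact ⟨fun _ => h2 r hr, fun _ => h1 r hr⟩
    simp only [exchMat, Matrix.of_apply, key]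

end Registers

/-! ### Generalized Bell states and teleportation -/

section Teleportation

variable (D : ℕ) [NeZero D]

/-- The unitary matrix of the discrete Fourier transform. -/
def fourier : Matrix (Fin D) (Fin D) ℂ := Matrix.of fun i a =>
  ZMod.stdAddChar (ZMod.finEquiv D i * ZMod.finEquiv D a) * ((√D : ℝ) : ℂ)⁻¹

variable {D}

theorem sqrt_inv_mul_self : ((√D : ℝ) : ℂ)⁻¹ * ((√D : ℝ) : ℂ)⁻¹ = (D : ℂ)⁻¹ := by
  rw [← mul_inv, ← Complex.ofReal_mul, Real.mul_self_sqrt (Nat.cast_nonneg D),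
    Complex.ofReal_natCast]

theorem sqrt_ne_zero : ((√D : ℝ) : ℂ) ≠ 0 := by
  have : (0 : ℝ) < D := Nat.cast_pos.2 (NeZero.pos D)
  exact Complex.ofReal_ne_zero.2 (Real.sqrt_pos.2 this).ne'

theorem fourier_mul_conj (i j a : Fin D) : fourier D i a * star (fourier D j a) =
    ZMod.stdAddChar ((ZMod.finEquiv D i - ZMod.finEquiv D j) * ZMod.finEquiv D a) *
      (D : ℂ)⁻¹ := by
  have h : star (ZMod.stdAddChar (ZMod.finEquiv D j * ZMod.finEquiv D a) : ℂ) =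
      ZMod.stdAddChar (-(ZMod.finEquiv D j * ZMod.finEquiv D a)) := by
    rw [AddChar.map_neg_eq_conj]; rfl
  simp only [fourier, Matrix.of_apply, star_mul', h, star_inv₀, Complex.star_def,
    Complex.conj_ofReal]
  rw [sub_mul, sub_eq_add_neg, AddChar.map_add_eq_mul, ← sqrt_inv_mul_self]
  ring

theorem fourier_mul_conj_self (i a : Fin D) :
    fourier D i a * star (fourier D i a) = (D : ℂ)⁻¹ := by
  rw [fourier_mul_conj]; simp

theorem fourier_zero (i : Fin D) : fourier D i 0 = ((√D : ℝ) : ℂ)⁻¹ := by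
  simp [fourier]

/-- Orthogonality of the additive characters of `ZMod D`. -/
theorem fourier_sum (i j : Fin D) :
    ∑ a, fourier D i a * star (fourier D j a) = if i = j then 1 else 0 := by
  simp only [fourier_mul_conj]
  have e := (ZMod.finEquiv D).toEquiv.sum_comp
    (fun a => (ZMod.stdAddChar ((ZMod.finEquiv D i - ZMod.finEquiv D j) * a) : ℂ))
  simp only [RingEquiv.toEquiv_eq_coe, RingEquiv.coe_toEquiv] at e
  rw [← Finset.sum_mul, e]
  simp only [mul_comm (ZMod.finEquiv D i - ZMod.finEquiv D j)]
  rw [AddChar.sum_mulShift _ (ZMod.isPrimitive_stdAddChar D)]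
  have hD : (D : ℂ) ≠ 0 := Nat.cast_ne_zero.2 (NeZero.ne D)
  by_cases h : i = j
  · simp [h, hD]
  · simp [h, sub_eq_zero]

/-- The unitary matrix with the generalized Bell states as its columns. -/
def bellMat : Matrix (Fin D × Fin D) (Fin D × Fin D) ℂ := Matrix.of fun p k =>
  if p.2 = p.1 + k.2 then fourier D p.1 k.1 else 0

theorem bellMat_mul_conjTranspose : bellMat (D := D) * bellMatᴴ = 1 := by
  ext p q
  simp only [Matrix.mul_apply, Matrix.conjTranspose_apply, bellMat, Matrix.of_apply,
    Fintype.sum_prod_type]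
  have : ∀ a b : Fin D, (if p.2 = p.1 + b then fourier D p.1 a else 0) *
      star (if q.2 = q.1 + b then fourier D q.1 a else 0) =
      if b = p.2 - p.1 then (if b = q.2 - q.1 then fourier D p.1 a * star (fourier D q.1 a) else 0)
        else 0 := by
    intro a b
    have e1 : p.2 = p.1 + b ↔ b = p.2 - p.1 := by rw [eq_sub_iff_add_eq', eq_comm]
    have e2 : q.2 = q.1 + b ↔ b = q.2 - q.1 := by rw [eq_sub_iff_add_eq', eq_comm]
    simp only [e1, e2]
    split_ifs <;> simp
  simp only [this, Finset.sum_ite_eq', Finset.mem_univ, if_true]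
  by_cases h : p.2 - p.1 = q.2 - q.1
  · simp only [h, if_true, fourier_sum, Matrix.one_apply]
    by_cases h1 : p.1 = q.1
    · rw [h1, sub_left_inj] at h
      simp [Prod.ext h1 h]
    · rw [if_neg h1, if_neg (fun e => h1 (by rw [e]))]
  · rw [Matrix.one_apply_ne (fun e => h (by rw [e]))]
    simp [h]

theorem bellMat_conjTranspose_mul : bellMatᴴ * bellMat (D := D) = 1 :=
  mul_eq_one_comm.1 bellMat_mul_conjTranspose

/-- Bell measurement with outcome `k`, after which both systems are reset. -/
def bellKraus (k : Fin D × Fin D) : Matrix (Fin D × Fin D) (Fin D × Fin D) ℂ := Matrix.of fun p q =>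
  if p = 0 then star (bellMat q k) else 0

theorem sum_bellKraus : ∑ k, (bellKraus (D := D) k)ᴴ * bellKraus k = 1 := by
  rw [← bellMat_mul_conjTranspose]
  ext p q
  simp only [Matrix.sum_apply, Matrix.mul_apply, Matrix.conjTranspose_apply]
  refine Finset.sum_congr rfl fun k _ => ?_
  rw [Finset.sum_eq_single 0]
  · simp [bellKraus]
  · intro r _ hr; simp [bellKraus, hr]
  · simp

/-- The correction for the outcome `k` of a Bell measurement. -/
def corrMat (k : Fin D × Fin D) : Matrix (Fin D) (Fin D) ℂ := Matrix.of fun i j =>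
  if j = i + k.2 then ((√D : ℝ) : ℂ) * fourier D i k.1 else 0

theorem corrMat_conjTranspose_mul (k : Fin D × Fin D) : (corrMat k)ᴴ * corrMat k = 1 := by
  rw [mul_eq_one_comm]
  ext i j
  simp only [Matrix.mul_apply, Matrix.conjTranspose_apply, corrMat, Matrix.of_apply]
  rw [Finset.sum_eq_single (i + k.2)]
  · by_cases h : i = j
    · subst h
      simp only [if_true, Matrix.one_apply_eq, star_mul']
      rw [mul_mul_mul_comm, fourier_mul_conj_self, ← sqrt_inv_mul_self]
      have := sqrt_ne_zero (D := D)
      simp only [Complex.star_def, Complex.conj_ofReal]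
      field_simp
    · rw [Matrix.one_apply_ne h]
      simp [h]
  · intro r _ hr; simp [hr]
  · simp

variable {R : Type} [Fintype R] [DecidableEq R] {d : R → ℕ}

/-- **Teleportation** from register `q` to register `y` with the help of an entangled state of the
registers `x` and `y`. -/
theorem teleport {q x y : R} (hqx : q ≠ x) (hqy : q ≠ y) (hxy : x ≠ y) (hq : d q = D) (hx : d x = D)
    (hy : d y = D) (k : Fin D × Fin D) (v : (∀ r, Fin (d r)) → ℂ)
    (hv : ∀ u, v u ≠ 0 → (u x : ℕ) = 0 ∧ (u y : ℕ) = 0) :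
    (regLens y hy).lift (corrMat k) *ᵥ ((pairLens q x hqx hq hx).lift (bellKraus k) *ᵥ
      ((pairLens x y hxy hx hy).lift bellMat *ᵥ v)) = (D : ℂ)⁻¹ • (exchMat q y *ᵥ v) := by
  obtain ⟨a, b⟩ := k
  -- Column `0` of `bellMat` is the maximally entangled state, with all amplitudes equal to `1 /
  -- √D`.
  have hw : ∀ w, ((pairLens x y hxy hx hy).lift bellMat *ᵥ v) w =
      if Fin.cast hx (w x) = Fin.cast hy (w y) then ((√D : ℝ) : ℂ)⁻¹ *
        v (Function.update (Function.update w x (Fin.cast hx.symm 0)) y (Fin.cast hy.symm 0))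
      else 0 := by
    intro w
    rw [Lens.lift_mulVec, Finset.sum_eq_single (0 : Fin D × Fin D)]
    · simp only [pairLens, bellMat, Matrix.of_apply, Prod.snd_zero, Prod.fst_zero, add_zero,
        fourier_zero, ite_mul, zero_mul, eq_comm]
    · intro i _ hi
      by_contra hne
      have h1 := hv _ (right_ne_zero_of_mul hne)
      simp only [pairLens, ne_eq, hxy, not_false_eq_true, Function.update_of_ne,
        Function.update_self, Fin.val_cast, Fin.val_eq_zero_iff] at h1
      exact hi (Prod.ext h1.1 h1.2)
    · simp
  funext u
  rw [Lens.lift_mulVec, Finset.sum_eq_single (Fin.cast hy (u y) + b)]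
  · rw [Lens.lift_mulVec, Pi.smul_apply, exchMat_mulVec, smul_eq_mul]
    -- The measurement resets `q` and `x` to `0`; elsewhere both sides vanish. Where they are `0`, a
    -- single Bell component contributes, and the correction cancels its phase, since `fourier D i
    -- a` has squared modulus `1 / D`.
    by_cases h0 : (u q : ℕ) = 0 ∧ (u x : ℕ) = 0
    · rw [Finset.sum_eq_single (Fin.cast hy (u y), Fin.cast hy (u y) + b)]
      · have hget : (pairLens q x hqx hq hx).get
            ((regLens y hy).set (Fin.cast hy (u y) + b) u) = 0 := by
          refine Prod.ext (Fin.ext ?_) (Fin.ext ?_) <;> simp [pairLens, regLens, hqy, hxy, h0]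
        have hU : Function.update (Function.update ((pairLens q x hqx hq hx).set
            (Fin.cast hy (u y), Fin.cast hy (u y) + b)
            ((regLens y hy).set (Fin.cast hy (u y) + b) u)) x (Fin.cast hx.symm 0)) y
            (Fin.cast hy.symm 0) = exch q y u := by
          have hcond : (u q : ℕ) < d y ∧ (u y : ℕ) < d q :=
            ⟨by have := (u q).2; omega, by have := (u y).2; omega⟩
          unfold exch
          rw [dif_pos hcond]
          funext r
          apply Fin.ext
          by_cases h1 : r = y
          · subst h1; simp [h0]
          · by_cases h2 : r = x
            · subst h2; simp [h1, hqx.symm, h0]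
            · by_cases h3 : r = q
              · subst h3; simp [pairLens, h1, h2]
              · simp [pairLens, regLens, h1, h2, h3]
        rw [hget, hw, hU, if_pos (by simp [pairLens, regLens, hxy.symm, hqy.symm])]
        simp only [corrMat, bellKraus, bellMat, Matrix.of_apply, regLens, if_true]
        rw [← fourier_mul_conj_self (Fin.cast hy (u y)) a]
        have := sqrt_ne_zero (D := D)
        field_simp
      · rintro ⟨i, j⟩ _ hij
        rw [hw]
        by_cases hj : j = Fin.cast hy (u y) + b
        · have hi : i ≠ Fin.cast hy (u y) := fun h => hij (by rw [h, hj])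
          have : bellMat (i, j) (a, b) = 0 := by
            simp only [bellMat, Matrix.of_apply]
            rw [if_neg]
            rw [hj, add_left_inj]
            exact hi.symm
          simp [bellKraus, this]
        · rw [if_neg, mul_zero]
          simpa [pairLens, regLens, hxy.symm, hqy.symm] using hj
      · simp
    · have hz : v (exch q y u) = 0 := by
        by_contra hne
        have h1 := hv _ hne
        rw [exch_apply_of_ne hqx.symm hxy] at h1
        have hcond : (u q : ℕ) < d y ∧ (u y : ℕ) < d q :=
          ⟨by have := (u q).2; omega, by have := (u y).2; omega⟩
        have h2 := h1.2
        unfold exch at h2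
        rw [dif_pos hcond] at h2
        simp only [Function.update_self] at h2
        exact h0 ⟨h2, h1.1⟩
      rw [hz, mul_zero, Finset.sum_eq_zero, mul_zero]
      intro i _
      have : (pairLens q x hqx hq hx).get
          ((regLens y hy).set (Fin.cast hy (u y) + b) u) ≠ 0 := by
        intro h
        refine h0 ⟨?_, ?_⟩
        · simpa [pairLens, regLens, hqy] using congrArg (fun p => (p.1 : ℕ)) h
        · simpa [pairLens, regLens, hxy] using congrArg (fun p => (p.2 : ℕ)) h
      simp [bellKraus, this]
  · intro i _ hi
    simp [corrMat, regLens, hi]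
  · simp

end Teleportation

/-! ### Extension of states and unitaries to larger dimensions -/

section Pad

variable {α β : Type} [Fintype α] [DecidableEq α] [Fintype β] [DecidableEq β]

open Classical in
/-- The extension of an operator along an embedding of index types, by the identity. -/
def extendMat (e : α ↪ β) (U : Matrix α α ℂ) : Matrix β β ℂ :=
  let σ : α ⊕ ((Set.range e)ᶜ : Set β) ≃ β :=
    ((Equiv.ofInjective e e.injective).sumCongr (Equiv.refl _)).trans
      (Equiv.Set.sumCompl (Set.range e))
  (Matrix.fromBlocks U 0 0 1).submatrix σ.symm σ.symm

theorem extendMat_conjTranspose_mul (e : α ↪ β) {U : Matrix α α ℂ} (hU : Uᴴ * U = 1) :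
    (extendMat e U)ᴴ * extendMat e U = 1 := by
  unfold extendMat
  rw [Matrix.conjTranspose_submatrix, Matrix.submatrix_mul_equiv, Matrix.fromBlocks_conjTranspose,
    Matrix.fromBlocks_multiply]
  simp only [hU, Matrix.conjTranspose_zero, Matrix.conjTranspose_one, Matrix.mul_zero,
    Matrix.zero_mul, add_zero, zero_add, Matrix.mul_one, Matrix.fromBlocks_one]
  exact Matrix.submatrix_one_equiv _

theorem extendMat_mulVec (e : α ↪ β) (U : Matrix α α ℂ) (f : α → ℂ) :
    extendMat e U *ᵥ (Function.extend e f 0) = Function.extend e (U *ᵥ f) 0 := by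
  classical
  unfold extendMat
  set σ : α ⊕ ((Set.range e)ᶜ : Set β) ≃ β :=
    ((Equiv.ofInjective e e.injective).sumCongr (Equiv.refl _)).trans
      (Equiv.Set.sumCompl (Set.range e))
  have hl : ∀ a, σ (Sum.inl a) = e a := fun a => by simp [σ]
  have hr : ∀ b, σ (Sum.inr b) = b := fun b => by simp [σ]
  have h1 : Function.extend e f 0 ∘ σ = Sum.elim f 0 := by
    funext s
    rcases s with a | ⟨b, hb⟩
    · simp [hl, e.injective.extend_apply]
    · have : ¬ ∃ a, e a = b := fun ⟨a, ha⟩ => hb ⟨a, ha⟩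
      simp [hr, Function.extend_apply' _ _ _ this]
  rw [Matrix.submatrix_mulVec_equiv, Equiv.symm_symm, h1]
  have h2 : Function.extend e (U *ᵥ f) 0 ∘ σ = Sum.elim (U *ᵥ f) 0 := by
    funext s
    rcases s with a | ⟨b, hb⟩
    · simp [hl, e.injective.extend_apply]
    · have : ¬ ∃ a, e a = b := fun ⟨a, ha⟩ => hb ⟨a, ha⟩
      simp [hr, Function.extend_apply' _ _ _ this]
  rw [Matrix.fromBlocks_mulVec]
  funext b
  obtain ⟨s, rfl⟩ := σ.surjective b
  rw [← Function.comp_apply (f := Function.extend e (U *ᵥ f) 0), h2]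
  rcases s with a | b <;> simp

variable {dA dB : ℕ}

/-- The amplitudes of a state, extended by zero. -/
def pad (ψ : Fin dA × Fin dB → ℂ) (n m : ℕ) : ℂ :=
  if h : n < dA ∧ m < dB then ψ (⟨n, h.1⟩, ⟨m, h.2⟩) else 0

/-- The extension of a bipartite operator to larger systems. -/
def padMat {D : ℕ} (hA : dA ≤ D) (hB : dB ≤ D) (U : Matrix (Fin dA × Fin dB) (Fin dA × Fin dB) ℂ) :
    Matrix (Fin D × Fin D) (Fin D × Fin D) ℂ :=
  extendMat ((Fin.castLEEmb hA).prodMap (Fin.castLEEmb hB)) U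

theorem padMat_mulVec {D : ℕ} (hA : dA ≤ D) (hB : dB ≤ D)
    (U : Matrix (Fin dA × Fin dB) (Fin dA × Fin dB) ℂ) (ψ : Fin dA × Fin dB → ℂ) :
    padMat hA hB U *ᵥ (fun p => pad ψ p.1 p.2) = fun p => pad (U *ᵥ ψ) p.1 p.2 := by
  have h : ∀ ψ : Fin dA × Fin dB → ℂ, (fun p : Fin D × Fin D => pad ψ p.1 p.2) =
      Function.extend ((Fin.castLEEmb hA).prodMap (Fin.castLEEmb hB)) ψ 0 := by
    intro ψ
    funext p
    by_cases hp : (p.1 : ℕ) < dA ∧ (p.2 : ℕ) < dB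
    · have : p = ((Fin.castLEEmb hA).prodMap (Fin.castLEEmb hB))
          (⟨p.1, hp.1⟩, ⟨p.2, hp.2⟩) := rfl
      conv_rhs => rw [this]
      rw [((Fin.castLEEmb hA).prodMap (Fin.castLEEmb hB)).injective.extend_apply]
      exact dif_pos hp
    · rw [Function.extend_apply']
      · exact dif_neg hp
      · rintro ⟨q, rfl⟩
        exact hp ⟨q.1.2, q.2.2⟩
  rw [h, padMat, extendMat_mulVec, ← h]

end Pad

/-! ### Tracking where the input is held -/

section Carries

variable {R : Type} [Fintype R] [DecidableEq R] {d : R → ℕ} {Ψ : Type}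

/-- The states `v ψ` carry the amplitudes `φ ψ` in the registers `a` and `b`, in a product with a
state of the other registers that does not depend on `ψ` and in which all registers outside `V` are
in the basis state `0`. -/
def Carries (a b : R) (V : Finset R) (φ : Ψ → ℕ → ℕ → ℂ) (v : Ψ → (∀ r, Fin (d r)) → ℂ) : Prop :=
  ∃ η : (∀ r, Fin (d r)) → ℂ, (∀ ψ x, v ψ x = φ ψ (x a) (x b) * η x) ∧
    (∀ x y, (∀ r, r ≠ a → r ≠ b → x r = y r) → η x = η y) ∧
    ∀ x, η x ≠ 0 → ∀ r, r ∉ V → (x r : ℕ) = 0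

variable {a b : R} {V : Finset R} {φ : Ψ → ℕ → ℕ → ℂ} {v : Ψ → (∀ r, Fin (d r)) → ℂ}

theorem Carries.symm (h : Carries a b V φ v) : Carries b a V (fun ψ n m => φ ψ m n) v := by
  obtain ⟨η, h1, h2, h3⟩ := h
  exact ⟨η, h1, fun x y hxy => h2 x y fun r ha hb => hxy r hb ha, h3⟩

theorem Carries.smul (h : Carries a b V φ v) (s : ℂ) : Carries a b V φ (fun ψ => s • v ψ) := by
  obtain ⟨η, h1, h2, h3⟩ := h
  refine ⟨fun x => s * η x, fun ψ x => ?_, fun x y hxy => congrArg (s * ·) (h2 x y hxy), fun x hx =>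
    h3 x (right_ne_zero_of_mul hx)⟩
  beta_reduce
  rw [Pi.smul_apply, h1, smul_eq_mul]
  ring

theorem Carries.mono (h : Carries a b V φ v) {V' : Finset R} (hV : V ⊆ V') :
    Carries a b V' φ v := by
  obtain ⟨η, h1, h2, h3⟩ := h
  exact ⟨η, h1, h2, fun x hx r hr => h3 x hx r fun h => hr (hV h)⟩

/-- Configurations that do not fit are left alone by the exchange. They are harmless because the
amplitudes vanish there, or because `y` is no larger than `a` or still holds `0`. -/
theorem Carries.exch (h : Carries a b V φ v) {y : R} (hay : a ≠ y) (hby : b ≠ y) (hab : a ≠ b)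
    (hy : d y ≤ d a ∨ y ∉ V) (hφ : ∀ ψ n m, d a ≤ n ∨ d y ≤ n → φ ψ n m = 0) :
    Carries y b (insert y V) φ (fun ψ => exchMat a y *ᵥ v ψ) := by
  obtain ⟨η, h1, h2, h3⟩ := h
  -- After the exchange `a` holds the former content of `y`, so the old factor is evaluated with the
  -- content of `a` put back into `y`.
  refine ⟨fun x => if h : (x a : ℕ) < d y then η (Function.update x y ⟨x a, h⟩) else 0, ?_, ?_, ?_⟩
  · intro ψ x
    beta_reduce
    rw [exchMat_mulVec, h1]
    have hb : RepeaterNet.exch a y x b = x b := exch_apply_of_ne hab.symm hby x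
    rw [hb]
    by_cases ha : (x a : ℕ) < d y
    · rw [dif_pos ha]
      by_cases hy' : (x y : ℕ) < d a
      · have e : RepeaterNet.exch a y x = Function.update (Function.update x a ⟨x y, hy'⟩) y
          ⟨x a, ha⟩ := dif_pos ⟨ha, hy'⟩
        have e1 : ((RepeaterNet.exch a y x) a : ℕ) = x y := by rw [e]; simp [hay]
        rw [e1]
        congr 1
        refine h2 _ _ fun r hra hrb => ?_
        rw [e]
        by_cases hr : r = y
        · subst hr; simp
        · simp [hr, hra]
      · have e : RepeaterNet.exch a y x = x := dif_neg fun h => hy' h.2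
        rw [e, hφ ψ (x y) _ (Or.inl (not_lt.1 hy')), zero_mul]
        rcases hy with hy | hy
        · exact absurd (lt_of_lt_of_le (x y).2 hy) hy'
        · by_cases hη : η x = 0
          · rw [hη, mul_zero]
          · have h4 := h3 x hη y hy
            have := (x a).2
            omega
    · have e : RepeaterNet.exch a y x = x := dif_neg fun h => ha h.1
      rw [dif_neg ha, e, hφ ψ (x a) _ (Or.inr (not_lt.1 ha)), zero_mul, mul_zero]
  · intro x x' hxx
    have ha := hxx a hay hab
    by_cases h : (x a : ℕ) < d y
    · have h' : (x' a : ℕ) < d y := by rw [← ha]; exact h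
      dsimp only
      rw [dif_pos h, dif_pos h']
      refine h2 _ _ fun r hra hrb => ?_
      by_cases hr : r = y
      · subst hr; simp [ha]
      · simp [hr, hxx r hr hrb]
    · have h' : ¬ (x' a : ℕ) < d y := by rw [← ha]; exact h
      dsimp only
      rw [dif_neg h, dif_neg h']
  · intro x hx r hr
    simp only [Finset.mem_insert, not_or] at hr
    dsimp only at hx
    split_ifs at hx with h
    · have := h3 _ hx r hr.2
      rwa [Function.update_of_ne hr.1] at this
    · exact absurd rfl hx

/-- An operator away from `a` and `b` changes only the factor `η`, and only the registers of `T` can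
leave the state `0`. -/
theorem Carries.mulVec (h : Carries a b V φ v) {T : Finset R}
    {M : Matrix (∀ r, Fin (d r)) (∀ r, Fin (d r)) ℂ} (hM : ActsOnlyOn (T : Set R) M)
    (ha : a ∉ T) (hb : b ∉ T) : Carries a b (V ∪ T) φ (fun ψ => M *ᵥ v ψ) := by
  obtain ⟨η, h1, h2, h3⟩ := h
  refine ⟨M *ᵥ η, ?_, ?_, ?_⟩
  · intro ψ x
    simp only [Matrix.mulVec, dotProduct, Finset.mul_sum]
    refine Finset.sum_congr rfl fun w _ => ?_
    rw [h1]
    by_cases hw : ∃ r, r ∉ T ∧ x r ≠ w r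
    · rw [hM.1 x w (by simpa using hw)]; ring
    · push Not at hw
      rw [hw a ha, hw b hb]; ring
  · intro x y hxy
    refine hM.mulVec_apply_congr (fun r hr => ?_) fun w w' hw hw' hww => h2 _ _ fun r hra hrb => ?_
    · have hr' : r ∈ T := hr
      exact hxy r (fun h => ha (h ▸ hr')) (fun h => hb (h ▸ hr'))
    · by_cases hr : r ∈ T
      · exact hww r hr
      · rw [hw r (by simpa using hr), hw' r (by simpa using hr), hxy r hra hrb]
  · intro x hx r hr
    simp only [Finset.mem_union, not_or] at hr
    obtain ⟨w, _, hw⟩ := Finset.exists_ne_zero_of_sum_ne_zero hx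
    have hη := h3 w (right_ne_zero_of_mul hw) r hr.1
    have : x r = w r := by
      by_contra hne
      exact left_ne_zero_of_mul hw (hM.1 x w ⟨r, by simpa using hr.2, hne⟩)
    rw [this, hη]

/-- Up to the factor `1 / D`, teleportation is the exchange of `a` and `y`. The pair must be fresh,
which is what `hxV` and `hyV` record. -/
theorem Carries.teleport {D : ℕ} [NeZero D] (h : Carries a b V φ v) {x y : R} (hax : a ≠ x)
    (hay : a ≠ y) (hxy : x ≠ y) (hab : a ≠ b) (hby : b ≠ y) (ha : d a = D) (hx : d x = D)
    (hy : d y = D) (hxV : x ∉ V) (hyV : y ∉ V) (hφ : ∀ ψ n m, D ≤ n → φ ψ n m = 0)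
    (k : Fin D × Fin D) :
    Carries y b (insert y V) φ (fun ψ =>
      (regLens y hy).lift (corrMat k) *ᵥ ((pairLens a x hax ha hx).lift (bellKraus k) *ᵥ
      ((pairLens x y hxy hx hy).lift bellMat *ᵥ v ψ))) := by
  have hv : ∀ ψ u, v ψ u ≠ 0 → (u x : ℕ) = 0 ∧ (u y : ℕ) = 0 := by
    obtain ⟨η, h1, h2, h3⟩ := h
    intro ψ u hu
    rw [h1] at hu
    exact ⟨h3 u (right_ne_zero_of_mul hu) x hxV, h3 u (right_ne_zero_of_mul hu) y hyV⟩
  have h' := (h.exch hay hby hab (Or.inr hyV) (fun ψ n m hn => hφ ψ n m (by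
    rw [ha, hy] at hn; exact hn.elim id id))).smul (D : ℂ)⁻¹
  refine (congrArg _ (funext fun ψ => ?_)).mp h'
  exact (RepeaterNet.teleport hax hay hxy ha hx hy k (v ψ) (hv ψ)).symm

theorem Carries.pairLens {D : ℕ} (h : Carries a b V φ v) (hab : a ≠ b) (ha : d a = D)
    (hb : d b = D) {A : Matrix (Fin D × Fin D) (Fin D × Fin D) ℂ} {φ' : Ψ → ℕ → ℕ → ℂ}
    (hA : ∀ ψ, A *ᵥ (fun p => φ ψ p.1 p.2) = fun p => φ' ψ p.1 p.2) :
    Carries a b V φ' (fun ψ => (RepeaterNet.pairLens a b hab ha hb).lift A *ᵥ v ψ) := by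
  obtain ⟨η, h1, h2, h3⟩ := h
  refine ⟨η, ?_, h2, h3⟩
  intro ψ x
  beta_reduce
  rw [Lens.lift_mulVec]
  have := congrFun (hA ψ) ((RepeaterNet.pairLens a b hab ha hb).get x)
  simp only [Matrix.mulVec, dotProduct] at this
  have e : φ' ψ (x a) (x b) = φ' ψ (((RepeaterNet.pairLens a b hab ha hb).get x).1)
    (((RepeaterNet.pairLens a b hab ha hb).get x).2) := rfl
  rw [e, ← this, Finset.sum_mul]
  refine Finset.sum_congr rfl fun i _ => ?_
  rw [h1, mul_assoc]
  congr 2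
  · congr 1
    · simp [RepeaterNet.pairLens, hab]
    · simp [RepeaterNet.pairLens]
  · refine h2 _ _ fun r hra hrb => ?_
    simp [RepeaterNet.pairLens, hra, hrb]

end Carries

/-! ### Reordering commuting operations -/

section Reorder

variable {α M : Type} [DecidableEq α] [Monoid M]

/-- `l'` arises from `l` by interchanging neighbours that commute according to `c`. -/
def reorders (c : α → α → Bool) : List α → List α → Bool
  | l, [] => l.isEmpty
  | l, a :: l' => l.contains a && (l.takeWhile (· ≠ a)).all (c a) && reorders c (l.erase a) l'

theorem List.exists_takeWhile_erase {a : α} {l : List α} (h : a ∈ l) :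
    ∃ r, l = l.takeWhile (· ≠ a) ++ a :: r ∧ l.erase a = l.takeWhile (· ≠ a) ++ r := by
  induction l with
  | nil => simp at h
  | cons b l ih =>
    by_cases hb : b = a
    · subst hb
      exact ⟨l, by simp, by simp⟩
    · have h' : a ∈ l := by simpa [Ne.symm hb] using h
      obtain ⟨r, h1, h2⟩ := ih h'
      refine ⟨r, ?_, ?_⟩
      · simp only [ne_eq, hb, not_false_eq_true, decide_true, List.takeWhile_cons_of_pos,
          List.cons_append, List.cons.injEq, true_and]
        exact h1
      · rw [List.erase_cons_tail (by simpa using hb)]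
        simp only [ne_eq, hb, not_false_eq_true, decide_true, List.takeWhile_cons_of_pos,
          List.cons_append, List.cons.injEq, true_and]
        exact h2

/-- The head of `l'` commutes with all that precedes it in `l`, so it can be made to act first; then
induction on the rest. -/
theorem prod_eq_of_reorders (c : α → α → Bool) (f : α → M)
    (hc : ∀ a b, c a b = true → Commute (f a) (f b)) (l l' : List α) (h : reorders c l l' = true) :
    (l.map f).reverse.prod = (l'.map f).reverse.prod := by
  induction l' generalizing l with
  | nil =>
    have : l = [] := by simpa [reorders] using h
    rw [this]
  | cons a l' ih =>
    simp only [reorders, Bool.and_eq_true, List.contains_iff_mem, List.all_eq_true] at h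
    obtain ⟨⟨h1, h2⟩, h3⟩ := h
    obtain ⟨r, e1, e2⟩ := List.exists_takeWhile_erase h1
    have ih' := ih _ h3
    rw [e2] at ih'
    set p := l.takeWhile (· ≠ a)
    have hcomm : Commute (f a) (p.map f).reverse.prod := by
      refine Commute.list_prod_right _ _ fun m hm => ?_
      obtain ⟨b, hb, rfl⟩ := List.mem_map.1 (List.mem_reverse.1 hm)
      exact hc _ _ (h2 b hb)
    rw [e1]
    simp only [List.map_append, List.map_cons, List.reverse_append, List.reverse_cons,
      List.prod_append, List.prod_cons, List.prod_nil, mul_one] at ih' ⊢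
    rw [← ih', mul_assoc, mul_assoc, hcomm.eq]

theorem prod_mulVec_eq_foldl {X : Type} [Fintype X] [DecidableEq X] (f : α → Matrix X X ℂ)
    (l : List α) (v : X → ℂ) :
    (l.map f).reverse.prod *ᵥ v = l.foldl (fun w a => f a *ᵥ w) v := by
  induction l generalizing v with
  | nil => simp
  | cons a l ih => simp [← ih, Matrix.mulVec_mulVec]

end Reorder

/-! ### The schedule of the teleportation protocol -/

/-- The operations of the teleportation protocol. The arm `s` is that of `A` (`false`) or of `B`
(`true`), the hop `i` is the one next to the end node (`false`) or the one next to the central node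
(`true`), and the pair `r` of a hop is used on the way to (`false`) or from (`true`) the central
node. -/
inductive Step : Type
  | load (s : Bool) : Step
  | unload (s : Bool) : Step
  | prep (s i r : Bool) : Step
  | bell (s i : Bool) : Step
  | corr (s i : Bool) : Step
  | gate : Step
  | rbell (s i : Bool) : Step
  | rcorr (s i : Bool) : Step
  | rswap (s i : Bool) : Step
  deriving DecidableEq

namespace Step

/-- The position of an operation in the schedule. -/
def phase : Step → Fin 6
  | load _ => 0
  | unload _ => 5
  | prep _ _ _ => 0
  | bell _ i => bif i then 2 else 1
  | corr _ i => bif i then 3 else 2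
  | gate => 3
  | rbell _ i => bif i then 3 else 4
  | rcorr _ i => bif i then 4 else 5
  | rswap _ i => bif i then 4 else 5

/-- The operations in chronological order. -/
def prog : List Step :=
  [load false, load true,
    prep false false false, prep false false true, prep false true false, prep false true true,
    prep true false false, prep true false true, prep true true false, prep true true true,
    bell false false, bell true false,
    corr false false, corr true false, bell false true, bell true true,
    corr false true, corr true true, gate, rbell false true, rbell true true,
    rcorr false true, rcorr true true, rswap false true, rswap true true,
    rbell false false, rbell true false,
    rcorr false false, rcorr true false, rswap false false, rswap true false,
    unload false, unload true]

/-- The operations in an order in which each entangled pair is used up when it has been made. -/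
def nested : List Step :=
  [load false, load true,
    prep false false false, bell false false, corr false false,
    prep true false false, bell true false, corr true false,
    prep false true false, bell false true, corr false true,
    prep true true false, bell true true, corr true true,
    gate,
    prep false true true, rbell false true, rcorr false true, rswap false true,
    prep true true true, rbell true true, rcorr true true, rswap true true,
    prep false false true, rbell false false, rcorr false false, rswap false false,
    prep true false true, rbell true false, rcorr true false, rswap true false,
    unload false, unload true]

theorem mem_prog (a : Step) : a ∈ prog := by
  rcases a with _ | _ | ⟨s, i, r⟩ | ⟨s, i⟩ | ⟨s, i⟩ | _ | ⟨s, i⟩ | ⟨s, i⟩ | ⟨s, i⟩ <;>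
    (try cases ‹Bool›) <;> (try cases ‹Bool›) <;> (try cases ‹Bool›) <;> decide

theorem nodup_prog : prog.Nodup := by decide

/-- The number of an operation. -/
def idx (a : Step) : Fin prog.length := ⟨prog.idxOf a, List.idxOf_lt_length_of_mem (mem_prog a)⟩

theorem get_idx (a : Step) : prog.get a.idx = a := by
  simp [idx]

theorem idx_get (e : Fin prog.length) : (prog.get e).idx = e := by
  apply Fin.ext
  simp [idx, nodup_prog.idxOf_getElem]

theorem phase_mono : Monotone fun e => phase (prog.get e) := by
  have h : prog.Pairwise (fun a b => phase a ≤ phase b) := by decide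
  intro e e' hee
  rcases hee.eq_or_lt with rfl | hlt
  · exact le_rfl
  · exact List.pairwise_iff_get.1 h e e' hlt

theorem idx_lt {a : Step} {e : Fin prog.length} (h : phase a < phase (prog.get e)) :
    a.idx < e := by
  by_contra hle
  have := phase_mono (not_lt.1 hle)
  simp only [get_idx] at this
  exact absurd h (not_lt.2 this)

/-- The memory that holds the input of an arm. -/
def lIx (s : Bool) : Fin 10 := ⟨s.toNat, by cases s <;> decide⟩

/-- The memory of an entangled pair. -/
def fIx (s i r : Bool) : Fin 10 :=
  ⟨2 + 4 * s.toNat + 2 * i.toNat + r.toNat, by cases s <;> cases i <;> cases r <;> decide⟩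

/-- The photon of an entangled pair. -/
def pIx (s i r : Bool) : Fin 8 :=
  ⟨4 * s.toNat + 2 * i.toNat + r.toNat, by cases s <;> cases i <;> cases r <;> decide⟩

/-- The memory that holds the state that is to be teleported over a hop. -/
def qIx (s i : Bool) : Fin 10 := bif i then fIx s false false else lIx s

/-- The input system of an arm. -/
def rin (s : Bool) : Reg 10 8 := bif s then .inB else .inA

/-- The registers on which an operation acts. -/
def supp : Step → Finset (Reg 10 8)
  | load s => {rin s, .mem (lIx s)}
  | unload s => {.mem (lIx s), rin s}
  | prep s i r => {.photon (pIx s i r), .mem (fIx s i r)}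
  | bell s i => {.mem (qIx s i), .photon (pIx s i false)}
  | corr s i => {.mem (fIx s i false)}
  | gate => {.mem (fIx false true false), .mem (fIx true true false)}
  | rbell s i => {.mem (fIx s i false), .mem (fIx s i true)}
  | rcorr s i => {.photon (pIx s i true)}
  | rswap s i => {.photon (pIx s i true), .mem (qIx s i)}

/-- Operations on disjoint registers commute. In the nested order preparation, measurement and
correction of each pair are consecutive, as `teleport` requires, although chronologically all pairs
are prepared at the start. -/
theorem reorders_nested :
    reorders (fun a b => decide (Disjoint (supp a) (supp b))) prog nested = true := by
  decide +kernel

section Mat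

variable {dA dB D : ℕ} [NeZero D]

/-- The dimensions of the registers. -/
abbrev dims (dA dB D : ℕ) : Reg 10 8 → ℕ := regDim dA dB (fun _ => D) (fun _ => D)

theorem fIx_ne (s i : Bool) : (Reg.mem (fIx s i false) : Reg 10 8) ≠ .mem (fIx s i true) := by
  cases s <;> cases i <;> decide

theorem gate_ne : (Reg.mem (fIx false true false) : Reg 10 8) ≠ .mem (fIx true true false) := by
  decide

/-- The Kraus operators of the operations, when the hops `act` are in use and the outcomes are
`out`. -/
def mat (hA : dA ≤ D) (hB : dB ≤ D) (U : Matrix (Fin dA × Fin dB) (Fin dA × Fin dB) ℂ)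
    (act : Bool → Bool → Bool) (out : Step → Fin D × Fin D) :
    Step → Matrix (∀ r, Fin (dims dA dB D r)) (∀ r, Fin (dims dA dB D r)) ℂ
  | load s => (D : ℂ)⁻¹ • exchMat (rin s) (.mem (lIx s))
  | unload s => (D : ℂ)⁻¹ • exchMat (.mem (lIx s)) (rin s)
  | prep s i false => (D : ℂ)⁻¹ • (pairLens (D := D) (d := dims dA dB D) (.photon (pIx s i false))
      (.mem (fIx s i false)) (by simp) rfl rfl).lift bellMat
  | prep s i true => (D : ℂ)⁻¹ • (pairLens (D := D) (d := dims dA dB D) (.mem (fIx s i true))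
      (.photon (pIx s i true)) (by simp) rfl rfl).lift bellMat
  | bell s i => if act s i then (pairLens (D := D) (d := dims dA dB D) (.mem (qIx s i))
      (.photon (pIx s i false)) (by simp) rfl rfl).lift (bellKraus (out (bell s i)))
      else (D : ℂ)⁻¹ • 1
  | corr s i => (D : ℂ)⁻¹ • if act s i then (regLens (D := D) (d := dims dA dB D)
      (.mem (fIx s i false)) rfl).lift (corrMat (out (bell s i))) else 1
  | gate => (D : ℂ)⁻¹ • if act false true && act true true then
      (pairLens (D := D) (d := dims dA dB D) (.mem (fIx false true false)) (.mem (fIx true true false))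
        gate_ne rfl rfl).lift (padMat hA hB U) else 1
  | rbell s i => if act s i then (pairLens (D := D) (d := dims dA dB D) (.mem (fIx s i false))
      (.mem (fIx s i true)) (fIx_ne s i) rfl rfl).lift (bellKraus (out (rbell s i)))
      else (D : ℂ)⁻¹ • 1
  | rcorr s i => (D : ℂ)⁻¹ • if act s i then (regLens (D := D) (d := dims dA dB D)
      (.photon (pIx s i true)) rfl).lift (corrMat (out (rbell s i))) else 1
  | rswap s i => (D : ℂ)⁻¹ • if act s i then exchMat (.photon (pIx s i true)) (.mem (qIx s i)) else 1

variable (hA : dA ≤ D) (hB : dB ≤ D) (U : Matrix (Fin dA × Fin dB) (Fin dA × Fin dB) ℂ)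
  (act : Bool → Bool → Bool) (out : Step → Fin D × Fin D)

theorem actsOnlyOn_mat (a : Step) :
    ActsOnlyOn (supp a : Set (Reg 10 8)) (mat hA hB U act out a) := by
  rcases a with s | s | ⟨s, i, r⟩ | ⟨s, i⟩ | ⟨s, i⟩ | _ | ⟨s, i⟩ | ⟨s, i⟩ | ⟨s, i⟩
  · exact ((actsOnlyOn_exchMat _ _).mono (by simp [supp])).smul _
  · exact ((actsOnlyOn_exchMat _ _).mono (by simp [supp])).smul _
  · cases r
    · exact ((actsOnlyOn_pairLens _ _ _ _ _ _).mono (by simp [supp])).smul _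
    · exact ((actsOnlyOn_pairLens _ _ _ _ _ _).mono (by simp [supp, Set.pair_comm])).smul _
  · simp only [mat]
    split_ifs
    · exact (actsOnlyOn_pairLens _ _ _ _ _ _).mono (by simp [supp])
    · exact (ActsOnlyOn.one _).smul _
  · refine ActsOnlyOn.smul ?_ _
    split_ifs
    · exact (actsOnlyOn_regLens _ _ _).mono (by simp [supp])
    · exact ActsOnlyOn.one _
  · refine ActsOnlyOn.smul ?_ _
    split_ifs
    · exact (actsOnlyOn_pairLens _ _ _ _ _ _).mono (by simp [supp])
    · exact ActsOnlyOn.one _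
  · simp only [mat]
    split_ifs
    · exact (actsOnlyOn_pairLens _ _ _ _ _ _).mono (by simp [supp])
    · exact (ActsOnlyOn.one _).smul _
  · refine ActsOnlyOn.smul ?_ _
    split_ifs
    · exact (actsOnlyOn_regLens _ _ _).mono (by simp [supp])
    · exact ActsOnlyOn.one _
  · refine ActsOnlyOn.smul ?_ _
    split_ifs
    · exact (actsOnlyOn_exchMat _ _).mono (by simp [supp])
    · exact ActsOnlyOn.one _

theorem prod_mat_prog : (prog.map (mat hA hB U act out)).reverse.prod =
    (nested.map (mat hA hB U act out)).reverse.prod := by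
  refine prod_eq_of_reorders _ _ (fun a b hab => ?_) _ _ reorders_nested
  refine ActsOnlyOn.commute ?_ (actsOnlyOn_mat hA hB U act out a) (actsOnlyOn_mat hA hB U act out b)
  exact Finset.disjoint_coe.2 (of_decide_eq_true hab)

end Mat

end Step

/-! ### The net effect of the schedule -/

theorem pad_of_le_left {dA dB n : ℕ} (ψ : Fin dA × Fin dB → ℂ) (m : ℕ) (h : dA ≤ n) :
    pad ψ n m = 0 := dif_neg fun h' => absurd h'.1 (not_lt.2 h)

theorem pad_of_le_right {dA dB m : ℕ} (ψ : Fin dA × Fin dB → ℂ) (n : ℕ) (h : dB ≤ m) :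
    pad ψ n m = 0 := dif_neg fun h' => absurd h'.2 (not_lt.2 h)

namespace Step

variable {dA dB D : ℕ} [NeZero D] (hA : dA ≤ D) (hB : dB ≤ D)
  (U : Matrix (Fin dA × Fin dB) (Fin dA × Fin dB) ℂ)
  (act : Bool → Bool → Bool) (out : Step → Fin D × Fin D)

section Blocks

variable {Ψ : Type} {a b : Reg 10 8} {V : Finset (Reg 10 8)} {φ : Ψ → ℕ → ℕ → ℂ}
  {v : Ψ → (∀ r, Fin (dims dA dB D r)) → ℂ}

/-- An active hop is a teleportation. For an inactive one the pair is still prepared, but away from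
the state, and the other two operations are scalars. -/
theorem carries_forward (s i : Bool) (h : Carries a b V φ v)
    (ha : act s i = true → a = .mem (qIx s i)) (hab : a ≠ b)
    (ha' : a ∉ supp (prep s i false)) (hb' : b ∉ supp (prep s i false))
    (hpV : (.photon (pIx s i false) : Reg 10 8) ∉ V) (hfV : (.mem (fIx s i false) : Reg 10 8) ∉ V)
    (hφ : ∀ ψ n m, D ≤ n → φ ψ n m = 0) :
    Carries (bif act s i then .mem (fIx s i false) else a) b (V ∪ supp (prep s i false)) φ
      (fun ψ => mat hA hB U act out (corr s i) *ᵥ (mat hA hB U act out (bell s i) *ᵥ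
        (mat hA hB U act out (prep s i false) *ᵥ v ψ))) := by
  by_cases hact : act s i = true
  · obtain rfl := ha hact
    simp only [mat, hact, if_true, cond_true, Matrix.smul_mulVec, Matrix.mulVec_smul]
    refine Carries.mono ((((h.teleport (D := D) ?_ ?_ ?_ hab ?_ rfl rfl rfl hpV hfV hφ
      (out (bell s i))).smul (D : ℂ)⁻¹).smul (D : ℂ)⁻¹)) ?_
    · simp only [supp, Finset.mem_insert, Finset.mem_singleton, not_or] at ha'
      exact ha'.2
    · simp only [supp, Finset.mem_insert, Finset.mem_singleton, not_or] at hb'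
      exact hb'.2
    · intro r hr
      simp only [supp, Finset.mem_insert, Finset.mem_union, Finset.mem_singleton] at hr ⊢
      tauto
  · have hact' : act s i = false := by simpa using hact
    simp only [mat, hact', if_false, cond_false, Matrix.smul_mulVec, Matrix.mulVec_smul,
      Matrix.one_mulVec, Bool.false_eq_true]
    have h1 := (actsOnlyOn_pairLens (D := D) (d := dims dA dB D) (.photon (pIx s i false))
      (.mem (fIx s i false)) (by simp) rfl rfl bellMat).mono
      (T := (supp (prep s i false) : Set (Reg 10 8))) (by simp [supp])
    exact (((h.mulVec h1 ha' hb').smul (D : ℂ)⁻¹).smul (D : ℂ)⁻¹).smul (D : ℂ)⁻¹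

/-- The return teleports into the photon at the outer node. The final exchange puts the state back
into the memory from which the hop started, so that active and inactive hops end alike. -/
theorem carries_back (s i : Bool)
    (h : Carries (bif act s i then .mem (fIx s i false) else a) b V φ v)
    (ha : act s i = true → a = .mem (qIx s i)) (hab : a ≠ b)
    (hfb : (.mem (fIx s i false) : Reg 10 8) ≠ b)
    (ha' : a ∉ supp (prep s i true)) (hb' : b ∉ supp (prep s i true))
    (hpV : (.photon (pIx s i true) : Reg 10 8) ∉ V) (hfV : (.mem (fIx s i true) : Reg 10 8) ∉ V)
    (hφ : ∀ ψ n m, D ≤ n → φ ψ n m = 0) :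
    Carries a b (V ∪ supp (prep s i true) ∪ {.mem (qIx s i)}) φ
      (fun ψ => mat hA hB U act out (rswap s i) *ᵥ (mat hA hB U act out (rcorr s i) *ᵥ
        (mat hA hB U act out (rbell s i) *ᵥ (mat hA hB U act out (prep s i true) *ᵥ v ψ)))) := by
  by_cases hact : act s i = true
  · obtain rfl := ha hact
    simp only [supp, Finset.mem_insert, Finset.mem_singleton, not_or] at hb' ha'
    rw [hact, cond_true] at h
    simp only [mat, hact, if_true, Matrix.smul_mulVec, Matrix.mulVec_smul]
    have h1 := h.teleport (D := D) (x := .mem (fIx s i true)) (y := .photon (pIx s i true))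
      (fIx_ne s i) (by simp) (by simp) hfb hb'.1 rfl rfl rfl hfV hpV hφ (out (rbell s i))
    have h2 := h1.exch (y := .mem (qIx s i)) (by simp) hab.symm (Ne.symm hb'.1)
      (Or.inl le_rfl) (fun ψ n m hn => hφ ψ n m (hn.elim id id))
    refine Carries.mono (((h2.smul (D : ℂ)⁻¹).smul (D : ℂ)⁻¹).smul (D : ℂ)⁻¹) ?_
    intro r hr
    simp only [supp, Finset.mem_insert, Finset.mem_union, Finset.mem_singleton] at hr ⊢
    tauto
  · have hact' : act s i = false := by simpa using hact
    rw [hact', cond_false] at h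
    simp only [mat, hact', if_false, Matrix.smul_mulVec, Matrix.mulVec_smul,
      Matrix.one_mulVec, Bool.false_eq_true]
    have h1 := (actsOnlyOn_pairLens (D := D) (d := dims dA dB D) (.mem (fIx s i true))
      (.photon (pIx s i true)) (by simp) rfl rfl bellMat).mono
      (T := (supp (prep s i true) : Set (Reg 10 8))) (by simp [supp, Set.pair_comm])
    exact ((((((h.mulVec h1 ha' hb').smul (D : ℂ)⁻¹).smul (D : ℂ)⁻¹).smul (D : ℂ)⁻¹).smul
      (D : ℂ)⁻¹)).mono Finset.subset_union_left

theorem carries_load (s : Bool) (h : Carries (rin s) b V φ v) (hb : .mem (lIx s) ≠ b)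
    (hab : rin s ≠ b) (hlV : (.mem (lIx s) : Reg 10 8) ∉ V)
    (hφ : ∀ ψ n m, dims dA dB D (rin s) ≤ n → φ ψ n m = 0)
    (hD : ∀ ψ n m, D ≤ n → φ ψ n m = 0) :
    Carries (.mem (lIx s)) b (insert (.mem (lIx s)) V) φ
      (fun ψ => mat hA hB U act out (load s) *ᵥ v ψ) := by
  simp only [mat, Matrix.smul_mulVec]
  exact (h.exch (by cases s <;> simp [rin]) hb.symm hab (Or.inr hlV)
    fun ψ n m hn => hn.elim (hφ ψ n m) (hD ψ n m)).smul _

theorem carries_unload (s : Bool) (h : Carries (.mem (lIx s)) b V φ v) (hb : .mem (lIx s) ≠ b)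
    (hab : rin s ≠ b) (hle : dims dA dB D (rin s) ≤ D)
    (hφ : ∀ ψ n m, dims dA dB D (rin s) ≤ n → φ ψ n m = 0)
    (hD : ∀ ψ n m, D ≤ n → φ ψ n m = 0) :
    Carries (rin s) b (insert (rin s) V) φ
      (fun ψ => mat hA hB U act out (unload s) *ᵥ v ψ) := by
  simp only [mat, Matrix.smul_mulVec]
  exact (h.exch (by cases s <;> simp [rin]) hab.symm hb (Or.inl hle)
    fun ψ n m hn => hn.elim (hD ψ n m) (hφ ψ n m)).smul _

end Blocks

/-- The register that holds the state of an arm after its first hop. -/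
def loc₁ (s : Bool) : Reg 10 8 := bif act s false then .mem (fIx s false false) else .mem (lIx s)

/-- The register that holds the state of an arm after its second hop. -/
def loc₂ (s : Bool) : Reg 10 8 := bif act s true then .mem (fIx s true false) else loc₁ act s

theorem loc₁_mem (s : Bool) : loc₁ act s ∈
    ({.mem (lIx s), .mem (fIx s false false)} : Finset (Reg 10 8)) := by
  unfold loc₁
  cases act s false <;> simp

theorem loc₂_mem (s : Bool) : loc₂ act s ∈
    ({.mem (lIx s), .mem (fIx s false false), .mem (fIx s true false)} : Finset (Reg 10 8)) := by
  have := loc₁_mem act s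
  unfold loc₂
  cases act s true
  · simp only [cond_false, Finset.mem_insert, Finset.mem_singleton] at this ⊢
    tauto
  · simp

theorem ne_of_disjoint {α : Type} {S T : Finset α} {x y : α} (hx : x ∈ S) (hy : y ∈ T)
    (h : Disjoint S T) : x ≠ y := fun e => Finset.disjoint_left.1 h hx (e ▸ hy)

theorem notMem_of_disjoint {α : Type} {S T : Finset α} {x : α} (hx : x ∈ S)
    (h : Disjoint S T) : x ∉ T := Finset.disjoint_left.1 h hx

theorem carries_gate {V : Finset (Reg 10 8)}
    {v : (Fin dA × Fin dB → ℂ) → (∀ r, Fin (dims dA dB D r)) → ℂ}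
    (h : Carries (loc₂ act false) (loc₂ act true) V pad v) :
    Carries (loc₂ act false) (loc₂ act true) V
      (fun ψ => pad ((if act false true && act true true then U else 1) *ᵥ ψ))
      (fun ψ => mat hA hB U act out gate *ᵥ v ψ) := by
  by_cases hg : (act false true && act true true) = true
  · have hg' := hg
    rw [Bool.and_eq_true] at hg'
    have e1 : loc₂ act false = .mem (fIx false true false) := by simp [loc₂, hg'.1]
    have e2 : loc₂ act true = .mem (fIx true true false) := by simp [loc₂, hg'.2]
    rw [e1, e2] at h ⊢
    simp only [mat, hg, if_true, Matrix.smul_mulVec]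
    exact (h.pairLens gate_ne rfl rfl (φ' := fun ψ => pad (U *ᵥ ψ))
      (fun ψ => padMat_mulVec hA hB U ψ)).smul _
  · simp only [mat, hg, if_false, Matrix.smul_mulVec, Matrix.one_mulVec, Bool.false_eq_true]
    exact h.smul _

/-- The net effect of all operations. -/
theorem carries_final (hact : ∀ s, act s true = true → act s false = true)
    (v : (Fin dA × Fin dB → ℂ) → (∀ r, Fin (dims dA dB D r)) → ℂ)
    (h : Carries .inA .inB {.inA, .inB} pad v) : ∃ V, Carries .inA .inB V
      (fun ψ => pad ((if act false true && act true true then U else 1) *ᵥ ψ))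
      (fun ψ => (prog.map (mat hA hB U act out)).reverse.prod *ᵥ v ψ) := by
  simp only [prod_mat_prog, prod_mulVec_eq_foldl, nested, List.foldl_cons, List.foldl_nil]
  have p1 : ∀ (ψ : Fin dA × Fin dB → ℂ) n m, D ≤ n → pad ψ n m = 0 := fun ψ n m hn =>
    pad_of_le_left ψ m (hA.trans hn)
  have p2 : ∀ (ψ : Fin dA × Fin dB → ℂ) n m, D ≤ m → pad ψ n m = 0 := fun ψ n m hm =>
    pad_of_le_right ψ n (hB.trans hm)
  have q1 : ∀ (ψ : Fin dA × Fin dB → ℂ) n m, dA ≤ n → pad ψ n m = 0 := fun ψ n m hn =>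
    pad_of_le_left ψ m hn
  have q2 : ∀ (ψ : Fin dA × Fin dB → ℂ) n m, dB ≤ m → pad ψ n m = 0 := fun ψ n m hm =>
    pad_of_le_right ψ n hm
  -- The location of a state depends on which hops are active. The finitely many candidates suffice
  -- to decide that the registers of the next operation are different.
  have l1 := loc₁_mem act
  have l2 := loc₂_mem act
  have ha1 : ∀ s, act s true = true → loc₁ act s = .mem (qIx s true) := by
    intro s hs
    simp [loc₁, hact s hs, qIx]
  replace h := carries_load hA hB U act out false h (by decide) (by decide) (by decide) q1 p1
  replace h := (carries_load hA hB U act out true h.symm (by decide) (by decide) (by decide)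
    (fun ψ n m => q2 ψ m n) (fun ψ n m => p2 ψ m n)).symm
  replace h := carries_forward hA hB U act out false false h (fun _ => rfl) (by decide) (by decide)
    (by decide) (by decide) (by decide) p1
  change Carries (loc₁ act false) _ _ _ _ at h
  replace h := (carries_forward hA hB U act out true false h.symm (fun _ => rfl)
    (ne_of_disjoint (Finset.mem_singleton_self _) (l1 false) (by decide)) (by decide)
    (notMem_of_disjoint (l1 false) (by decide)) (by decide) (by decide)
    (fun ψ n m => p2 ψ m n)).symm
  change Carries _ (loc₁ act true) _ _ _ at h
  replace h := carries_forward hA hB U act out false true h (ha1 false)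
    (ne_of_disjoint (l1 false) (l1 true) (by decide)) (notMem_of_disjoint (l1 false) (by decide))
    (notMem_of_disjoint (l1 true) (by decide)) (by decide) (by decide) p1
  change Carries (loc₂ act false) _ _ _ _ at h
  replace h := (carries_forward hA hB U act out true true h.symm (ha1 true)
    (ne_of_disjoint (l1 true) (l2 false) (by decide)) (notMem_of_disjoint (l1 true) (by decide))
    (notMem_of_disjoint (l2 false) (by decide)) (by decide) (by decide)
    (fun ψ n m => p2 ψ m n)).symm
  change Carries _ (loc₂ act true) _ _ _ at h
  replace h := carries_gate hA hB U act out h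
  replace h := carries_back hA hB U act out false true (a := loc₁ act false) h (ha1 false)
    (ne_of_disjoint (l1 false) (l2 true) (by decide))
    (ne_of_disjoint (Finset.mem_singleton_self _) (l2 true) (by decide))
    (notMem_of_disjoint (l1 false) (by decide))
    (notMem_of_disjoint (l2 true) (by decide)) (by decide) (by decide) (fun ψ => p1 _)
  replace h := (carries_back hA hB U act out true true (a := loc₁ act true) h.symm (ha1 true)
    (ne_of_disjoint (l1 true) (l1 false) (by decide))
    (ne_of_disjoint (Finset.mem_singleton_self _) (l1 false) (by decide))
    (notMem_of_disjoint (l1 true) (by decide))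
    (notMem_of_disjoint (l1 false) (by decide)) (by decide) (by decide)
    (fun ψ n m => p2 _ m n)).symm
  replace h := carries_back hA hB U act out false false (a := .mem (lIx false)) h (fun _ => rfl)
    (ne_of_disjoint (Finset.mem_singleton_self _) (l1 true) (by decide))
    (ne_of_disjoint (Finset.mem_singleton_self _) (l1 true) (by decide)) (by decide)
    (notMem_of_disjoint (l1 true) (by decide)) (by decide) (by decide) (fun ψ => p1 _)
  replace h := (carries_back hA hB U act out true false (a := .mem (lIx true)) h.symm (fun _ => rfl)
    (by decide) (by decide) (by decide) (by decide) (by decide) (by decide)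
    (fun ψ n m => p2 _ m n)).symm
  replace h := carries_unload hA hB U act out false h (by decide) (by decide) hA (fun ψ => q1 _)
    (fun ψ => p1 _)
  replace h := (carries_unload hA hB U act out true h.symm (by decide) (by decide) hB
    (fun ψ n m => q2 _ m n) (fun ψ n m => p2 _ m n)).symm
  exact ⟨_, h⟩

end Step

theorem Layout.sum_initial_norm_sq {K dA dB : ℕ} (P : Layout K dA dB)
    (ψ : Fin dA × Fin dB → ℂ) : ∑ x, ‖P.initial ψ x‖ ^ 2 = ∑ q, ‖ψ q‖ ^ 2 := by
  classical
  symm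
  refine Fintype.sum_of_injective (fun q : Fin dA × Fin dB => (fun r => match r with
    | .inA => q.1
    | .inB => q.2
    | .mem i => P.memInit i
    | .photon j => P.photonInit j : P.Cfg)) ?_ _ _ ?_ ?_
  · intro q q' h
    exact Prod.ext (congrFun h .inA) (congrFun h .inB)
  · intro x hx
    rw [Layout.initial, if_neg, norm_zero, zero_pow two_ne_zero]
    rintro ⟨h1, h2⟩
    refine hx ⟨(x .inA, x .inB), ?_⟩
    funext r
    cases r with
    | inA => rfl
    | inB => rfl
    | mem i => exact (h1 i).symm
    | photon j => exact (h2 j).symm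
  · intro q
    rw [Layout.initial, if_pos ⟨fun _ => rfl, fun _ => rfl⟩]

theorem Protocol.sum_final_norm_sq {K dA dB : ℕ} {c : ℝ} {pos : Fin (K + 2) → ℝ} {t : ℝ}
    (P : Protocol K dA dB c pos t) (a₀ : Fin P.k) (lost : Fin P.n → Bool)
    (ψ : Fin dA × Fin dB → ℂ) :
    ∑ o, ∑ x, ‖P.final (lost, o) ψ x‖ ^ 2 = ∑ q, ‖ψ q‖ ^ 2 := by
  rw [← P.sum_initial_norm_sq ψ]
  exact sum_opProd_norm_sq a₀ (fun e o => P.kraus e (lost, o)) (P.kraus_causal lost)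
    (fun e o => P.kraus_complete e (lost, o)) (P.initial ψ)

/-! ### Placing the schedule in space and time -/

/-- The nodes and times of the teleportation protocol. The arm `s` consists of the nodes `v s 0`
(the end node), `v s 1` and `v s 2` (the central node), where neighbouring nodes may coincide;
operations of phase `i` take place at time `τ i`. -/
structure Plan (K : ℕ) (c : ℝ) (pos : Fin (K + 2) → ℝ) where
  v : Bool → Fin 3 → Fin (K + 2)
  τ : Fin 6 → ℝ
  v_A : v false 0 = 0
  v_B : v true 0 = Fin.last (K + 1)
  v_center : v true 2 = v false 2
  τ_zero : τ 0 = 0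
  τ_mono : Monotone τ
  photon₁ : ∀ s, Reaches c (pos (v s 1)) 0 (pos (v s 0)) (τ 1)
  photon₂ : ∀ s, Reaches c (pos (v s 2)) 0 (pos (v s 1)) (τ 2)
  reach₁₂ : ∀ s, Reaches c (pos (v s 0)) (τ 1) (pos (v s 1)) (τ 2)
  reach₂₃ : ∀ s, Reaches c (pos (v s 1)) (τ 2) (pos (v s 2)) (τ 3)
  reach₃₄ : ∀ s, Reaches c (pos (v s 2)) (τ 3) (pos (v s 1)) (τ 4)
  reach₄₅ : ∀ s, Reaches c (pos (v s 1)) (τ 4) (pos (v s 0)) (τ 5)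

namespace Plan

open Step

variable {K : ℕ} {c : ℝ} {pos : Fin (K + 2) → ℝ} (Q : Plan K c pos)

/-- The node of a hop that is nearer to the end node. -/
def near (s i : Bool) : Fin (K + 2) := bif i then Q.v s 1 else Q.v s 0

/-- The node of a hop that is nearer to the central node. -/
def far (s i : Bool) : Fin (K + 2) := bif i then Q.v s 2 else Q.v s 1

/-- The node at which an operation takes place. -/
def nodeOf : Step → Fin (K + 2)
  | load s => Q.v s 0
  | unload s => Q.v s 0
  | prep s i _ => Q.far s i
  | bell s i => Q.near s i
  | corr s i => Q.far s i
  | gate => Q.v false 2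
  | rbell s i => Q.far s i
  | rcorr s i => Q.near s i
  | rswap s i => Q.near s i

/-- The arm to which a photon belongs. -/
def photonArm (j : Fin 8) : Bool := decide (4 ≤ (j : ℕ))

/-- The hop to which a photon belongs. -/
def photonHop (j : Fin 8) : Bool := decide (2 ≤ (j : ℕ) % 4)

theorem photonArm_pIx (s i r : Bool) : photonArm (pIx s i r) = s := by
  cases s <;> cases i <;> cases r <;> rfl

theorem photonHop_pIx (s i r : Bool) : photonHop (pIx s i r) = i := by
  cases s <;> cases i <;> cases r <;> rfl

/-- The source of a photon of a hop. -/
def srcOf (s i : Bool) : Fin (K + 2) := Q.far s i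

/-- The destination of a photon of a hop; if the nodes of the hop coincide, the photon stays where
it is during the whole protocol. -/
def dstOf (s i : Bool) : Fin (K + 2) :=
  if Q.near s i = Q.far s i then (if Q.far s i = 0 then Fin.last (K + 1) else 0) else Q.near s i

/-- The departure time of a photon of a hop. -/
def depOf (s i : Bool) : ℝ := if Q.near s i = Q.far s i then Q.τ 5 else 0

theorem τ_nonneg (i : Fin 6) : 0 ≤ Q.τ i := Q.τ_zero ▸ Q.τ_mono (Fin.zero_le i)

/-- The layout of the teleportation protocol. -/
@[reducible] def layout (dA dB D : ℕ) [NeZero D] : Layout K dA dB where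
  m := 10
  n := 8
  N := prog.length
  k := D * D
  memDim _ := D
  memInit _ := 0
  memNode := ![Q.v false 0, Q.v true 0, Q.v false 1, Q.v false 1, Q.v false 2, Q.v false 2,
    Q.v true 1, Q.v true 1, Q.v true 2, Q.v true 2]
  photonDim _ := D
  photonInit _ := 0
  src j := Q.srcOf (photonArm j) (photonHop j)
  dst j := Q.dstOf (photonArm j) (photonHop j)
  dep j := Q.depOf (photonArm j) (photonHop j)
  node e := Q.nodeOf (prog.get e)
  time e := Q.τ (phase (prog.get e))

/-- Both photons of a hop have arrived, or none had to be sent. -/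
def ok (lost : Fin 8 → Bool) (s i : Bool) : Bool :=
  decide (Q.near s i = Q.far s i) || (!lost (pIx s i false) && !lost (pIx s i true))

/-- The hop can be used. -/
def act (lost : Fin 8 → Bool) (s i : Bool) : Bool := Q.ok lost s false && (!i || Q.ok lost s true)

theorem act_true {lost : Fin 8 → Bool} {s : Bool} (h : Q.act lost s true = true) :
    Q.act lost s false = true := by
  simp only [act, Bool.and_eq_true] at h ⊢
  simp [h.1]

theorem ok_of_act {lost : Fin 8 → Bool} {s i : Bool} (h : Q.act lost s i = true) :
    Q.ok lost s i = true := by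
  cases i <;> simp_all [act]

/-- The phase in which a hop is first used. -/
def hopPhase (i : Bool) : Fin 6 := bif i then 2 else 1

theorem photon_reaches (s i : Bool) :
    Reaches c (pos (Q.far s i)) 0 (pos (Q.near s i)) (Q.τ (hopPhase i)) := by
  cases i
  · exact Q.photon₁ s
  · exact Q.photon₂ s

section View

variable {Q} {dA dB D : ℕ} [NeZero D]

theorem arr_le (hc : 0 < c) (s i r : Bool) (h : Q.near s i ≠ Q.far s i) :
    (Q.layout dA dB D).arr c pos (pIx s i r) ≤ Q.τ (hopPhase i) := by
  have h1 := Q.photon_reaches s i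
  unfold Reaches at h1
  simp only [Layout.arr, photonArm_pIx, photonHop_pIx, srcOf, dstOf, depOf, if_neg h, zero_add]
  rw [div_le_iff₀ hc]
  linarith

theorem ok_congr (hc : 0 < c) {q : ℕ} {u : Fin (K + 2)} {T : ℝ}
    {ω ω' : (Q.layout dA dB D).Record}
    (hview : (Q.layout dA dB D).SameView c pos q u T ω ω') {s i : Bool}
    (h : Reaches c (pos (Q.near s i)) (Q.τ (hopPhase i)) (pos u) T) :
    Q.ok ω.1 s i = Q.ok ω'.1 s i := by
  unfold ok
  by_cases hnf : Q.near s i = Q.far s i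
  · simp [hnf]
  · have : ∀ r, ω.1 (pIx s i r) = ω'.1 (pIx s i r) := by
      intro r
      refine hview.1 (pIx s i r) ?_
      refine Reaches.trans (y := pos (Q.near s i)) ?_ h
      have e : (Q.layout dA dB D).dst (pIx s i r) = Q.near s i := by
        simp only [photonArm_pIx, photonHop_pIx, dstOf, if_neg hnf]
      rw [e]
      exact Reaches.of_le hc (arr_le hc s i r hnf)
    rw [this, this]

/-- Usability of the second hop also involves the first one, whose status reaches the middle node by
`reach₁₂`. -/
theorem act_congr (hc : 0 < c) {q : ℕ} {u : Fin (K + 2)} {T : ℝ}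
    {ω ω' : (Q.layout dA dB D).Record}
    (hview : (Q.layout dA dB D).SameView c pos q u T ω ω') {s i : Bool}
    (h : Reaches c (pos (Q.near s i)) (Q.τ (hopPhase i)) (pos u) T) :
    Q.act ω.1 s i = Q.act ω'.1 s i := by
  unfold act
  cases i
  · rw [ok_congr hc hview h]; simp
  · rw [ok_congr hc hview (i := true) h, ok_congr hc hview (i := false) ((Q.reach₁₂ s).trans h)]

end View

theorem reach_far (s i : Bool) : Reaches c (pos (Q.near s i)) (Q.τ (hopPhase i))
    (pos (Q.far s i)) (Q.τ (phase (corr s i))) := by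
  cases i
  · exact Q.reach₁₂ s
  · exact Q.reach₂₃ s

theorem reach_back (s i : Bool) : Reaches c (pos (Q.far s i)) (Q.τ (phase (rbell s i)))
    (pos (Q.near s i)) (Q.τ (phase (rcorr s i))) := by
  cases i
  · exact Q.reach₄₅ s
  · exact Q.reach₃₄ s

/-- For the outer hop the message may take the detour over the centre, because the return
measurement comes only after the state has had time to come back. -/
theorem reach_rbell (s i : Bool) : Reaches c (pos (Q.near s i)) (Q.τ (hopPhase i))
    (pos (Q.far s i)) (Q.τ (phase (rbell s i))) := by
  cases i
  · exact ((Q.reach₁₂ s).trans (Q.reach₂₃ s)).trans (Q.reach₃₄ s)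
  · exact Q.reach₂₃ s

theorem reach_gate (s : Bool) : Reaches c (pos (Q.near s true)) (Q.τ (hopPhase true))
    (pos (Q.v false 2)) (Q.τ (phase gate)) := by
  have := Q.reach₂₃ s
  cases s
  · exact this
  · rw [Q.v_center] at this; exact this

/-- The status of either arm goes to the centre and from there to both ends, so the two ends reach
the same verdict. -/
theorem reach_end (s s' : Bool) : Reaches c (pos (Q.near s true)) (Q.τ (hopPhase true))
    (pos (Q.v s' 0)) (Q.τ 5) := by
  have h1 := (Q.reach₃₄ s').trans (Q.reach₄₅ s')
  have h2 := Q.reach_gate s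
  have : Q.v s' 2 = Q.v false 2 := by
    cases s'
    · rfl
    · exact Q.v_center
  rw [this] at h1
  exact h2.trans h1

section Protocol

variable {dA dB D : ℕ} [NeZero D]

/-- The outcomes of the Bell measurements. -/
def outc (o : Fin prog.length → Fin (D * D)) (a : Step) : Fin D × Fin D :=
  finProdFinEquiv.symm (o a.idx)

theorem outc_update_self (o : Fin prog.length → Fin (D * D)) (e : Fin prog.length)
    (q : Fin (D * D)) : outc (Function.update o e q) (prog.get e) = finProdFinEquiv.symm q := by
  rw [outc, idx_get, Function.update_self]

theorem outc_update_of_ne (o : Fin prog.length → Fin (D * D)) (e : Fin prog.length)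
    (q : Fin (D * D)) {a : Step} (h : prog.get e ≠ a) :
    outc (Function.update o e q) a = outc o a := by
  rw [outc, Function.update_of_ne, outc]
  intro he
  exact h (by rw [← he, get_idx])

/-- All operations of a layout have the same number of outcomes. A deterministic one is given `D *
D` equally likely outcomes that nobody uses. -/
theorem sum_scaled {X : Type} [Fintype X] [DecidableEq X] {M : Matrix X X ℂ} (hM : Mᴴ * M = 1) :
    ∑ _q : Fin (D * D), ((D : ℂ)⁻¹ • M)ᴴ * ((D : ℂ)⁻¹ • M) = 1 := by
  have hD : (D : ℂ) ≠ 0 := Nat.cast_ne_zero.2 (NeZero.ne D)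
  simp only [Matrix.conjTranspose_smul, Matrix.smul_mul, Matrix.mul_smul, hM, Finset.sum_const,
    Finset.card_univ, Fintype.card_fin, smul_smul]
  rw [← Nat.cast_smul_eq_nsmul ℂ, smul_smul]
  simp only [star_inv₀, star_natCast, Nat.cast_mul]
  have : (D : ℂ) * D * ((D : ℂ)⁻¹ * (D : ℂ)⁻¹) = 1 := by field_simp
  rw [this, one_smul]

theorem sum_bell {X : Type} [Fintype X] [DecidableEq X] (l : Lens X (Fin D × Fin D)) :
    ∑ q : Fin (D * D), (l.lift (bellKraus (finProdFinEquiv.symm q)))ᴴ *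
      l.lift (bellKraus (finProdFinEquiv.symm q)) = 1 := by
  simp only [l.lift_conjTranspose, l.lift_mul, l.lift_sum]
  rw [finProdFinEquiv.symm.sum_comp (fun k => (bellKraus (D := D) k)ᴴ * bellKraus k),
    sum_bellKraus, l.lift_one]

variable (hA : dA ≤ D) (hB : dB ≤ D) {U : Matrix (Fin dA × Fin dB) (Fin dA × Fin dB) ℂ}

theorem sum_mat (hU : Uᴴ * U = 1) (a : Bool → Bool → Bool) (o : Fin prog.length → Fin (D * D))
    (e : Fin prog.length) :
    ∑ q, (mat hA hB U a (outc (Function.update o e q)) (prog.get e))ᴴ *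
      mat hA hB U a (outc (Function.update o e q)) (prog.get e) = 1 := by
  have h1 := outc_update_self o e
  have h2 : ∀ q {b : Step}, prog.get e ≠ b → outc (Function.update o e q) b = outc o b :=
    fun q b => outc_update_of_ne o e q
  generalize prog.get e = b at h1 h2
  rcases b with s | s | ⟨s, i, r⟩ | ⟨s, i⟩ | ⟨s, i⟩ | _ | ⟨s, i⟩ | ⟨s, i⟩ | ⟨s, i⟩
  · exact sum_scaled (exchMat_conjTranspose_mul_self (by cases s <;> decide))
  · exact sum_scaled (exchMat_conjTranspose_mul_self (by cases s <;> decide))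
  · cases r
    · exact sum_scaled (Lens.lift_conjTranspose_mul_self _ bellMat_conjTranspose_mul)
    · exact sum_scaled (Lens.lift_conjTranspose_mul_self _ bellMat_conjTranspose_mul)
  · simp only [mat, h1]
    by_cases h : a s i = true
    · simp only [h, if_true]
      exact sum_bell _
    · simp only [h, if_false, Bool.false_eq_true]
      exact sum_scaled (by simp)
  · simp only [mat, h2 _ (show corr s i ≠ bell s i by simp)]
    refine sum_scaled ?_
    split_ifs
    · exact Lens.lift_conjTranspose_mul_self _ (corrMat_conjTranspose_mul _)
    · simp
  · simp only [mat]
    refine sum_scaled ?_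
    split_ifs
    · exact Lens.lift_conjTranspose_mul_self _ (extendMat_conjTranspose_mul _ hU)
    · simp
  · simp only [mat, h1]
    by_cases h : a s i = true
    · simp only [h, if_true]
      exact sum_bell _
    · simp only [h, if_false, Bool.false_eq_true]
      exact sum_scaled (by simp)
  · simp only [mat, h2 _ (show rcorr s i ≠ rbell s i by simp)]
    refine sum_scaled ?_
    split_ifs
    · exact Lens.lift_conjTranspose_mul_self _ (corrMat_conjTranspose_mul _)
    · simp
  · simp only [mat]
    refine sum_scaled ?_
    split_ifs
    · exact exchMat_conjTranspose_mul_self (by simp)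
    · simp

theorem mem_f_regsAt (s i r : Bool) (T : ℝ) (lost : Fin 8 → Bool) :
    (.mem (fIx s i r) : Reg 10 8) ∈ (Q.layout dA dB D).regsAt c pos (Q.far s i) T lost := by
  cases s <;> cases i <;> cases r <;> rfl

theorem mem_q_regsAt (s i : Bool) (T : ℝ) (lost : Fin 8 → Bool) :
    (.mem (qIx s i) : Reg 10 8) ∈ (Q.layout dA dB D).regsAt c pos (Q.near s i) T lost := by
  cases s <;> cases i <;> rfl

theorem rin_regsAt (s : Bool) (T : ℝ) (lost : Fin 8 → Bool) :
    rin s ∈ (Q.layout dA dB D).regsAt c pos (Q.v s 0) T lost := by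
  cases s
  · exact Q.v_A
  · exact Q.v_B

theorem photon_src_regsAt (s i r : Bool) (lost : Fin 8 → Bool) :
    (.photon (pIx s i r) : Reg 10 8) ∈ (Q.layout dA dB D).regsAt c pos (Q.far s i) 0 lost := by
  refine Or.inl ⟨?_, ?_⟩
  · simp only [photonArm_pIx, photonHop_pIx, srcOf]
  · simp only [photonArm_pIx, photonHop_pIx, depOf]
    split_ifs
    · exact Q.τ_nonneg 5
    · exact le_rfl

theorem photon_dst_regsAt (hc : 0 < c) (s i r : Bool) {p : Fin 6} (hp : hopPhase i ≤ p)
    {lost : Fin 8 → Bool} (hok : Q.act lost s i = true) :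
    (.photon (pIx s i r) : Reg 10 8) ∈
      (Q.layout dA dB D).regsAt c pos (Q.near s i) (Q.τ p) lost := by
  by_cases hnf : Q.near s i = Q.far s i
  · refine Or.inl ⟨?_, ?_⟩
    · simp only [photonArm_pIx, photonHop_pIx, srcOf, hnf]
    · simp only [photonArm_pIx, photonHop_pIx, depOf, if_pos hnf]
      exact Q.τ_mono (Fin.le_last p)
  · refine Or.inr ⟨?_, (arr_le hc s i r hnf).trans (Q.τ_mono hp), ?_⟩
    · simp only [photonArm_pIx, photonHop_pIx, dstOf, if_neg hnf]
    · have := Q.ok_of_act hok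
      simp only [ok, hnf, decide_false, Bool.false_or, Bool.and_eq_true, Bool.not_eq_true'] at this
      cases r
      · exact this.1
      · exact this.2

/-- When a hop is inactive, the operations that would need its photons at the outer node are
scalars; otherwise both photons are present there. -/
theorem mat_local (hc : 0 < c) (lost : Fin 8 → Bool) (out : Step → Fin D × Fin D) (a : Step) :
    ActsOnlyOn ((Q.layout dA dB D).regsAt c pos (Q.nodeOf a) (Q.τ (phase a)) lost)
      (mat hA hB U (Q.act lost) out a) := by
  have key : (∀ r ∈ supp a, r ∈ (Q.layout dA dB D).regsAt c pos (Q.nodeOf a) (Q.τ (phase a)) lost) →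
      ActsOnlyOn ((Q.layout dA dB D).regsAt c pos (Q.nodeOf a) (Q.τ (phase a)) lost)
      (mat hA hB U (Q.act lost) out a) := fun h =>
    (actsOnlyOn_mat hA hB U (Q.act lost) out a).mono h
  rcases a with s | s | ⟨s, i, r⟩ | ⟨s, i⟩ | ⟨s, i⟩ | _ | ⟨s, i⟩ | ⟨s, i⟩ | ⟨s, i⟩
  · refine key ?_
    simp only [supp, Finset.mem_insert, Finset.mem_singleton, forall_eq_or_imp, forall_eq]
    exact ⟨Q.rin_regsAt s _ _, Q.mem_q_regsAt s false _ _⟩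
  · refine key ?_
    simp only [supp, Finset.mem_insert, Finset.mem_singleton, forall_eq_or_imp, forall_eq]
    exact ⟨Q.mem_q_regsAt s false _ _, Q.rin_regsAt s _ _⟩
  · refine key ?_
    simp only [supp, Finset.mem_insert, Finset.mem_singleton, forall_eq_or_imp, forall_eq]
    refine ⟨?_, Q.mem_f_regsAt s i r _ _⟩
    have := Q.photon_src_regsAt (dA := dA) (dB := dB) (D := D) s i r lost
    rw [← Q.τ_zero] at this
    exact this
  · by_cases h : Q.act lost s i = true
    · refine key ?_
      simp only [supp, Finset.mem_insert, Finset.mem_singleton, forall_eq_or_imp, forall_eq]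
      exact ⟨Q.mem_q_regsAt s i _ _, Q.photon_dst_regsAt hc s i false le_rfl h⟩
    · simp only [mat, h, if_false, Bool.false_eq_true]
      exact (ActsOnlyOn.one _).smul _
  · refine key ?_
    simp only [supp, Finset.mem_singleton, forall_eq]
    exact Q.mem_f_regsAt s i false _ _
  · refine key ?_
    simp only [supp, Finset.mem_insert, Finset.mem_singleton, forall_eq_or_imp, forall_eq]
    refine ⟨Q.mem_f_regsAt false true false _ _, ?_⟩
    have := Q.mem_f_regsAt (dA := dA) (dB := dB) (D := D) true true false (Q.τ (phase gate)) lost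
    have e : Q.far true true = Q.nodeOf gate := Q.v_center
    rw [e] at this
    exact this
  · refine key ?_
    simp only [supp, Finset.mem_insert, Finset.mem_singleton, forall_eq_or_imp, forall_eq]
    exact ⟨Q.mem_f_regsAt s i false _ _, Q.mem_f_regsAt s i true _ _⟩
  · by_cases h : Q.act lost s i = true
    · refine key ?_
      simp only [supp, Finset.mem_singleton, forall_eq]
      exact Q.photon_dst_regsAt hc s i true (by cases s <;> cases i <;> decide) h
    · simp only [mat, h, if_false, Bool.false_eq_true]
      exact (ActsOnlyOn.one _).smul _
  · by_cases h : Q.act lost s i = true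
    · refine key ?_
      simp only [supp, Finset.mem_insert, Finset.mem_singleton, forall_eq_or_imp, forall_eq]
      exact ⟨Q.photon_dst_regsAt hc s i true (by cases s <;> cases i <;> decide) h, Q.mem_q_regsAt s i _ _⟩
    · simp only [mat, h, if_false, Bool.false_eq_true]
      exact (ActsOnlyOn.one _).smul _

theorem mat_congr (hc : 0 < c) (e : Fin prog.length) (ω ω' : (Q.layout dA dB D).Record)
    (hview : (Q.layout dA dB D).SameView c pos e.val (Q.nodeOf (prog.get e))
      (Q.τ (phase (prog.get e))) ω ω') (he : ω.2 e = ω'.2 e) :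
    mat hA hB U (Q.act ω.1) (outc ω.2) (prog.get e) =
      mat hA hB U (Q.act ω'.1) (outc ω'.2) (prog.get e) := by
  have hself : outc ω.2 (prog.get e) = outc ω'.2 (prog.get e) := by
    rw [outc, outc, idx_get, he]
  have hout : ∀ b : Step, phase b < phase (prog.get e) →
      Reaches c (pos (Q.nodeOf b)) (Q.τ (phase b)) (pos (Q.nodeOf (prog.get e)))
        (Q.τ (phase (prog.get e))) → outc ω.2 b = outc ω'.2 b := by
    intro b hb hr
    rw [outc, outc, hview.2 b.idx (idx_lt hb)]
    change Reaches c (pos (Q.nodeOf (prog.get b.idx))) (Q.τ (phase (prog.get b.idx))) _ _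
    rw [get_idx]
    exact hr
  have hact := fun s i => act_congr (s := s) (i := i) hc hview
  generalize prog.get e = b at hself hout hact
  rcases b with s | s | ⟨s, i, r⟩ | ⟨s, i⟩ | ⟨s, i⟩ | _ | ⟨s, i⟩ | ⟨s, i⟩ | ⟨s, i⟩
  · rfl
  · rfl
  · cases r <;> rfl
  · simp only [mat, hself, hact s i (Reaches.of_le hc le_rfl)]
  · simp only [mat, hact s i (Q.reach_far s i),
      hout (bell s i) (by cases s <;> cases i <;> decide) (Q.reach_far s i)]
  · simp only [mat, hact false true (Q.reach_gate false), hact true true (Q.reach_gate true)]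
  · simp only [mat, hself, hact s i (Q.reach_rbell s i)]
  · simp only [mat, hact s i ((Q.reach_rbell s i).trans (Q.reach_back s i)),
      hout (rbell s i) (by cases s <;> cases i <;> decide) (Q.reach_back s i)]
  · simp only [mat, hact s i ((Q.reach_rbell s i).trans (Q.reach_back s i))]

/-- The teleportation protocol: both inputs are teleported to the central node and back, and the
unitary is applied at the central node if all photons have arrived. -/
def protocol (hc : 0 < c) (hU : Uᴴ * U = 1) : Protocol K dA dB c pos (Q.τ 5) where
  toLayout := Q.layout dA dB D
  src_ne_dst j := by
    change Q.far _ _ ≠ Q.dstOf _ _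
    unfold dstOf
    split_ifs with h1 h2
    · rw [h2]; exact (Fin.last_pos).ne
    · exact h2
    · exact Ne.symm h1
  dep_nonneg j := by
    change 0 ≤ Q.depOf _ _
    unfold depOf
    split_ifs
    · exact Q.τ_nonneg 5
    · exact le_rfl
  time_nonneg e := Q.τ_nonneg _
  time_le e := Q.τ_mono (Fin.le_last _)
  time_mono := Q.τ_mono.comp phase_mono
  kraus e ω := mat hA hB U (Q.act ω.1) (outc ω.2) (prog.get e)
  kraus_congr e ω ω' := Q.mat_congr hA hB hc e ω ω'
  kraus_local e ω := Q.mat_local hA hB hc ω.1 _ _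
  kraus_complete e ω := sum_mat hA hB hU (Q.act ω.1) ω.2 e

end Protocol

/-! ### Correctness of the teleportation protocol -/

section Correctness

variable {dA dB D : ℕ} [NeZero D] (hA : dA ≤ D) (hB : dB ≤ D)
  {U : Matrix (Fin dA × Fin dB) (Fin dA × Fin dB) ℂ} (hc : 0 < c) (hU : Uᴴ * U = 1)

/-- All hops can be used. -/
def allOk (lost : Fin 8 → Bool) : Bool := Q.act lost false true && Q.act lost true true

theorem protocol_final (ω : (Q.protocol hA hB hc hU).Record) (ψ : Fin dA × Fin dB → ℂ) :
    (Q.protocol hA hB hc hU).final ω ψ =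
      (prog.map (mat hA hB U (Q.act ω.1) (outc ω.2))).reverse.prod *ᵥ
        (Q.layout dA dB D).initial ψ := by
  have : (List.ofFn fun e => (Q.protocol hA hB hc hU).kraus e ω) =
      prog.map (mat hA hB U (Q.act ω.1) (outc ω.2)) :=
    List.ofFn_getElem_eq_map prog (mat hA hB U (Q.act ω.1) (outc ω.2))
  rw [Protocol.final, this]
  rfl

open Classical in
theorem carries_initial : Carries (d := dims dA dB D) .inA .inB {.inA, .inB} pad
    (fun ψ => (Q.layout dA dB D).initial ψ) := by
  refine ⟨fun x => if (∀ i, x (.mem i) = (0 : Fin D)) ∧ (∀ j, x (.photon j) = (0 : Fin D)) then 1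
    else 0, ?_, ?_, ?_⟩
  · intro ψ x
    have hp : pad ψ (x .inA) (x .inB) = ψ (x .inA, x .inB) := dif_pos ⟨(x .inA).2, (x .inB).2⟩
    rw [hp]
    by_cases h : (∀ i, x (.mem i) = (0 : Fin D)) ∧ (∀ j, x (.photon j) = (0 : Fin D))
    · exact (if_pos h).trans ((mul_one _).symm.trans (congrArg _ (if_pos h).symm))
    · exact (if_neg h).trans ((mul_zero _).symm.trans (congrArg _ (if_neg h).symm))
  · intro x y hxy
    have h1 : ∀ i, x (.mem i) = y (.mem i) := fun i => hxy _ (by simp) (by simp)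
    have h2 : ∀ j, x (.photon j) = y (.photon j) := fun j => hxy _ (by simp) (by simp)
    simp only [h1, h2]
  · intro x hx r hr
    simp only [ne_eq, ite_eq_right_iff, one_ne_zero, imp_false, not_not] at hx
    cases r with
    | inA => simp at hr
    | inB => simp at hr
    | mem i => rw [hx.1 i]; simp
    | photon j => rw [hx.2 j]; simp

theorem protocol_applies (hA₀ : 0 < dA) (hB₀ : 0 < dB) (ω : (Q.protocol hA hB hc hU).Record) :
    (Q.protocol hA hB hc hU).Applies ω (if Q.allOk ω.1 then U else 1) := by
  obtain ⟨V, η, h1, h2, h3⟩ := carries_final hA hB U (Q.act ω.1) (outc ω.2)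
    (fun s => Q.act_true) _ Q.carries_initial
  -- `η` does not depend on the input systems, so any contents may be inserted there; `0` exists
  -- because `dA` and `dB` are positive.
  refine ⟨fun m p => η (fun r => match r with
    | .inA => ⟨0, hA₀⟩
    | .inB => ⟨0, hB₀⟩
    | .mem i => m i
    | .photon j => p j), fun ψ x => ?_⟩
  rw [protocol_final]
  refine (h1 ψ x).trans ?_
  refine congrArg₂ _ (dif_pos ⟨(x .inA).2, (x .inB).2⟩) (h2 _ _ fun r hrA hrB => ?_)
  cases r with
  | inA => exact absurd rfl hrA
  | inB => exact absurd rfl hrB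
  | mem i => rfl
  | photon j => rfl

theorem allOk_congr {q : ℕ} {ω ω' : (Q.layout dA dB D).Record} {u : Fin (K + 2)} (s : Bool)
    (hu : Q.v s 0 = u) (hc : 0 < c) (h : (Q.layout dA dB D).SameView c pos q u (Q.τ 5) ω ω') :
    Q.allOk ω.1 = Q.allOk ω'.1 := by
  subst hu
  unfold allOk
  rw [act_congr hc h (Q.reach_end false s), act_congr hc h (Q.reach_end true s)]

theorem protocol_implements (hA₀ : 0 < dA) (hB₀ : 0 < dB) (hpos : Function.Injective pos)
    {loss : ℝ → ℝ} (hloss : ∀ l : ℝ, 0 < l → 0 < loss l ∧ loss l < 1) :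
    (Q.protocol hA hB hc hU).Implements loss U := by
  set P := Q.protocol hA hB hc hU
  have hl : ∀ j, 0 < loss |pos (P.src j) - pos (P.dst j)| ∧
      loss |pos (P.src j) - pos (P.dst j)| < 1 := fun j =>
    hloss _ (abs_pos.2 (sub_ne_zero.2 (hpos.ne (P.src_ne_dst j))))
  have hw : ∀ lost, 0 < P.lossWeight pos loss lost := by
    intro lost
    refine Finset.prod_pos fun j _ => ?_
    split_ifs
    · exact (hl j).1
    · exact sub_pos.2 (hl j).2
  -- Success is a property of the loss pattern. For a fixed pattern the outcomes have total
  -- probability one on every normalized input, so the sum of the weights of the good patterns is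
  -- the success probability. It is positive because the pattern without losses is good.
  refine ⟨fun ω => Q.allOk ω.1 = true, fun ω => Q.allOk ω.1 = true, ?_, ?_, ?_, ?_, ?_,
    ∑ lost : Fin 8 → Bool, if Q.allOk lost = true then P.lossWeight pos loss lost else 0, ?_, ?_⟩
  · intro ω ω' h
    exact Eq.congr (Q.allOk_congr false Q.v_A hc h) rfl
  · intro ω ω' h
    exact Eq.congr (Q.allOk_congr true Q.v_B hc h) rfl
  · exact fun ω h => absurd Iff.rfl h
  · intro ω h _
    have := Q.protocol_applies hA hB hc hU hA₀ hB₀ ω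
    rwa [if_pos h] at this
  · intro ω h _
    have := Q.protocol_applies hA hB hc hU hA₀ hB₀ ω
    rwa [if_neg h] at this
  · refine Finset.sum_pos' (fun lost _ => ?_) ⟨fun _ => false, Finset.mem_univ _, ?_⟩
    · split_ifs
      · exact (hw lost).le
      · exact le_rfl
    · rw [if_pos (by simp [allOk, act, ok])]
      exact hw _
  · intro ψ hψ
    rw [Fintype.sum_prod_type]
    refine Finset.sum_congr rfl fun lost _ => ?_
    by_cases h : Q.allOk lost = true
    · simp only [h, and_self, if_true, Protocol.prob]
      rw [← Finset.mul_sum, P.sum_final_norm_sq (0 : Fin (D * D)), hψ, mul_one]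
    · simp [h]

end Correctness

end Plan

theorem Plan.suffAt {K : ℕ} {L c : ℝ} {pos : Fin (K + 2) → ℝ} (Q : Plan K c pos) (hc : 0 < c)
    {loss : ℝ → ℝ} (hloss : ∀ l : ℝ, 0 < l → 0 < loss l ∧ loss l < 1)
    (hpos : IsPlacement K L pos) : SuffAt K L c loss pos (Q.τ 5) := by
  refine ⟨hpos, fun dA dB hA hB U hU => ?_⟩
  -- All memories and photons get the larger input dimension, so that either input fits.
  have : NeZero (max dA dB) := ⟨(lt_max_of_lt_left hA).ne'⟩
  exact ⟨Q.protocol (le_max_left _ _) (le_max_right _ _) hc (Matrix.mem_unitaryGroup_iff'.1 hU),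
    Q.protocol_implements _ _ hc _ hA hB hpos.strictMono.injective hloss⟩

theorem SuffAt.mem_sufficientTimes {K : ℕ} {L c : ℝ} {loss : ℝ → ℝ} {pos : Fin (K + 2) → ℝ} {t : ℝ}
    (h : SuffAt K L c loss pos t) : t ∈ sufficientTimes K L c loss :=
  fun dA dB hA hB U hU => ⟨pos, h.1, h.2 dA dB hA hB U hU⟩

theorem Reaches.of_div {c l x y a b : ℝ} (hc : 0 < c) (h : |x - y| ≤ (b - a) * l) :
    Reaches c x (a * (l / c)) y (b * (l / c)) := by
  unfold Reaches
  have : c * (b * (l / c) - a * (l / c)) = (b - a) * l := by field_simp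
  rwa [this]

/-- A plan in which all positions are multiples of `L` and all times are multiples of `L / c`. -/
def Plan.ofScaled {K : ℕ} {L c : ℝ} (hL : 0 < L) (hc : 0 < c) {pos : Fin (K + 2) → ℝ}
    (x : Fin (K + 2) → ℝ) (hx : ∀ u, pos u = x u * L)
    (v : Bool → Fin 3 → Fin (K + 2)) (σ : Fin 6 → ℝ) (v_A : v false 0 = 0)
    (v_B : v true 0 = Fin.last (K + 1)) (v_center : v true 2 = v false 2) (σ_zero : σ 0 = 0)
    (σ_le : σ 3 ≤ σ 4)
    (h₁ : ∀ s, |x (v s 1) - x (v s 0)| ≤ σ 1)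
    (h₂ : ∀ s, |x (v s 2) - x (v s 1)| ≤ σ 2)
    (h₁₂ : ∀ s, |x (v s 1) - x (v s 0)| ≤ σ 2 - σ 1)
    (h₂₃ : ∀ s, |x (v s 2) - x (v s 1)| ≤ σ 3 - σ 2)
    (h₃₄ : ∀ s, |x (v s 2) - x (v s 1)| ≤ σ 4 - σ 3)
    (h₄₅ : ∀ s, |x (v s 1) - x (v s 0)| ≤ σ 5 - σ 4) : Plan K c pos := by
  have key : ∀ u w a b, |x u - x w| ≤ b - a →
      Reaches c (pos u) (a * (L / c)) (pos w) (b * (L / c)) := by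
    intro u w a b h
    refine Reaches.of_div hc ?_
    rw [hx, hx, ← sub_mul, abs_mul, abs_of_pos hL]
    exact mul_le_mul_of_nonneg_right h hL.le
  have key₀ : ∀ u w b, |x u - x w| ≤ b → Reaches c (pos u) 0 (pos w) (b * (L / c)) := by
    intro u w b h
    have := key u w 0 b (by rwa [sub_zero])
    rwa [zero_mul] at this
  refine ⟨v, fun i => σ i * (L / c), v_A, v_B, v_center, by rw [σ_zero, zero_mul], ?_,
    fun s => key₀ _ _ _ (h₁ s), fun s => key₀ _ _ _ (h₂ s),
    fun s => key _ _ _ _ (abs_sub_comm (x (v s 1)) _ ▸ h₁₂ s),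
    fun s => key _ _ _ _ (abs_sub_comm (x (v s 2)) _ ▸ h₂₃ s),
    fun s => key _ _ _ _ (h₃₄ s), fun s => key _ _ _ _ (h₄₅ s)⟩
  refine Monotone.mul_const (Fin.monotone_iff_le_succ.2 fun i => ?_) (div_pos hL hc).le
  have n := fun s i j => abs_nonneg (x (v s i) - x (v s j))
  fin_cases i
  · exact σ_zero.trans_le ((n false 1 0).trans (h₁ false))
  · exact sub_nonneg.1 ((n false 1 0).trans (h₁₂ false))
  · exact sub_nonneg.1 ((n false 2 1).trans (h₂₃ false))
  · exact σ_le
  · exact sub_nonneg.1 ((n false 1 0).trans (h₄₅ false))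

/-! ### The four placements -/

variable {L c : ℝ}

theorem isPlacement_zero (hL : 0 < L) : IsPlacement 0 L ![0, L] :=
  ⟨Fin.strictMono_iff_lt_succ.2 fun i => by fin_cases i; simpa, rfl, rfl⟩

theorem isPlacement_one (hL : 0 < L) : IsPlacement 1 L ![0, L / 2, L] :=
  ⟨Fin.strictMono_iff_lt_succ.2 fun i => by fin_cases i <;> simp <;> linarith, rfl, rfl⟩

theorem isPlacement_two (hL : 0 < L) : IsPlacement 2 L ![0, L / 5, 3 * L / 5, L] :=
  ⟨Fin.strictMono_iff_lt_succ.2 fun i => by fin_cases i <;> simp <;> linarith, rfl, rfl⟩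

theorem isPlacement_three (hL : 0 < L) : IsPlacement 3 L ![0, L / 6, L / 2, 5 * L / 6, L] :=
  ⟨Fin.strictMono_iff_lt_succ.2 fun i => by fin_cases i <;> simp <;> linarith, rfl, rfl⟩

variable {loss : ℝ → ℝ}

/-- `A` is the centre and its arm is trivial. The photons need `L / c` to reach `B`, the state of
`B` needs `L / c` to get to `A`, and as much to return. -/
theorem suffAt_zero (hL : 0 < L) (hc : 0 < c)
    (hloss : ∀ l : ℝ, 0 < l → 0 < loss l ∧ loss l < 1) :
    SuffAt 0 L c loss ![0, L] (3 * L / c) := by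
  have h := Plan.suffAt (Plan.ofScaled (K := 0) (pos := ![0, L]) hL hc ![0, 1]
    (fun u => by fin_cases u <;> simp) (fun s => bif s then ![1, 1, 0] else ![0, 0, 0])
    ![0, 1, 1, 2, 3, 3] rfl rfl rfl rfl (by simp; norm_num)
    (fun s => by cases s <;> simp) (fun s => by cases s <;> simp)
    (fun s => by cases s <;> simp) (fun s => by cases s <;> simp <;> norm_num)
    (fun s => by cases s <;> simp <;> norm_num) (fun s => by cases s <;> simp))
    hc hloss (isPlacement_zero hL)
  convert h using 1
  change _ = 3 * (L / c)
  ring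

/-- The repeater is the centre, with one hop of length `L / 2` on either side: three crossings of
such a hop. -/
theorem suffAt_one (hL : 0 < L) (hc : 0 < c)
    (hloss : ∀ l : ℝ, 0 < l → 0 < loss l ∧ loss l < 1) :
    SuffAt 1 L c loss ![0, L / 2, L] (3 * L / (2 * c)) := by
  have h := Plan.suffAt (Plan.ofScaled (K := 1) (pos := ![0, L / 2, L]) hL hc ![0, 1 / 2, 1]
    (fun u => by fin_cases u <;> simp <;> ring) (fun s => bif s then ![2, 2, 1] else ![0, 0, 1])
    ![0, 1 / 2, 1 / 2, 1, 3 / 2, 3 / 2] rfl rfl rfl rfl (by simp; norm_num)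
    (fun s => by cases s <;> simp) (fun s => by cases s <;> simp [abs_le] <;> norm_num)
    (fun s => by cases s <;> simp) (fun s => by cases s <;> simp [abs_le] <;> norm_num)
    (fun s => by cases s <;> simp [abs_le] <;> norm_num) (fun s => by cases s <;> simp))
    hc hloss (isPlacement_one hL)
  convert h using 1
  change _ = 3 / 2 * (L / c)
  field_simp

/-- The centre is at `3 * L / 5`. The first hop of `A`, of length `L / 5`, is completed just when
the photons of the hops of length `2 * L / 5` arrive on both sides of the centre. -/
theorem suffAt_two (hL : 0 < L) (hc : 0 < c)
    (hloss : ∀ l : ℝ, 0 < l → 0 < loss l ∧ loss l < 1) :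
    SuffAt 2 L c loss ![0, L / 5, 3 * L / 5, L] (7 * L / (5 * c)) := by
  have h := Plan.suffAt (Plan.ofScaled (K := 2) (pos := ![0, L / 5, 3 * L / 5, L]) hL hc
    ![0, 1 / 5, 3 / 5, 1]
    (fun u => by fin_cases u <;> simp <;> ring) (fun s => bif s then ![3, 3, 2] else ![0, 1, 2])
    ![0, 1 / 5, 2 / 5, 4 / 5, 6 / 5, 7 / 5] rfl rfl rfl rfl (by simp; norm_num)
    (fun s => by cases s <;> simp)
    (fun s => by cases s <;> simp [abs_le] <;> norm_num)
    (fun s => by cases s <;> simp <;> norm_num)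
    (fun s => by cases s <;> simp [abs_le] <;> norm_num)
    (fun s => by cases s <;> simp [abs_le] <;> norm_num)
    (fun s => by cases s <;> simp <;> norm_num))
    hc hloss (isPlacement_two hL)
  convert h using 1
  change _ = 7 / 5 * (L / c)
  field_simp

/-- Both arms have hops of lengths `L / 6` and `L / 3`. The photons of the inner hop arrive at time
`L / (3 * c)`, exactly when the outer hop is completed, so there is no waiting. -/
theorem suffAt_three (hL : 0 < L) (hc : 0 < c)
    (hloss : ∀ l : ℝ, 0 < l → 0 < loss l ∧ loss l < 1) :
    SuffAt 3 L c loss ![0, L / 6, L / 2, 5 * L / 6, L] (7 * L / (6 * c)) := by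
  have h := Plan.suffAt (Plan.ofScaled (K := 3) (pos := ![0, L / 6, L / 2, 5 * L / 6, L]) hL hc
    ![0, 1 / 6, 1 / 2, 5 / 6, 1]
    (fun u => by fin_cases u <;> simp <;> ring) (fun s => bif s then ![4, 3, 2] else ![0, 1, 2])
    ![0, 1 / 6, 2 / 6, 4 / 6, 1, 7 / 6] rfl rfl rfl rfl (by simp; norm_num)
    (fun s => by cases s <;> simp [abs_le] <;> norm_num)
    (fun s => by cases s <;> simp [abs_le] <;> norm_num)
    (fun s => by cases s <;> simp [abs_le] <;> norm_num)
    (fun s => by cases s <;> simp [abs_le] <;> norm_num)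
    (fun s => by cases s <;> simp [abs_le] <;> norm_num)
    (fun s => by cases s <;> simp [abs_le] <;> norm_num))
    hc hloss (isPlacement_three hL)
  convert h using 1
  change _ = 7 / 6 * (L / c)
  field_simp

theorem minTime_bounds {K : ℕ} {a : ℝ} {pos : Fin (K + 2) → ℝ} {t : ℝ}
    (h : SuffAt K L c loss pos t) (ha : ∀ s ∈ sufficientTimes K L c loss, a ≤ s) :
    a ≤ minTime K L c loss ∧ minTime K L c loss ≤ t :=
  ⟨le_csInf ⟨t, h.mem_sufficientTimes⟩ ha, csInf_le ⟨a, ha⟩ h.mem_sufficientTimes⟩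

end RepeaterNet

end

theorem theorem1 (L c : ℝ) (hL : 0 < L) (hc : 0 < c) (loss : ℝ → ℝ)
    (hloss : ∀ l : ℝ, 0 < l → 0 < loss l ∧ loss l < 1) :
    -- the bounds on the minimum time
    ((2 * L / c ≤ RepeaterNet.minTime 0 L c loss ∧
        RepeaterNet.minTime 0 L c loss ≤ 3 * L / c) ∧
      RepeaterNet.minTime 1 L c loss = 3 * L / (2 * c) ∧
      (5 * L / (4 * c) ≤ RepeaterNet.minTime 2 L c loss ∧
        RepeaterNet.minTime 2 L c loss ≤ 7 * L / (5 * c)) ∧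
      RepeaterNet.minTime 3 L c loss = 7 * L / (6 * c)) ∧
    -- the upper bounds are attained, with explicit placements of the repeater nodes
    (RepeaterNet.SuffAt 0 L c loss ![0, L] (3 * L / c) ∧
      RepeaterNet.SuffAt 1 L c loss ![0, L / 2, L] (3 * L / (2 * c)) ∧
      RepeaterNet.SuffAt 2 L c loss ![0, L / 5, 3 * L / 5, L] (7 * L / (5 * c)) ∧
      RepeaterNet.SuffAt 3 L c loss ![0, L / 6, L / 2, 5 * L / 6, L] (7 * L / (6 * c))) := by
  have s0 := RepeaterNet.suffAt_zero hL hc hloss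
  have s1 := RepeaterNet.suffAt_one hL hc hloss
  have s2 := RepeaterNet.suffAt_two hL hc hloss
  have s3 := RepeaterNet.suffAt_three hL hc hloss
  have b1 := RepeaterNet.minTime_bounds s1
    fun _ => RepeaterNet.three_halves_le_of_mem_sufficientTimes hc
  have b3 := RepeaterNet.minTime_bounds s3
    fun _ => RepeaterNet.seven_sixths_le_of_mem_sufficientTimes hc
  exact ⟨⟨RepeaterNet.minTime_bounds s0 fun _ => RepeaterNet.two_le_of_mem_sufficientTimes hc,
    le_antisymm b1.2 b1.1,
    RepeaterNet.minTime_bounds s2 fun _ => RepeaterNet.five_quarters_le_of_mem_sufficientTimes hc,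
    le_antisymm b3.2 b3.1⟩, s0, s1, s2, s3⟩
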